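/- Let $p$ be a prime and let $F$ be a non-archimedean local field with residue field $k_F$ of cardinality $q=p^f$, ring of integers $\mathcal O_F$ and uniformizer $\pi_F$. Let $D$ be a central division algebra over $F$ of degree $d>1$ (so $\dim_F D=d^2$), with ring of integers $\mathcal O_D$ and a uniformizer $\varpi_D$ such that $\varpi_D^d=\pi_F$. If $F$ has characteristic $0$, with ramification index $e$ over $\mathbb Q_p$, assume $p>de+1$; if $F$ has characteristic $p$, assume $\gcd(p,d)=1$. Let $k_D=\mathcal O_D/\varpi_D\mathcal O_D$, let $\sigma$ be the automorphism of $k_D$ induced by $a\mapsto\varpi_D a\varpi_D^{-1}$ on $\mathcal O_D$, fix an algebraic closure $\overline{\mathbb F}_p$ of $\mathbb F_p$ (with the discrete topology) and an embedding $k_D\hookrightarrow\overline{\mathbb F}_p$, and put $I_1=1+\varpi_D\mathcal O_D$, a normal subgroup of $D^\times$, and $D_d^\times=F^\times\mathcal O_D^\times$. For an integer $i\ge 0$ let $\chi_{\eta_i}:D_d^\times/I_1\to\overline{\mathbb F}_p^\times$ be the character that is trivial on $F^\times$ and is given on $\mathcal O_D^\times$ by inflation of the character $x\mapsto(\sigma(x)/x)^{p^i}$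 of $k_D^\times$. Let $D^\times/I_1$ act on the continuous cohomology group $H^1(I_1,\overline{\mathbb F}_p)$ (trivial coefficients) by conjugation: viewing its elements as homomorphisms $\varphi$, $(g\varphi)(x)=\varphi(g^{-1}xg)$. Then there is an isomorphism of representations of $D^\times/I_1$ $$H^1(I_1,\overline{\mathbb F}_p)\;\simeq\; H^1(1+\pi_F\mathcal O_F,\overline{\mathbb F}_p)\;\oplus\;\bigoplus_{i\in\mathbb Z/f\mathbb Z}\operatorname{Ind}_{D_d^\times/I_1}^{D^\times/I_1}\chi_{\eta_i},$$ where $D^\times/I_1$ acts trivially on $H^1(1+\pi_F\mathcal O_F,\overline{\mathbb F}_p)$ and each class $i\in\mathbb Z/f\mathbb Z$ is represented by an arbitrary non-negative integer. Up to isomorphism, $\operatorname{Ind}_{D_d^\times/I_1}^{D^\times/I_1}\chi_{\eta_i}$ depends only on $i$ modulo $f$. Moreover each character $\chi(x)=(\sigma(x)/x)^{p^i}$ of $k_D^\times$ has order $d$ in the sense that $d$ is the least integer $a\ge1$ with $\chi(\sigma^a(x))=\chi(x)$ for all $x\in k_D^\times$. -/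

import Mathlib

universe u

namespace DivAlg

section cohomology
open CategoryTheory TopRep ContRepresentation

variable (k : Type u) [CommRing k] [TopologicalSpace k] [IsTopologicalRing k]
variable (G : Type u) [Group G] [TopologicalSpace G] [IsTopologicalGroup G]

/-- The trivial `G`-representation on the coefficient field `k`. -/
abbrev trivRep : TopRep.{u} k G := TopRep.of (ContRepresentation.trivial k G k)

/-- The continuous cohomology group `H¹(G, k)` with trivial action on `k`. -/
noncomputable abbrev H1 : Type u := (continuousCohomology 1 (trivRep k G) : TopModuleCat.{u} k)

variable {G}
variable {H : Type u} [Group H] [TopologicalSpace H] [IsTopologicalGroup H]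
variable {J : Type u} [Group J] [TopologicalSpace J] [IsTopologicalGroup J]

/-- The identity of `k`, as a morphism from the restriction of the trivial representation. -/
def trivResHom (φ : H →ₜ* G) : TopRep.res (φ : H →* G) (trivRep k G) ⟶ trivRep k H :=
  TopRep.ofHom ⟨ContinuousLinearMap.id k k, fun _ => rfl⟩

/-- The pullback `H¹(G, k) → H¹(H, k)` along a continuous homomorphism `φ : H → G`. -/
noncomputable def H1map (φ : H →ₜ* G) : H1 k G →ₗ[k] H1 k H :=
  (ContinuousCohomology.map φ (trivResHom k φ) 1).hom.toLinearMap

theorem H1map_id : H1map k (ContinuousMonoidHom.id G) = LinearMap.id := by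
  have : trivResHom k (ContinuousMonoidHom.id G) = 𝟙 (trivRep k G) := rfl
  unfold H1map
  rw [this]
  have := ContinuousCohomology.map_id (trivRep k G) 1
  exact congrArg (fun f => (TopModuleCat.Hom.hom f).toLinearMap) this

theorem H1map_comp (φ : H →ₜ* G) (ψ : J →ₜ* H) :
    H1map k (φ.comp ψ) = H1map k ψ ∘ₗ H1map k φ := by
  have := ContinuousCohomology.map_comp φ ψ (trivResHom k φ) (trivResHom k ψ) 1
  exact congrArg (fun f => (TopModuleCat.Hom.hom f).toLinearMap) this


theorem cochain_invariant (F : (homogeneousCochains (trivRep k G)).X 1) (h x y : G) :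
    (F.1 : C(G, C(G, k))) (h⁻¹ * x) (h⁻¹ * y) = (F.1 : C(G, C(G, k))) x y := by
  have h1 := F.2 h
  have h2 := DFunLike.congr_fun (DFunLike.congr_fun h1 x) y
  exact h2

theorem cochain_cocycle (F : (homogeneousCochains (trivRep k G)).X 1)
    (hF : ((homogeneousCochains (trivRep k G)).d 1 2).hom F = 0) (x y w : G) :
    (F.1 : C(G, C(G, k))) y w - ((F.1 : C(G, C(G, k))) x w - (F.1 : C(G, C(G, k))) x y) = 0 := by
  have h1 := homogeneousCochains.d_apply (trivRep k G) 1 F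
  rw [hF] at h1
  have h2 : (0 : C(G, C(G, C(G, k)))) x y w = _ :=
    DFunLike.congr_fun (DFunLike.congr_fun (DFunLike.congr_fun h1 x) y) w
  exact h2.symm

theorem cochain_inner (F : (homogeneousCochains (trivRep k G)).X 1)
    (hF : ((homogeneousCochains (trivRep k G)).d 1 2).hom F = 0) (g x y : G) :
    (F.1 : C(G, C(G, k))) (g⁻¹ * x * g) (g⁻¹ * y * g) = (F.1 : C(G, C(G, k))) x y := by
  have a := cochain_invariant k F g (x * g) (y * g)
  have b := cochain_invariant k F y⁻¹ 1 g
  have c := cochain_invariant k F x⁻¹ 1 g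
  have d := cochain_cocycle k F hF x (x * g) (y * g)
  have e := cochain_cocycle k F hF x y (y * g)
  simp only [inv_inv, mul_one, ← mul_assoc] at a b c d e ⊢
  rw [a]
  linear_combination d - e + b - c

variable (G)
/-- The inner automorphism `x ↦ g⁻¹ x g`. -/
def innerHom (g : G) : G →ₜ* G where
  toMonoidHom := (MulAut.conj g⁻¹).toMonoidHom
  continuous_toFun := by
    change Continuous fun x : G => g⁻¹ * x * (g⁻¹)⁻¹
    fun_prop

theorem H1map_inner (g : G) : H1map k (innerHom G g) = LinearMap.id := by
  have key : ContinuousCohomology.cocyclesMap (innerHom G g) (trivResHom k (innerHom G g)) 1 = 𝟙 _ := by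
    rw [← cancel_mono (HomologicalComplex.iCycles _ _)]
    simp only [HomologicalComplex.cyclesMap_i, Category.id_comp]
    ext z
    set F := (HomologicalComplex.iCycles (homogeneousCochains (trivRep k G)) 1).hom z with hFdef
    have hF : ((homogeneousCochains (trivRep k G)).d 1 2).hom F = 0 := by
      have := HomologicalComplex.iCycles_d (homogeneousCochains (trivRep k G)) 1 2
      exact congrArg (fun f => (TopModuleCat.Hom.hom f) z) this
    refine Subtype.ext ?_
    refine ContinuousMap.ext fun x => ContinuousMap.ext fun y => ?_
    have h := cochain_inner k F hF g x y
    refine Eq.trans ?_ h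
    change (F.1 : C(G, C(G, k))) (g⁻¹ * x * (g⁻¹)⁻¹) (g⁻¹ * y * (g⁻¹)⁻¹) = _
    rw [inv_inv]
  have h2 := ContinuousCohomology.π_map (innerHom G g) (trivResHom k (innerHom G g)) 1
  rw [key, Category.id_comp] at h2
  have : ContinuousCohomology.map (innerHom G g) (trivResHom k (innerHom G g)) 1 = 𝟙 _ := by
    rw [← cancel_epi (ContinuousCohomology.π (trivRep k G) 1), h2, Category.comp_id]
  exact congrArg (fun f => (TopModuleCat.Hom.hom f).toLinearMap) this

variable {G}
variable (N : Subgroup G) [N.Normal]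

/-- For `N` normal in `G`, the automorphism `x ↦ g⁻¹ x g` of `N`. -/
def conjHom (g : G) : N →ₜ* N where
  toMonoidHom := (MulAut.conjNormal g⁻¹ : MulAut N).toMonoidHom
  continuous_toFun := by
    refine Continuous.subtype_mk (f := fun x : N => g⁻¹ * (x : G) * (g⁻¹)⁻¹) ?_ _
    fun_prop

/-- The conjugation action of `G` on `H¹(N, k)`: the element `g` acts by pullback along
`x ↦ g⁻¹ x g`; on homomorphisms, `(g • φ) x = φ (g⁻¹ x g)`. -/
noncomputable def conjRep : Representation k G (H1 k N) where
  toFun g := H1map k (conjHom N g)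
  map_one' := by
    have : conjHom N 1 = ContinuousMonoidHom.id N := by
      ext x; change (1 : G)⁻¹ * (x : G) * ((1 : G)⁻¹)⁻¹ = x; simp
    rw [this, H1map_id]; rfl
  map_mul' g h := by
    have : conjHom N (g * h) = (conjHom N h).comp (conjHom N g) := by
      ext x
      change (g * h)⁻¹ * (x : G) * ((g * h)⁻¹)⁻¹ = h⁻¹ * (g⁻¹ * (x : G) * (g⁻¹)⁻¹) * (h⁻¹)⁻¹
      group
    rw [this, H1map_comp]; rfl

instance conjRep_isTrivial : Representation.IsTrivial ((conjRep k N).comp N.subtype) where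
  out g := H1map_inner k N g

/-- The conjugation action on `H¹(N, k)` is trivial on `N`; this is the induced action of
`G ⧸ N`. -/
noncomputable def conjRepQuotient : Representation k (G ⧸ N) (H1 k N) :=
  (conjRep k N).ofQuotient N

end cohomology

open ValuativeRel

section K
variable {F K : Type*} [NontriviallyNormedField F] [IsUltrametricDist F] [CompleteSpace F]
  [Field K] [Algebra F K] [FiniteDimensional F K]

theorem norm_algebraNorm_le_one_iff (y : K) :
    ‖Algebra.norm F y‖ ≤ 1 ↔ spectralNorm F K y ≤ 1 := by
  have hint : IsIntegral F y := Algebra.IsIntegral.isIntegral y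
  rw [Algebra.norm_eq_norm_adjoin, ← IntermediateField.adjoin.powerBasis_gen hint,
    Algebra.PowerBasis.norm_gen_eq_coeff_zero_minpoly,
    IntermediateField.adjoin.powerBasis_gen hint,
    IntermediateField.minpoly_gen, spectralNorm.spectralNorm_eq_norm_coeff_zero_rpow]
  simp only [norm_pow, norm_mul, norm_neg, norm_one, one_pow, one_mul]
  rw [pow_le_one_iff_of_nonneg (norm_nonneg _) Module.finrank_pos.ne']
  have hd : 0 < (minpoly F y).natDegree := minpoly.natDegree_pos hint
  have hd' : (0 : ℝ) < 1 / (minpoly F y).natDegree := by positivity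
  constructor
  · intro h
    exact Real.rpow_le_one (norm_nonneg _) h hd'.le
  · intro h
    by_contra! h1
    exact absurd h (not_le.2 (Real.one_lt_rpow h1 hd'))

theorem norm_algebraNorm_one_add_le_one {y : K} (h : ‖Algebra.norm F y‖ ≤ 1) :
    ‖Algebra.norm F (1 + y)‖ ≤ 1 := by
  rw [norm_algebraNorm_le_one_iff] at h ⊢
  refine (isNonarchimedean_spectralNorm 1 y).trans ?_
  simp [h, spectralNorm_one]

end K

theorem det_smul_eq {F K D : Type*} [Field F] [Field K] [Algebra F K] [FiniteDimensional F K]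
    [Ring D] [Algebra F D] [FiniteDimensional F D] [Module K D] [IsScalarTower F K D]
    (y : K) (x : D) (h : ∀ z : D, y • z = x * z) :
    Algebra.norm F x = Algebra.norm F y ^ Module.finrank K D := by
  have : Module.Finite K D := Module.Finite.of_restrictScalars_finite F K D
  have h1 := LinearMap.det_restrictScalars (R := F) (S := K) (A := D)
    (f := LinearMap.lsmul K D y)
  have h2 : (LinearMap.lsmul K D y).det = y ^ Module.finrank K D := by
    have : LinearMap.lsmul K D y = y • LinearMap.id := by ext; simp
    rw [this, LinearMap.det_smul]; simp
  rw [h2, map_pow] at h1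
  rw [← h1, Algebra.norm_apply]
  congr 1
  ext z
  simp [h]

section D
variable {F D : Type*} [NontriviallyNormedField F] [IsUltrametricDist F] [CompleteSpace F]
  [DivisionRing D] [Algebra F D] [FiniteDimensional F D]

theorem norm_algebraNorm_one_add_le_one' {x : D} (h : ‖Algebra.norm F x‖ ≤ 1) :
    ‖Algebra.norm F (1 + x)‖ ≤ 1 := by
  let K := Algebra.adjoin F {x}
  have hK : IsField K := by
    have : Algebra.IsIntegral F K := inferInstance
    exact isField_of_isIntegral_of_isField' (Field.toIsField F)
  let : Field K := { (inferInstance : CommRing K), hK.toField with }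
  let y : K := ⟨x, Algebra.self_mem_adjoin_singleton F x⟩
  have e1 := det_smul_eq (F := F) y x (fun z => rfl)
  have e2 := det_smul_eq (F := F) (1 + y) (1 + x) (fun z => rfl)
  have hp : Module.finrank K D ≠ 0 := by
    have : Module.Finite K D := Module.Finite.of_restrictScalars_finite F K D
    exact Module.finrank_pos.ne'
  rw [e1, norm_pow, pow_le_one_iff_of_nonneg (norm_nonneg _) hp] at h
  rw [e2, norm_pow, pow_le_one_iff_of_nonneg (norm_nonneg _) hp]
  exact norm_algebraNorm_one_add_le_one h

end D

section val
variable (F D : Type*) [Field F] [ValuativeRel F] [TopologicalSpace F]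
  [IsNonarchimedeanLocalField F] [DivisionRing D] [Algebra F D] [FiniteDimensional F D]

variable {D} in
open scoped Valued in
theorem valuation_algebraNorm_one_add_le_one {x : D}
    (h : valuation F (Algebra.norm F x) ≤ 1) : valuation F (Algebra.norm F (1 + x)) ≤ 1 := by
  let := IsTopologicalAddGroup.rightUniformSpace F
  have := isUniformAddGroup_of_addCommGroup (G := F)
  let : (Valued.v (R := F)).RankOne :=
  { hom' := IsRankLeOne.nonempty.some.emb (R := F).comp MonoidWithZeroHom.ValueGroup₀.embedding
    strictMono' := IsRankLeOne.nonempty.some.strictMono.comp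
        MonoidWithZeroHom.ValueGroup₀.embedding_strictMono }
  let : NontriviallyNormedField F := Valued.toNontriviallyNormedField F (ValueGroupWithZero F)
  have : IsUltrametricDist F := inferInstance
  have key := norm_algebraNorm_one_add_le_one' (F := F) (D := D) (x := x)
  have e (z : F) : ‖z‖ ≤ 1 ↔ valuation F z ≤ 1 := Valued.toNormedField.norm_le_one_iff
  rw [e, e] at key
  exact key h

/-- The valuation of the division algebra `D`, written multiplicatively:
`x ↦ v_F(N_{D/F}(x))`, where `N_{D/F}` is the norm of the regular representation. If `D` is
central of degree `d` over `F`, then `N_{D/F} = Nrd ^ d`, so that in additive notation this is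
`ν_F ∘ N_{D/F} = d² ν_D` for the valuation `ν_D = (1/d) ν_F ∘ Nrd` of `D`. -/
noncomputable def val : Valuation D (ValueGroupWithZero F) where
  toFun x := valuation F (Algebra.norm F x)
  map_zero' := by simp
  map_one' := by simp
  map_mul' := by simp
  map_add_le_max' x y := by
    wlog hxy : valuation F (Algebra.norm F x) ≤ valuation F (Algebra.norm F y) generalizing x y
    · rw [add_comm, max_comm]; exact this y x (le_of_not_ge hxy)
    rw [max_eq_right hxy]
    rcases eq_or_ne y 0 with rfl | hy
    · have : x = 0 := by simpa [Algebra.norm_eq_zero_iff] using hxy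
      simp [this]
    · have hN : valuation F (Algebra.norm F y) ≠ 0 := by
        simpa [Algebra.norm_eq_zero_iff] using hy
      have h1 : x = x * y⁻¹ * y := by simp [hy]
      have h2 : x + y = (1 + x * y⁻¹) * y := by rw [add_mul, ← h1, one_mul, add_comm]
      rw [h2, map_mul, map_mul]
      refine mul_le_of_le_one_left' (valuation_algebraNorm_one_add_le_one F ?_)
      rw [h1, map_mul, map_mul] at hxy
      exact le_of_mul_le_mul_right (by simpa using hxy) (zero_lt_iff.2 hN)


variable {F D} in
theorem val_apply (x : D) : val F D x = valuation F (Algebra.norm F x) := rfl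

/-- The ring of integers `𝒪_D`. -/
noncomputable abbrev intRing : Subring D := (val F D).integer

/-- The maximal ideal of `𝒪_D`, i.e. the elements of positive valuation. -/
noncomputable def maxIdeal : Ideal (intRing F D) where
  carrier := {x | val F D x < 1}
  zero_mem' := by simp
  add_mem' {x y} hx hy := by
    have := (val F D).map_add_lt (g := 1) hx hy
    simpa using this
  smul_mem' c x hx := by
    have hc : val F D c ≤ 1 := c.2
    have hx : val F D x < 1 := hx
    simpa using mul_lt_one_of_nonneg_of_lt_one_right hc zero_le hx

variable {F D} in
theorem mem_maxIdeal (x : intRing F D) : x ∈ maxIdeal F D ↔ val F D x < 1 := Iff.rfl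

instance : (maxIdeal F D).IsTwoSided where
  mul_mem_of_left {a} b ha := by
    rw [mem_maxIdeal] at ha ⊢
    have hb : val F D b ≤ 1 := b.2
    simpa using mul_lt_one_of_nonneg_of_lt_one_left zero_le ha hb

/-- The residue ring `k_D = 𝒪_D / 𝔪_D`. -/
abbrev resRing : Type _ := intRing F D ⧸ maxIdeal F D

/-- The subgroup `I₁ = 1 + 𝔪_D` of `Dˣ`. For a uniformizer `ϖ` this is `1 + ϖ 𝒪_D`,
see `mem_I₁_iff`. -/
noncomputable def I₁ : Subgroup Dˣ where
  carrier := {u | val F D (u - 1) < 1}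
  one_mem' := by simp
  mul_mem' {a b} ha hb := by
    have ha : val F D (a - 1) < 1 := ha
    have hb : val F D (b - 1) < 1 := hb
    have h : ((a * b : Dˣ) : D) - 1 = (a - 1) * (b - 1) + ((a - 1) + (b - 1)) := by
      push_cast; noncomm_ring
    change val F D _ < 1
    rw [h]
    refine (val F D).map_add_lt ?_ ((val F D).map_add_lt ha hb)
    rw [map_mul]
    exact mul_lt_one_of_nonneg_of_lt_one_left zero_le ha hb.le
  inv_mem' {a} ha := by
    have ha : val F D (a - 1) < 1 := ha
    have h1 : val F D a = 1 := by
      have := (val F D).map_one_add_of_lt ha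
      simpa using this
    have h : ((a⁻¹ : Dˣ) : D) - 1 = -((a⁻¹ : Dˣ) : D) * (a - 1) := by
      rw [mul_sub, neg_mul, Units.inv_mul, mul_one]; abel
    change val F D _ < 1
    rw [h, map_mul, Valuation.map_neg, Units.val_inv_eq_inv_val, map_inv₀, h1]
    simpa using ha

variable {F D} in
theorem mem_I₁ (u : Dˣ) : u ∈ I₁ F D ↔ val F D (u - 1) < 1 := Iff.rfl

variable {F D} in
theorem val_conj (u : Dˣ) (x : D) :
    val F D ((u : D) * x * ((u⁻¹ : Dˣ) : D)) = val F D x := by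
  have h : val F D u ≠ 0 := by simp
  rw [map_mul, map_mul, Units.val_inv_eq_inv_val, map_inv₀, mul_comm, inv_mul_cancel_left₀ h]

instance : (I₁ F D).Normal where
  conj_mem a ha g := by
    rw [mem_I₁] at ha ⊢
    have h : ((g * a * g⁻¹ : Dˣ) : D) - 1 = (g : D) * ((a : D) - 1) * ((g⁻¹ : Dˣ) : D) := by
      rw [mul_sub, sub_mul]; simp
    rwa [h, val_conj]

variable {F D} in
/-- `ϖ` is a uniformizer of `D`: it has the largest valuation less than one (written
multiplicatively), i.e. it generates the maximal ideal of `𝒪_D`. -/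
def IsDivUniformizer (ϖ : Dˣ) : Prop :=
  val F D ϖ < 1 ∧ ∀ x : D, val F D x < 1 → val F D x ≤ val F D ϖ

variable {F D} in
theorem mem_I₁_iff {ϖ : Dˣ} (hϖ : IsDivUniformizer (F := F) ϖ) (u : Dˣ) :
    u ∈ I₁ F D ↔ ∃ y ∈ intRing F D, (u : D) = 1 + ϖ * y := by
  rw [mem_I₁]
  constructor
  · intro h
    refine ⟨((ϖ⁻¹ : Dˣ) : D) * (u - 1), ?_, by simp⟩
    have := hϖ.2 _ h
    have h0 : 0 < val F D ϖ := zero_lt_iff.2 (by simp)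
    rw [Valuation.mem_integer_iff, map_mul, Units.val_inv_eq_inv_val, map_inv₀]
    exact inv_mul_le_one_of_le₀ this zero_le
  · rintro ⟨y, hy, h⟩
    rw [h, add_sub_cancel_left, map_mul]
    exact mul_lt_one_of_nonneg_of_lt_one_left zero_le hϖ.1 hy

variable {F D} in
/-- Conjugation `a ↦ ϖ a ϖ⁻¹` on `𝒪_D`. -/
noncomputable def intConj (ϖ : Dˣ) : intRing F D →+* intRing F D where
  toFun a := ⟨(ϖ : D) * a * ((ϖ⁻¹ : Dˣ) : D), by
    rw [Valuation.mem_integer_iff, val_conj]; exact a.2⟩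
  map_one' := by ext; simp
  map_zero' := by ext; simp
  map_add' a b := by ext; simp [mul_add, add_mul]
  map_mul' a b := by ext; simp [mul_assoc]

variable {F D} in
/-- The map `σ` of `k_D` induced by conjugation by `ϖ`: `σ(ā)` is the class of `ϖ a ϖ⁻¹`.
In terms of Teichmüller lifts, `ϖ [x] ϖ⁻¹ = [σ(x)]`. -/
noncomputable def resConj (ϖ : Dˣ) : resRing F D →+* resRing F D :=
  Ideal.Quotient.lift (maxIdeal F D) ((Ideal.Quotient.mk (maxIdeal F D)).comp (intConj ϖ))
    fun a ha => by
      rw [mem_maxIdeal] at ha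
      rw [RingHom.comp_apply, Ideal.Quotient.eq_zero_iff_mem, mem_maxIdeal]
      exact (val_conj ϖ (a : D)).trans_lt ha

/-- `Fˣ` as a subgroup of `Dˣ`. -/
noncomputable def baseUnits : Subgroup Dˣ := (Units.map (algebraMap F D : F →* D)).range

/-- `𝒪_Dˣ` as a subgroup of `Dˣ`. -/
noncomputable def intUnits : Subgroup Dˣ :=
  (Units.map ((intRing F D).subtype : intRing F D →* D)).range

/-- The image `D_d^× / I₁` of `D_d^× = Fˣ 𝒪_Dˣ` in `Dˣ / I₁`. -/
noncomputable def DdQuotient : Subgroup (Dˣ ⧸ I₁ F D) :=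
  (baseUnits F D ⊔ intUnits F D).map (QuotientGroup.mk' (I₁ F D))

/-- The class in `D_d^× / I₁` of a scalar `z ∈ Fˣ`. -/
noncomputable def baseToDd : Fˣ →* DdQuotient F D :=
  ((QuotientGroup.mk' (I₁ F D)).comp (Units.map (algebraMap F D : F →* D))).codRestrict _
    fun z => Subgroup.mem_map_of_mem _ (Subgroup.mem_sup_left ⟨z, rfl⟩)

/-- The class in `D_d^× / I₁` of a unit `u ∈ 𝒪_Dˣ`. -/
noncomputable def intToDd : (intRing F D)ˣ →* DdQuotient F D :=
  ((QuotientGroup.mk' (I₁ F D)).comp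
    (Units.map ((intRing F D).subtype : intRing F D →* D))).codRestrict _
    fun u => Subgroup.mem_map_of_mem _ (Subgroup.mem_sup_right ⟨u, rfl⟩)

variable {F D}
variable {k : Type*} [Field k]

/-- The character `x ↦ (σ(x) / x)^(p^i)` of `k_Dˣ`, with values in `kˣ` through `ι : k_D → k`. -/
noncomputable def resChar (p : ℕ) (ϖ : Dˣ) (ι : resRing F D →+* k) (i : ℕ) :
    (resRing F D)ˣ →* kˣ :=
  (Units.map (ι.comp (resConj ϖ) : resRing F D →* k) / Units.map (ι : resRing F D →* k)) ^ (p ^ i)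

theorem resChar_apply (p : ℕ) (ϖ : Dˣ) (ι : resRing F D →+* k) (i : ℕ) (x : (resRing F D)ˣ) :
    (resChar p ϖ ι i x : k) = (ι (resConj ϖ x) / ι x) ^ (p ^ i) := by
  simp [resChar]

/-- The homomorphism `Fˣ × 𝒪_Dˣ → D_d^× / I₁`, `(z, u) ↦ z u`. -/
noncomputable def prodToDd : Fˣ × (intRing F D)ˣ →* DdQuotient F D :=
  MonoidHom.noncommCoprod (baseToDd F D) (intToDd F D) fun z u => by
    refine Subtype.ext ?_
    change ((Units.map (algebraMap F D : F →* D) z * Units.map _ u : Dˣ) : Dˣ ⧸ I₁ F D) =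
      ((Units.map _ u * Units.map (algebraMap F D : F →* D) z : Dˣ) : Dˣ ⧸ I₁ F D)
    congr 1
    ext
    simp [Algebra.commutes]

theorem prodToDd_apply (z : Fˣ) (u : (intRing F D)ˣ) :
    prodToDd (z, u) = baseToDd F D z * intToDd F D u := rfl

theorem prodToDd_surjective : Function.Surjective (prodToDd (F := F) (D := D)) := by
  have hnorm : (baseUnits F D).Normal := by
    refine ⟨?_⟩
    rintro _ ⟨z, rfl⟩ g
    refine ⟨z, ?_⟩
    ext
    simp [← Algebra.commutes]
  rintro ⟨_, g, hg, rfl⟩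
  obtain ⟨_, ⟨z, rfl⟩, _, ⟨u, rfl⟩, rfl⟩ := Subgroup.mem_sup_of_normal_left.1 hg
  exact ⟨(z, u), rfl⟩

theorem resChar_eq_one_of_mem_ker (p : ℕ) (ϖ : Dˣ) (ι : resRing F D →+* k) (i : ℕ)
    (z : Fˣ) (u : (intRing F D)ˣ) (h : prodToDd (z, u) = 1) :
    resChar p ϖ ι i
      (Units.map (Ideal.Quotient.mk (maxIdeal F D) : _ →* resRing F D) u) = 1 := by
  set a : D := algebraMap F D z with ha
  set b : D := ((u : intRing F D) : D) with hb
  have h1 : Units.map (algebraMap F D : F →* D) z *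
      Units.map ((intRing F D).subtype : intRing F D →* D) u ∈ I₁ F D :=
    (QuotientGroup.eq_one_iff _).1 (congrArg Subtype.val h)
  have h2 : val F D (a * b - 1) < 1 := h1
  have hab : val F D (a * b) = 1 := by
    have := (val F D).map_one_add_of_lt h2
    simpa using this
  have hu : val F D b = 1 := by
    refine le_antisymm (u : intRing F D).2 ?_
    have h3 : val F D (((u⁻¹ : (intRing F D)ˣ) : intRing F D) : D) ≤ 1 :=
      ((u⁻¹ : (intRing F D)ˣ) : intRing F D).2
    have h4 : b * (((u⁻¹ : (intRing F D)ˣ) : intRing F D) : D) = 1 :=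
      congrArg Subtype.val u.mul_inv
    have h5 := congrArg (val F D) h4
    rw [map_mul, map_one] at h5
    rw [← h5]
    exact mul_le_of_le_one_right' h3
  have hva : val F D a = 1 := by rwa [map_mul, hu, mul_one] at hab
  have h6 : val F D (a * ((ϖ : D) * b * ((ϖ⁻¹ : Dˣ) : D) - b)) < 1 := by
    have e : a * ((ϖ : D) * b * ((ϖ⁻¹ : Dˣ) : D) - b) =
        (ϖ : D) * (a * b - 1) * ((ϖ⁻¹ : Dˣ) : D) - (a * b - 1) := by
      have hc : (ϖ : D) * a = a * ϖ := (Algebra.commutes (z : F) (ϖ : D)).symm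
      rw [mul_sub (ϖ : D), ← mul_assoc (ϖ : D) a b, hc, sub_mul, mul_one, Units.mul_inv]
      noncomm_ring
    rw [e]
    exact (val F D).map_sub_lt (by rwa [val_conj]) h2
  rw [map_mul, hva, one_mul] at h6
  have h7 : resConj ϖ (Ideal.Quotient.mk (maxIdeal F D) (u : intRing F D)) =
      Ideal.Quotient.mk (maxIdeal F D) (u : intRing F D) := by
    refine (Ideal.Quotient.eq).2 ?_
    exact h6
  ext
  rw [resChar_apply]
  simp only [Units.coe_map, MonoidHom.coe_coe, Units.val_one]
  rw [h7, div_self, one_pow]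
  exact ((Units.map (ι : resRing F D →* k))
    (Units.map (Ideal.Quotient.mk (maxIdeal F D) : _ →* resRing F D) u)).ne_zero

/-- There is exactly one character of `D_d^× / I₁ = Fˣ 𝒪_Dˣ / I₁` which is trivial on `Fˣ` and is
given on `𝒪_Dˣ` by the inflation of `x ↦ (σ(x) / x)^(p^i)`. -/
theorem existsUnique_chi (p : ℕ) (ϖ : Dˣ) (ι : resRing F D →+* k) (i : ℕ) :
    ∃! χ : DdQuotient F D →* kˣ,
      (∀ z : Fˣ, χ (baseToDd F D z) = 1) ∧
      ∀ u : (intRing F D)ˣ, χ (intToDd F D u) =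
        resChar p ϖ ι i (Units.map (Ideal.Quotient.mk (maxIdeal F D) : _ →* resRing F D) u) := by
  refine existsUnique_of_exists_of_unique ?_ ?_
  · let ψ : Fˣ × (intRing F D)ˣ →* kˣ := ((resChar p ϖ ι i).comp
      (Units.map (Ideal.Quotient.mk (maxIdeal F D) : _ →* resRing F D))).comp (MonoidHom.snd _ _)
    have hψ : (prodToDd (F := F) (D := D)).ker ≤ ψ.ker := by
      rintro ⟨z, u⟩ h
      exact resChar_eq_one_of_mem_ker p ϖ ι i z u h
    let χ := prodToDd.liftOfSurjective prodToDd_surjective ⟨ψ, hψ⟩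
    have hχ (z : Fˣ) (u : (intRing F D)ˣ) : χ (prodToDd (z, u)) = ψ (z, u) :=
      MonoidHom.liftOfRightInverse_comp_apply _ _ _ ⟨ψ, hψ⟩ (z, u)
    refine ⟨χ, fun z => ?_, fun u => ?_⟩
    · have := hχ z 1
      rw [prodToDd_apply, map_one, mul_one] at this
      rw [this]; simp [ψ]
    · have := hχ 1 u
      rw [prodToDd_apply, map_one, one_mul] at this
      rw [this]; simp [ψ]
  · rintro χ₁ χ₂ ⟨h1, h2⟩ ⟨h3, h4⟩
    ext g
    obtain ⟨⟨z, u⟩, rfl⟩ := prodToDd_surjective g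
    rw [prodToDd_apply, map_mul, map_mul, h1, h2, h3, h4]

/-- The character `χ` of `D_d^× / I₁` extended trivially from `x ↦ (σ(x) / x)^(p^i)`: it is the
inflation of that character on `𝒪_Dˣ` and trivial on `Fˣ` (in particular on `ϖ^d = π_F`). -/
noncomputable def chi (p : ℕ) (ϖ : Dˣ) (ι : resRing F D →+* k) (i : ℕ) :
    DdQuotient F D →* kˣ :=
  (existsUnique_chi p ϖ ι i).choose

/-- A character with values in `kˣ` as a one-dimensional representation. -/
noncomputable def charRep {G : Type*} [Group G] (χ : G →* kˣ) : Representation k G k :=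
  (Module.toModuleEnd k (S := k) k : k →* Module.End k k).comp ((Units.coeHom k).comp χ)

theorem charRep_apply {G : Type*} [Group G] (χ : G →* kˣ) (g : G) (a : k) :
    charRep χ g a = (χ g : k) * a := rfl

/-- The induced representation `Ind χ` from `D_d^× / I₁` to `Dˣ / I₁`: functions `f` on `Dˣ / I₁`
with `f (h g) = χ(h) f(g)` for `h ∈ D_d^× / I₁`, on which `Dˣ / I₁` acts by right translation. -/
noncomputable abbrev indChi (p : ℕ) (ϖ : Dˣ) (ι : resRing F D →+* k) (i : ℕ) :=
  Representation.coind (DdQuotient F D).subtype (charRep (chi p ϖ ι i))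

end val
end DivAlg

open ValuativeRel DivAlg

set_option linter.unusedSectionVars false

/-! Since the coefficients are trivial, H¹(I₁, k) is the space of continuous homomorphisms φ : I₁ →
k (`H1equiv`). Restriction to the central subgroup 1 + 𝔪_F is unchanged by conjugation, and it has
an invariant section: pull back along x ↦ N(x)^(q-1) and divide by d²(q-1), which is prime to p
because p ∤ d (`resMap_splitMap`). It remains to describe the kernel of restriction.

Let φ be in this kernel and U_j = 1 + ϖ^j 𝒪_D. By continuity φ is trivial on some U_n. If φ is
trivial on U_{j+1} with j ≥ 2, it induces an additive ψ on U_j / U_{j+1} ≅ k_D, and triviality on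
commutators of 1 + aϖ with 1 + bϖ^(j-1) reads ψ(a σ(b)) = ψ(b σ^(j-1)(a)). Hence ψ ∘ σ = ψ, and ψ
kills every c(a - σ^j(a)). If σ^j ≠ 1 this forces ψ = 0. If σ^j = 1, then d ∣ j and d ψ(x) = ψ(Tr
x), where Tr x lies in k_F and so comes from 1 + 𝔪_F; again ψ = 0 (`VanishesOn.pred`). Thus φ
factors through U₁ / U₂ ≅ k_D. Conversely every additive map k_D → k occurs, because d > 1 puts 1 +
𝔪_F inside U₂ (`exists_isGraded_of_addMonoidHom`).

On Hom(k_D, k) a unit w acts by precomposition with multiplication by σ(w)/w, and ϖ by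
precomposition with σ⁻¹. The fd embeddings of k_D form a k-basis; they are y ↦ ι(σ^j(y))^(p^i) with
i in ℤ/f and 0 ≤ j < d. The coefficient at j = 0 transforms under D_d^× by the i-th character, so
Frobenius reciprocity gives a map to the i-th induced representation. Its values at the coset
representatives ϖ^j are the other coefficients, so the sum of these maps is bijective on the kernel
(`bijective_gradedCoeff`).

The arithmetic input is that |k_D| = q^d (`card_resRing`), that the fixed field of σ is k_F
(`exists_baseRes_eq`, from the centrality of traces of Teichmüller lifts), and hence, by Galois
theory, that the q-Frobenius is a power of σ and that σ has order d. -/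

namespace DivAlg

/-! ### Degree-one cohomology as continuous characters. -/

section homs
open CategoryTheory TopRep ContRepresentation

variable (k : Type u) [CommRing k] [TopologicalSpace k] [IsTopologicalRing k]
variable (G : Type u) [Group G] [TopologicalSpace G] [IsTopologicalGroup G]
variable {G}
variable {H : Type u} [Group H] [TopologicalSpace H] [IsTopologicalGroup H]

variable (G) in
/-- The continuous additive characters `G → k`. -/
def contHom : Submodule k (G → k) where
  carrier := {φ | Continuous φ ∧ ∀ x y, φ (x * y) = φ x + φ y}
  add_mem' {φ ψ} hφ hψ := ⟨hφ.1.add hψ.1, fun x y => by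
    simp only [Pi.add_apply, hφ.2, hψ.2]; ring⟩
  zero_mem' := ⟨continuous_const, fun x y => by simp⟩
  smul_mem' c φ hφ := ⟨hφ.1.const_smul c, fun x y => by
    simp only [Pi.smul_apply, hφ.2, smul_add]⟩

variable (G) in
-- An invariant 0-cochain is a constant function, so there are no nonzero coboundaries and H¹ is the
-- space of cocycles itself.
theorem d_zero_one_eq_zero : (homogeneousCochains (trivRep k G)).d 0 1 = 0 := by
  ext F
  refine Subtype.ext (ContinuousMap.ext fun x => ContinuousMap.ext fun y => ?_)
  have h1 := homogeneousCochains.d_apply (trivRep k G) 0 F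
  have h2 : (((homogeneousCochains (trivRep k G)).d 0 1).hom F).1 x y =
    (F.1 : C(G, k)) y - (F.1 : C(G, k)) x :=
    DFunLike.congr_fun (DFunLike.congr_fun h1 x) y
  have h3 (z : G) : (F.1 : C(G, k)) z = (F.1 : C(G, k)) 1 := by
    have := DFunLike.congr_fun (F.2 z) z
    rw [← this]
    change (F.1 : C(G, k)) (z⁻¹ * z) = _
    rw [inv_mul_cancel]
  exact h2.trans (by rw [h3 x, h3 y, sub_self]; rfl)

variable (G) in
theorem bijective_π :
    Function.Bijective (ContinuousCohomology.π (trivRep k G) 1).hom := by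
  have := (homogeneousCochains (trivRep k G)).isIso_homologyπ 0 1 (by simp)
    (d_zero_one_eq_zero k G)
  exact ConcreteCategory.bijective_of_isIso (ContinuousCohomology.π (trivRep k G) 1)

variable (G) in
/-- The character attached to a cocycle. -/
noncomputable def cocycleEval :
    (ContinuousCohomology.cocycles (trivRep k G) 1 : TopModuleCat k) →ₗ[k] (G → k) where
  toFun z x := (((HomologicalComplex.iCycles (homogeneousCochains (trivRep k G)) 1).hom z).1 :
    C(G, C(G, k))) 1 x
  map_add' a b := by ext; simp; rfl
  map_smul' c a := by ext; simp; rfl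

variable {k} in
theorem cocycle_d (z : (ContinuousCohomology.cocycles (trivRep k G) 1 : TopModuleCat k)) :
    ((homogeneousCochains (trivRep k G)).d 1 2).hom
      ((HomologicalComplex.iCycles (homogeneousCochains (trivRep k G)) 1).hom z) = 0 := by
  have := HomologicalComplex.iCycles_d (homogeneousCochains (trivRep k G)) 1 2
  exact congrArg (fun f => (TopModuleCat.Hom.hom f) z) this

variable {k} in
theorem cochain_eq (F : (homogeneousCochains (trivRep k G)).X 1)
    (hF : ((homogeneousCochains (trivRep k G)).d 1 2).hom F = 0) (x y : G) :
    (F.1 : C(G, C(G, k))) x y = (F.1 : C(G, C(G, k))) 1 y - (F.1 : C(G, C(G, k))) 1 x :=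
  sub_eq_zero.1 (cochain_cocycle k F hF 1 x y)

/-- With F the cochain, F(1, y) = F(x, xy) by invariance, and F(x, xy) = F(1, xy) - F(1, x) by the
cocycle relation. -/
theorem cocycleEval_mem (z : (ContinuousCohomology.cocycles (trivRep k G) 1 : TopModuleCat k)) :
    cocycleEval k G z ∈ contHom k G := by
  set F := (HomologicalComplex.iCycles (homogeneousCochains (trivRep k G)) 1).hom z with hF
  refine ⟨((F.1 : C(G, C(G, k))) 1).continuous, fun x y => ?_⟩
  change (F.1 : C(G, C(G, k))) 1 (x * y) = (F.1 : C(G, C(G, k))) 1 x + (F.1 : C(G, C(G, k))) 1 y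
  have h1 := cochain_invariant k F x⁻¹ 1 y
  have h2 := cochain_eq F (cocycle_d z) x (x * y)
  simp only [inv_inv, mul_one] at h1
  rw [← h1, h2]; ring

theorem cocycleEval_injective : Function.Injective (cocycleEval k G) := by
  rw [injective_iff_map_eq_zero]
  intro z hz
  have hmono : Function.Injective
      (HomologicalComplex.iCycles (homogeneousCochains (trivRep k G)) 1).hom := by
    -- The abstract cycles are identified with the concrete kernel, whose inclusion is visibly
    -- injective on elements.
    let e := Limits.KernelFork.mapIsoOfIsLimit
      ((homogeneousCochains (trivRep k G)).cyclesIsKernel 1 2 (by simp))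
      (TopModuleCat.isLimitKer _) (Iso.refl _)
    have he : e.hom ≫ TopModuleCat.kerι ((homogeneousCochains (trivRep k G)).d 1 2) =
        (homogeneousCochains (trivRep k G)).iCycles 1 := by
      have := Limits.KernelFork.mapOfIsLimit_ι
        (Limits.KernelFork.ofι _ ((homogeneousCochains (trivRep k G)).iCycles_d 1 2))
        (TopModuleCat.isLimitKer ((homogeneousCochains (trivRep k G)).d 1 2))
        (Iso.refl (Arrow.mk ((homogeneousCochains (trivRep k G)).d 1 2))).hom
      exact this
    rw [← he]
    intro a b hab
    have h1 : (e.hom.hom a) = e.hom.hom b := Subtype.ext hab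
    exact (ConcreteCategory.bijective_of_isIso e.hom).1 h1
  refine hmono ?_
  rw [map_zero]
  refine Subtype.ext (ContinuousMap.ext fun x => ContinuousMap.ext fun y => ?_)
  refine (cochain_eq _ (cocycle_d z) x y).trans ?_
  have h1 := congrFun hz x
  have h2 := congrFun hz y
  change (((HomologicalComplex.iCycles (homogeneousCochains (trivRep k G)) 1).hom z).1 :
    C(G, C(G, k))) 1 x = 0 at h1
  change (((HomologicalComplex.iCycles (homogeneousCochains (trivRep k G)) 1).hom z).1 :
    C(G, C(G, k))) 1 y = 0 at h2
  rw [h1, h2, sub_zero]; rfl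

theorem exists_cocycleEval {φ : G → k} (hφ : φ ∈ contHom k G) :
    ∃ z, cocycleEval k G z = φ := by
  let c : C(G × G, k) := ⟨fun x => φ x.2 - φ x.1,
    (hφ.1.comp continuous_snd).sub (hφ.1.comp continuous_fst)⟩
  have h1 : φ 1 = 0 := by simpa using hφ.2 1 1
  have hinv (x : G) : φ x⁻¹ = - φ x := by
    have := hφ.2 x⁻¹ x
    rw [inv_mul_cancel, h1] at this
    linear_combination -this
  let F : (homogeneousCochains (trivRep k G)).X 1 := ⟨c.curry, fun g => by
    refine ContinuousMap.ext fun x => ContinuousMap.ext fun y => ?_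
    change φ (g⁻¹ * y) - φ (g⁻¹ * x) = φ y - φ x
    rw [hφ.2, hφ.2]; ring⟩
  have hF : ((homogeneousCochains (trivRep k G)).d 1 2).hom F = 0 := by
    have h1 := homogeneousCochains.d_apply (trivRep k G) 1 F
    refine Subtype.ext (h1.trans ?_)
    refine ContinuousMap.ext fun x => ContinuousMap.ext fun y => ContinuousMap.ext fun w => ?_
    change (φ w - φ y) - ((φ w - φ x) - (φ y - φ x)) = 0
    ring
  -- Lifting to cycles is available for morphisms, so the element `F` is encoded as the map k →
  -- cochains sending 1 to `F`.
  let s : TopModuleCat.of k k ⟶ (homogeneousCochains (trivRep k G)).X 1 :=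
    TopModuleCat.ofHom ((ContinuousLinearMap.id k k).smulRight F)
  have hs : s ≫ (homogeneousCochains (trivRep k G)).d 1 2 = 0 := by
    ext
    change ((homogeneousCochains (trivRep k G)).d 1 2).hom ((1 : k) • F) = 0
    rw [one_smul, hF]
  let z := ((homogeneousCochains (trivRep k G)).liftCycles s 2 (by simp) hs).hom (1 : k)
  refine ⟨z, ?_⟩
  have hz : ((homogeneousCochains (trivRep k G)).iCycles 1).hom z = F := by
    have := (homogeneousCochains (trivRep k G)).liftCycles_i s 2 (by simp) hs
    have := congrArg (fun f => TopModuleCat.Hom.hom f (1 : k)) this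
    exact this.trans (one_smul k F)
  ext x
  change ((((homogeneousCochains (trivRep k G)).iCycles 1).hom z).1 : C(G, C(G, k))) 1 x = _
  rw [hz]
  change φ x - φ 1 = _
  rw [h1, sub_zero]

variable (G) in
/-- The cocycles with trivial coefficients are the continuous characters. -/
noncomputable def cocycleEquiv :
    (ContinuousCohomology.cocycles (trivRep k G) 1 : TopModuleCat k) ≃ₗ[k] contHom k G :=
  LinearEquiv.ofBijective ((cocycleEval k G).codRestrict (contHom k G) (cocycleEval_mem k))
    ⟨fun _ _ h => cocycleEval_injective k (congrArg Subtype.val h),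
      fun φ => (exists_cocycleEval k φ.2).imp fun _ h => Subtype.ext h⟩

variable (G) in
/-- `H¹(G, k)` is the space of continuous characters `G → k`. -/
noncomputable def H1equiv : H1 k G ≃ₗ[k] contHom k G :=
  (LinearEquiv.ofBijective (ContinuousCohomology.π (trivRep k G) 1).hom.toLinearMap
    (bijective_π k G)).symm.trans (cocycleEquiv k G)

theorem H1equiv_π (z : (ContinuousCohomology.cocycles (trivRep k G) 1 : TopModuleCat k)) :
    H1equiv k G ((ContinuousCohomology.π (trivRep k G) 1).hom z) = cocycleEquiv k G z := by
  change cocycleEquiv k G ((LinearEquiv.ofBijective _ (bijective_π k G)).symm _) = _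
  congr 1
  exact (LinearEquiv.ofBijective (ContinuousCohomology.π (trivRep k G) 1).hom.toLinearMap
    (bijective_π k G)).symm_apply_apply z

/-- Pullbacks of cohomology classes are compositions of characters. -/
theorem H1equiv_H1map (φ : H →ₜ* G) (c : H1 k G) (x : H) :
    (H1equiv k H (H1map k φ c) : H → k) x = (H1equiv k G c : G → k) (φ x) := by
  obtain ⟨z, rfl⟩ := (bijective_π k G).2 c
  have h : H1map k φ ((ContinuousCohomology.π (trivRep k G) 1).hom z) =
      (ContinuousCohomology.π (trivRep k H) 1).hom
        ((ContinuousCohomology.cocyclesMap φ (trivResHom k φ) 1).hom z) :=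
    congrArg (fun f => TopModuleCat.Hom.hom f z)
      (ContinuousCohomology.π_map φ (trivResHom k φ) 1)
  rw [h, H1equiv_π, H1equiv_π]
  have h2 := congrArg (fun f => TopModuleCat.Hom.hom f z)
    (HomologicalComplex.cyclesMap_i (ContinuousCohomology.cochainsMap φ (trivResHom k φ)) 1)
  have h3 : ((homogeneousCochains (trivRep k H)).iCycles 1).hom
      ((ContinuousCohomology.cocyclesMap φ (trivResHom k φ) 1).hom z) =
      ((ContinuousCohomology.cochainsMap φ (trivResHom k φ)).f 1).hom
        (((homogeneousCochains (trivRep k G)).iCycles 1).hom z) := h2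
  change ((((homogeneousCochains (trivRep k H)).iCycles 1).hom
      ((ContinuousCohomology.cocyclesMap φ (trivResHom k φ) 1).hom z)).1 : C(H, C(H, k))) 1 x = _
  rw [h3]
  change ((((homogeneousCochains (trivRep k G)).iCycles 1).hom z).1 : C(G, C(G, k)))
    (φ 1) (φ x) = _
  rw [map_one]
  rfl

end homs
end DivAlg

namespace DivAlg
open ValuativeRel

/-! ### Topology of `D`: compactness of the ring of integers. -/

section topology
variable {F D : Type*} [Field F] [ValuativeRel F] [TopologicalSpace F]
  [IsNonarchimedeanLocalField F] [DivisionRing D] [Algebra F D] [FiniteDimensional F D]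

theorem valuation_eq_of_sub_lt {x z : F} (h : valuation F (z - x) < valuation F x) :
    valuation F z = valuation F x := by
  have := (valuation F).map_add_eq_of_lt_left h
  simpa using this

/-- The valuation is locally constant away from 0, so openness only has to be checked at 0. -/
theorem isOpen_valuation_mem {S : Set (ValueGroupWithZero F)}
    (hS : 0 ∈ S → ∃ γ, γ ≠ 0 ∧ ∀ c < γ, c ∈ S) : IsOpen {z : F | valuation F z ∈ S} := by
  rw [isOpen_iff_mem_nhds]
  intro x hx
  rcases eq_or_ne x 0 with rfl | h0
  · obtain ⟨γ, hγ, h⟩ := hS (by simpa using hx)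
    exact (IsValuativeTopology.hasBasis_nhds_zero' F).mem_iff.2 ⟨γ, hγ, fun z hz => h _ hz⟩
  · refine (IsValuativeTopology.hasBasis_nhds' x).mem_iff.2
      ⟨valuation F x, by simpa using h0, fun z hz => ?_⟩
    change valuation F z ∈ S
    rw [valuation_eq_of_sub_lt hz]
    exact hx

theorem val_algebraMap (z : F) :
    val F D (algebraMap F D z) = valuation F z ^ Module.finrank F D := by
  rw [val_apply, Algebra.norm_algebraMap, map_pow]

variable [TopologicalSpace D] [IsTopologicalRing D] [IsModuleTopology F D]

theorem continuous_algebraNorm : Continuous (Algebra.norm F : D → F) := by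
  classical
  let b := Module.finBasis F D
  have h : (Algebra.norm F : D → F) = fun x => (Algebra.leftMulMatrix b x).det :=
    funext fun x => Algebra.norm_eq_matrix_det b x
  rw [h]
  refine Continuous.matrix_det ?_
  exact IsModuleTopology.continuous_of_linearMap (R := F)
    (Algebra.leftMulMatrix b).toLinearMap

theorem isOpen_val_mem {S : Set (ValueGroupWithZero F)}
    (hS : 0 ∈ S → ∃ γ, γ ≠ 0 ∧ ∀ c < γ, c ∈ S) : IsOpen {x : D | val F D x ∈ S} :=
  (isOpen_valuation_mem hS).preimage continuous_algebraNorm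

theorem isOpen_val_lt (c : ValueGroupWithZero F) : IsOpen {x : D | val F D x < c} :=
  isOpen_val_mem (S := Set.Iio c) fun h => ⟨c, ne_of_gt h, fun _ h => h⟩

theorem isClosed_val_le (c : ValueGroupWithZero F) : IsClosed {x : D | val F D x ≤ c} := by
  rw [← isOpen_compl_iff]
  have h := isOpen_val_mem (F := F) (D := D) (S := Set.Ioi c) fun h => absurd h (by simp)
  convert h using 1
  ext x
  simp

/-- The norm has no zero on the compact set of coordinate vectors of maximal valuation 1, because
`D` is a division ring; so it is bounded below there by some γ. Dividing an integral element by its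
largest coordinate then bounds that coordinate. -/
theorem exists_bound (b : Module.Basis (Fin (Module.finrank F D)) F D) :
    ∃ w : F, w ≠ 0 ∧ ∀ x : D, val F D x ≤ 1 → ∀ i, valuation F (b.repr x i) ≤ valuation F w := by
  let Ψ : (Fin (Module.finrank F D) → F) → D := fun c => ∑ i, c i • b i
  have hΨ : Continuous Ψ := by fun_prop
  let S : Set (Fin (Module.finrank F D) → F) :=
    Set.univ.pi (fun _ => {z | valuation F z ≤ 1}) ∩ ⋃ i, {c | valuation F (c i) = 1}
  have hS : IsCompact S := by
    refine (isCompact_univ_pi fun _ =>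
      IsNonarchimedeanLocalField.isCompact_closedBall F 1).inter_right ?_
    refine isClosed_iUnion_of_finite fun i => ?_
    refine IsClosed.preimage (f := fun c : Fin (Module.finrank F D) → F => c i)
      (continuous_apply i) (t := {z : F | valuation F z = 1}) ?_
    rw [← isOpen_compl_iff]
    exact isOpen_valuation_mem (S := {1}ᶜ) fun _ => ⟨1, one_ne_zero, fun c hc => ne_of_lt hc⟩
  have hT : IsCompact ((fun c => Algebra.norm F (Ψ c)) '' S) :=
    hS.image (continuous_algebraNorm.comp hΨ)
  have h0 : (0 : F) ∉ (fun c => Algebra.norm F (Ψ c)) '' S := by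
    rintro ⟨c, ⟨-, hc⟩, h⟩
    obtain ⟨i, hi⟩ := Set.mem_iUnion.1 hc
    have h1 : Ψ c = 0 := Algebra.norm_eq_zero_iff.1 h
    have h2 : c i = 0 := Fintype.linearIndependent_iff.1 b.linearIndependent c h1 i
    have hi : valuation F (c i) = 1 := hi
    simp [h2] at hi
  have hcl : IsClosed ({0} : Set F) := by
    rw [← isOpen_compl_iff]
    have h := isOpen_valuation_mem (F := F) (S := {0}ᶜ) fun h => absurd rfl h
    convert h using 1
    ext x
    simp
  have := IsTopologicalAddGroup.t1Space F hcl
  obtain ⟨γ, hγ, hγS⟩ := (IsValuativeTopology.hasBasis_nhds_zero' F).mem_iff.1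
    (hT.isClosed.isOpen_compl.mem_nhds h0)
  obtain ⟨w', hw'⟩ := ValuativeRel.valuation_surjective γ
  have hw'0 : w' ≠ 0 := by rintro rfl; simp at hw'; exact hγ hw'.symm
  have hn : Module.finrank F D ≠ 0 := Module.finrank_pos.ne'
  -- The bound must dominate γ⁻¹, and also 1: for a coordinate `y` of valuation above 1, the power
  -- of v(y)⁻¹ produced by the norm is at most v(y)⁻¹.
  obtain ⟨w, hw0, hw1, hw2⟩ : ∃ w : F, w ≠ 0 ∧ 1 ≤ valuation F w ∧ γ⁻¹ ≤ valuation F w := by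
    rcases le_total 1 γ⁻¹ with h | h
    · exact ⟨w'⁻¹, inv_ne_zero hw'0, by simpa [hw'] using h, by simp [hw']⟩
    · exact ⟨1, one_ne_zero, by simp, by simpa using h⟩
  refine ⟨w, hw0, fun x hx i => ?_⟩
  have : Nonempty (Fin (Module.finrank F D)) := ⟨i⟩
  obtain ⟨j, hj⟩ := Finite.exists_max fun i => valuation F (b.repr x i)
  refine (hj i).trans ?_
  by_contra! hlt
  set y := b.repr x j
  have hy0 : y ≠ 0 := by rintro h; rw [h] at hlt; simp at hlt
  let c : Fin (Module.finrank F D) → F := fun i => y⁻¹ * b.repr x i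
  have hc : c ∈ S := by
    refine ⟨fun i _ => ?_, Set.mem_iUnion.2 ⟨j, ?_⟩⟩
    · change valuation F (y⁻¹ * _) ≤ 1
      rw [map_mul, map_inv₀]
      exact inv_mul_le_one_of_le₀ (hj i) zero_le
    · change valuation F (y⁻¹ * y) = 1
      simp [hy0]
  have hΨc : Ψ c = y⁻¹ • x := by
    simp only [Ψ, c, mul_smul, ← Finset.smul_sum, b.sum_repr]
  have h1 : ¬ valuation F (Algebra.norm F (Ψ c)) < γ := fun h => hγS h ⟨c, hc, rfl⟩
  rw [hΨc, Algebra.smul_def, map_mul, map_mul, Algebra.norm_algebraMap, map_pow, map_inv₀] at h1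
  push Not at h1
  have hx' : valuation F (Algebra.norm F x) ≤ 1 := hx
  have h2 : γ ≤ (valuation F y)⁻¹ ^ Module.finrank F D :=
    h1.trans (mul_le_of_le_one_right' hx')
  have hy1 : 1 < valuation F y := hw1.trans_lt hlt
  have h3 : (valuation F y)⁻¹ ^ Module.finrank F D ≤ (valuation F y)⁻¹ :=
    pow_le_of_le_one zero_le (inv_le_one_of_one_le₀ hy1.le) hn
  have h4 : valuation F y ≤ γ⁻¹ := by
    rw [le_inv_comm₀ (zero_lt_one.trans hy1) (zero_lt_iff.2 hγ)]
    exact h2.trans h3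
  exact absurd (h4.trans hw2) (not_le.2 hlt)

variable (F D) in
theorem isCompact_val_le_one : IsCompact {x : D | val F D x ≤ 1} := by
  let b := Module.finBasis F D
  obtain ⟨w, -, hw⟩ := exists_bound b
  let Ψ : (Fin (Module.finrank F D) → F) → D := fun c => ∑ i, c i • b i
  have hΨ : Continuous Ψ := by fun_prop
  refine ((isCompact_univ_pi fun _ =>
      IsNonarchimedeanLocalField.isCompact_closedBall F (valuation F w)).image hΨ).of_isClosed_subset
    (isClosed_val_le 1) fun x hx => ⟨b.repr x, fun i _ => hw x hx i, b.sum_repr x⟩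

/-- Balls for `val` form a neighbourhood basis at 0: after rescaling, `exists_bound` makes all
coordinates small. -/
theorem exists_val_le_subset {U : Set D} (hU : U ∈ nhds (0 : D)) :
    ∃ z : F, z ≠ 0 ∧ {x : D | val F D x ≤ val F D (algebraMap F D z)} ⊆ U := by
  let b := Module.finBasis F D
  obtain ⟨w, hw0, hw⟩ := exists_bound b
  let Ψ : (Fin (Module.finrank F D) → F) → D := fun c => ∑ i, c i • b i
  have hΨ : Continuous Ψ := by fun_prop
  have h1 : Ψ ⁻¹' U ∈ nhds (0 : Fin (Module.finrank F D) → F) :=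
    hΨ.continuousAt.preimage_mem_nhds (by simpa [Ψ] using hU)
  rw [nhds_pi, Filter.mem_pi'] at h1
  obtain ⟨I, t, ht, hI⟩ := h1
  have h2 : ⋂ i ∈ I, t i ∈ nhds (0 : F) :=
    (Filter.biInter_finset_mem I).2 fun i _ => ht i
  obtain ⟨γ, hγ, hγt⟩ := (IsValuativeTopology.hasBasis_nhds_zero' F).mem_iff.1 h2
  obtain ⟨w', hw'⟩ := ValuativeRel.valuation_surjective γ
  have hw'0 : w' ≠ 0 := by rintro rfl; simp at hw'; exact hγ hw'.symm
  -- The factor `r` turns the non-strict bound on coordinates into the strict one required by the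
  -- basis of neighbourhoods.
  obtain ⟨r, hr0, hr1⟩ := Valuation.IsNontrivial.exists_lt_one (v := valuation F)
  have hr0' : r ≠ 0 := by simpa using hr0
  refine ⟨r * w' * w⁻¹, by simp [*], fun x hx => ?_⟩
  set z := r * w' * w⁻¹ with hz
  have hz0 : z ≠ 0 := by simp [*]
  have hx' : val F D x ≤ val F D (algebraMap F D z) := hx
  have h3 : val F D (z⁻¹ • x) ≤ 1 := by
    rw [Algebra.smul_def, map_mul, map_inv₀, map_inv₀]
    exact inv_mul_le_one_of_le₀ hx' zero_le
  have h4 := hw _ h3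
  have h5 : (b.repr x : Fin (Module.finrank F D) → F) ∈ Ψ ⁻¹' U := by
    refine hI fun i hi => ?_
    have h6 : valuation F (b.repr x i) < γ := by
      have h7 := h4 i
      rw [map_smul, Finsupp.smul_apply, smul_eq_mul, map_mul, map_inv₀,
        inv_mul_le_iff₀ (zero_lt_iff.2 (by simpa using hz0)), ← map_mul, hz,
        inv_mul_cancel_right₀ hw0, map_mul, hw'] at h7
      exact h7.trans_lt (mul_lt_of_lt_one_left (zero_lt_iff.2 hγ) hr1)
    exact Set.mem_iInter₂.1 (hγt h6) i hi
  have h6 : Ψ (b.repr x) = x := b.sum_repr x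
  rw [← h6]
  exact h5

variable (F D) in
-- The maximal ideal is open in the compact group 𝒪_D, hence of finite index.
theorem finite_resRing : Finite (resRing F D) := by
  have : CompactSpace (intRing F D) := isCompact_iff_compactSpace.1 (isCompact_val_le_one F D)
  have ho : IsOpen ((maxIdeal F D).toAddSubgroup : Set (intRing F D)) :=
    (isOpen_val_lt (F := F) (D := D) 1).preimage continuous_subtype_val
  exact AddSubgroup.quotient_finite_of_isOpen _ ho

end topology

/-! ### The residue field of `D`. -/

section residue
variable {F D : Type*} [Field F] [ValuativeRel F] [TopologicalSpace F]
  [IsNonarchimedeanLocalField F] [DivisionRing D] [Algebra F D] [FiniteDimensional F D]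

theorem isUnit_of_val_eq_one {x : intRing F D} (h : val F D x = 1) : IsUnit x := by
  have h0 : (x : D) ≠ 0 := by rw [← (val F D).ne_zero_iff, h]; exact one_ne_zero
  refine isUnit_iff_exists.2 ⟨⟨(x : D)⁻¹, ?_⟩, Subtype.ext ?_, Subtype.ext ?_⟩
  · rw [Valuation.mem_integer_iff, map_inv₀, h, inv_one]
  · exact mul_inv_cancel₀ h0
  · exact inv_mul_cancel₀ h0

theorem resRing_mk_eq_zero {x : intRing F D} :
    Ideal.Quotient.mk (maxIdeal F D) x = 0 ↔ val F D x < 1 :=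
  Ideal.Quotient.eq_zero_iff_mem

instance : Nontrivial (resRing F D) :=
  Ideal.Quotient.nontrivial_iff.2 <| (Ideal.ne_top_iff_one _).2 <| by
    rw [mem_maxIdeal]; simp

theorem isUnit_or_eq_zero (x : resRing F D) : IsUnit x ∨ x = 0 := by
  obtain ⟨x, rfl⟩ := Ideal.Quotient.mk_surjective x
  rw [resRing_mk_eq_zero]
  have hx : val F D x ≤ 1 := x.2
  rcases hx.lt_or_eq with h | h
  · exact Or.inr h
  · exact Or.inl ((isUnit_of_val_eq_one h).map _)

variable [TopologicalSpace D] [IsTopologicalRing D] [IsModuleTopology F D]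

/-- The field structure of `k_D`. -/
@[reducible] noncomputable def fieldResRing : Field (resRing F D) :=
  letI : DivisionRing (resRing F D) := DivisionRing.ofIsUnitOrEqZero isUnit_or_eq_zero
  haveI : Finite (resRing F D) := finite_resRing F D
  littleWedderburn _

instance : Finite (resRing F D) := finite_resRing F D

end residue
end DivAlg

namespace DivAlg
open ValuativeRel
attribute [local instance] fieldResRing

/-! ### Discreteness of the valuation and the cardinality of the residue field. -/

section uniformizer
variable {F D : Type*} [Field F] [ValuativeRel F] [TopologicalSpace F]
  [IsNonarchimedeanLocalField F] [DivisionRing D] [Algebra F D] [FiniteDimensional F D]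
  {ϖ : Dˣ}

theorem val_units_pos (u : Dˣ) : 0 < val F D u := zero_lt_iff.2 (by simp)

theorem IsDivUniformizer.le_pow_succ (hϖ : IsDivUniformizer (F := F) ϖ) {x : D} {n : ℕ}
    (h : val F D x < val F D ϖ ^ n) : val F D x ≤ val F D ϖ ^ (n + 1) := by
  have h0 : 0 < val F D ϖ ^ n := pow_pos (val_units_pos ϖ) n
  have h1 : val F D (((ϖ : D) ^ n)⁻¹ * x) < 1 := by
    rw [map_mul, map_inv₀, map_pow]
    exact (inv_mul_lt_one₀ h0).2 h
  have h2 := hϖ.2 _ h1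
  rw [map_mul, map_inv₀, map_pow, inv_mul_le_iff₀ h0] at h2
  rwa [pow_succ]

/-- If no power of v(ϖ) equalled v(x), then `IsDivUniformizer.le_pow_succ` would give v(x) ≤ v(ϖ)^n
for all n, whereas these powers tend to 0. -/
theorem IsDivUniformizer.exists_val_eq_pow (hϖ : IsDivUniformizer (F := F) ϖ) {x : D}
    (h0 : x ≠ 0) (h : val F D x ≤ 1) : ∃ n : ℕ, val F D x = val F D ϖ ^ n := by
  classical
  have hex := exists_pow_lt₀ hϖ.1 (Units.mk0 (val F D x) (by simpa using h0))
  by_contra! hne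
  obtain ⟨n, hn⟩ := hex
  refine absurd hn (not_lt.2 ?_)
  change val F D x ≤ _
  clear hn
  induction n with
  | zero => simpa using h
  | succ n ih => exact hϖ.le_pow_succ (lt_of_le_of_ne ih (hne n))

theorem IsDivUniformizer.exists_val_eq_zpow (hϖ : IsDivUniformizer (F := F) ϖ) {x : D}
    (h0 : x ≠ 0) : ∃ n : ℤ, val F D x = val F D ϖ ^ n := by
  rcases le_total (val F D x) 1 with h | h
  · obtain ⟨n, hn⟩ := hϖ.exists_val_eq_pow h0 h
    exact ⟨n, by rw [hn, zpow_natCast]⟩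
  · obtain ⟨n, hn⟩ := hϖ.exists_val_eq_pow (inv_ne_zero h0)
      (by rw [map_inv₀]; exact inv_le_one_of_one_le₀ h)
    refine ⟨-n, ?_⟩
    rw [zpow_neg, zpow_natCast, ← hn, map_inv₀, inv_inv]

theorem map_mulLeft_leAddSubgroup (u : Dˣ) (c : ValueGroupWithZero F) :
    ((val F D).leAddSubgroup c).map (AddMonoidHom.mulLeft (u : D)) =
      (val F D).leAddSubgroup (val F D u * c) := by
  ext x
  simp only [AddSubgroup.mem_map, Valuation.mem_leAddSubgroup_iff, AddMonoidHom.coe_mulLeft]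
  constructor
  · rintro ⟨y, hy, rfl⟩
    rw [map_mul]
    exact mul_le_mul_right hy _
  · intro h
    refine ⟨(u : D)⁻¹ * x, ?_, by simp⟩
    rw [map_mul, map_inv₀]
    exact (inv_mul_le_iff₀ (val_units_pos u)).2 h

theorem mulLeft_injective (u : Dˣ) : Function.Injective (AddMonoidHom.mulLeft (u : D)) :=
  fun x y h => by simpa using h

theorem IsDivUniformizer.relIndex_uniformizer (hϖ : IsDivUniformizer (F := F) ϖ) :
    ((val F D).leAddSubgroup (val F D ϖ)).relIndex ((val F D).leAddSubgroup 1) =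
      Nat.card (resRing F D) := by
  have h : ((val F D).leAddSubgroup (val F D ϖ)).addSubgroupOf (intRing F D).toAddSubgroup =
      (maxIdeal F D).toAddSubgroup := by
    ext x
    change val F D x ≤ val F D ϖ ↔ val F D x < 1
    exact ⟨fun h => h.trans_lt hϖ.1, fun h => hϖ.2 _ h⟩
  exact congrArg AddSubgroup.index h

/-- Left multiplication by ϖ^n carries the first step of the filtration to the n-th, so all
successive indices equal |k_D|. -/
theorem IsDivUniformizer.relIndex_pow (hϖ : IsDivUniformizer (F := F) ϖ) (n : ℕ) :
    ((val F D).leAddSubgroup (val F D ϖ ^ n)).relIndex ((val F D).leAddSubgroup 1) =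
      Nat.card (resRing F D) ^ n := by
  induction n with
  | zero => simp
  | succ n ih =>
    have h1 : val F D ϖ ^ (n + 1) ≤ val F D ϖ ^ n :=
      pow_le_pow_of_le_one zero_le hϖ.1.le (Nat.le_succ n)
    have h2 : val F D ϖ ^ n ≤ 1 := pow_le_one₀ zero_le hϖ.1.le
    have h3 : ((val F D).leAddSubgroup (val F D ϖ ^ (n + 1))).relIndex
        ((val F D).leAddSubgroup (val F D ϖ ^ n)) = Nat.card (resRing F D) := by
      rw [← hϖ.relIndex_uniformizer,
        ← AddSubgroup.relIndex_map_map_of_injective ((val F D).leAddSubgroup (val F D ϖ)) _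
          (mulLeft_injective (ϖ ^ n)),
        map_mulLeft_leAddSubgroup, map_mulLeft_leAddSubgroup, Units.val_pow_eq_pow_val, map_pow,
        mul_one, pow_succ]
    rw [← AddSubgroup.relIndex_mul_relIndex _ _ _ ((val F D).leAddSubgroup_monotone h1)
      ((val F D).leAddSubgroup_monotone h2), ih, h3, pow_succ']

end uniformizer

section card
variable (F D : Type*) [Field F] [ValuativeRel F] [TopologicalSpace F]
  [IsNonarchimedeanLocalField F] [DivisionRing D] [Algebra F D] [FiniteDimensional F D]
  [TopologicalSpace D] [IsTopologicalRing D] [IsModuleTopology F D]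

theorem exists_integral_basis :
    ∃ b : Module.Basis (Fin (Module.finrank F D)) F D, ∀ i, val F D (b i) ≤ 1 := by
  let b := Module.finBasis F D
  have h (i) : ∃ w : Fˣ, val F D ((w : F) • b i) ≤ 1 := by
    rcases le_total (val F D (b i)) 1 with h | h
    · exact ⟨1, by simpa using h⟩
    · have hb : b i ≠ 0 := b.ne_zero i
      have hN : Algebra.norm F (b i) ≠ 0 := by simpa [Algebra.norm_eq_zero_iff] using hb
      -- The scalar N(b)⁻¹ works: its `val` is v(b) to the power -[D : F], and v(b) ≥ 1.
      refine ⟨(Units.mk0 _ hN)⁻¹, ?_⟩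
      have hv : valuation F (Algebra.norm F (b i)) = val F D (b i) := rfl
      have h0 : 0 < val F D (b i) := zero_lt_one.trans_le h
      rw [Algebra.smul_def, map_mul, val_algebraMap]
      simp only [Units.val_inv_eq_inv_val, Units.val_mk0, map_inv₀, hv]
      rw [inv_pow, inv_mul_le_one₀ (pow_pos h0 _)]
      exact le_self_pow₀ h Module.finrank_pos.ne'
  choose w hw using h
  exact ⟨b.unitsSMul w, fun i => by rw [Module.Basis.unitsSMul_apply]; exact hw i⟩

variable {F D} in
-- For the lattice L spanned over 𝒪_F by an integral basis the index [L : πL] is q^[D:F]. It equals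
-- [𝒪_D : π𝒪_D], because [𝒪_D : L] = [π𝒪_D : πL] is finite and cancels.
theorem relIndex_algebraMap {z : F} (π : 𝒪[F]) (hπ : Irreducible π) (hz : z = π) :
    ((val F D).leAddSubgroup (val F D (algebraMap F D z))).relIndex
      ((val F D).leAddSubgroup 1) = Nat.card 𝓀[F] ^ Module.finrank F D := by
  subst hz
  obtain ⟨b, hb⟩ := exists_integral_basis F D
  have hπ0 : (π : F) ≠ 0 := by simpa using hπ.ne_zero
  let u : Dˣ := Units.mk0 (algebraMap F D π) (by simpa using hπ0)
  let θ : (Fin (Module.finrank F D) → 𝒪[F]) →+ D :=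
    { toFun := fun c => ∑ i, (c i : F) • b i
      map_zero' := by simp
      map_add' := fun c c' => by simp [add_smul, Finset.sum_add_distrib] }
  have hθ : Function.Injective θ := by
    rw [injective_iff_map_eq_zero]
    intro c hc
    have := Fintype.linearIndependent_iff.1 b.linearIndependent (fun i => (c i : F)) hc
    exact funext fun i => Subtype.ext (this i)
  set A := (val F D).leAddSubgroup 1 with hA
  set L : AddSubgroup D := θ.range with hL
  set P : AddSubgroup (Fin (Module.finrank F D) → 𝒪[F]) :=
    AddSubgroup.pi Set.univ fun _ => 𝓂[F].toAddSubgroup with hP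
  have hPL : P.map θ = L.map (AddMonoidHom.mulLeft (u : D)) := by
    ext x
    constructor
    · rintro ⟨c, hc, rfl⟩
      have h (i) : ∃ c' : 𝒪[F], c i = π * c' := by
        have h1 : c i ∈ 𝓂[F] := hc i trivial
        rw [hπ.maximalIdeal_eq, Ideal.mem_span_singleton] at h1
        exact h1
      choose c' hc' using h
      refine ⟨_, ⟨c', rfl⟩, ?_⟩
      change algebraMap F D π * ∑ i, (c' i : F) • b i = ∑ i, (c i : F) • b i
      simp only [hc', Subring.coe_mul, mul_smul]
      rw [← Finset.smul_sum, Algebra.smul_def]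
    · rintro ⟨_, ⟨c, rfl⟩, rfl⟩
      refine ⟨fun i => π * c i, fun i _ => ?_, ?_⟩
      · change π * c i ∈ 𝓂[F]
        rw [hπ.maximalIdeal_eq]
        exact Ideal.mem_span_singleton.2 (dvd_mul_right _ _)
      · change ∑ i, ((π * c i : 𝒪[F]) : F) • b i = algebraMap F D π * ∑ i, (c i : F) • b i
        simp only [Subring.coe_mul, mul_smul]
        rw [← Finset.smul_sum, Algebra.smul_def]
  have hLA : L ≤ A := by
    rintro _ ⟨c, rfl⟩
    change ∑ i, (c i : F) • b i ∈ A
    refine sum_mem fun i _ => ?_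
    rw [hA, Valuation.mem_leAddSubgroup_iff, Algebra.smul_def, map_mul, val_algebraMap]
    exact mul_le_one' (pow_le_one' (c i).2 _) (hb i)
  have hPLL : P.map θ ≤ L := by
    rintro _ ⟨c, -, rfl⟩
    exact ⟨c, rfl⟩
  have hidx : (P.map θ).relIndex L = Nat.card 𝓀[F] ^ Module.finrank F D := by
    rw [hL, AddMonoidHom.range_eq_map, AddSubgroup.relIndex_map_map_of_injective _ _ hθ,
      AddSubgroup.relIndex_top_right, hP, AddSubgroup.index_pi, Finset.prod_const,
      Finset.card_univ, Fintype.card_fin]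
    rfl
  have hfin : L.relIndex A ≠ 0 := by
    have : CompactSpace (intRing F D) := isCompact_iff_compactSpace.1 (isCompact_val_le_one F D)
    -- L is cut out by integrality of the coordinates, hence open, so it has finite index in the
    -- compact 𝒪_D.
    have hLo : IsOpen (L : Set D) := by
      have h1 : IsOpen {c : Fin (Module.finrank F D) → F | ∀ i, valuation F (c i) ≤ 1} := by
        rw [Set.ofPred_forall]
        refine isOpen_iInter_of_finite fun i => ?_
        exact (isOpen_valuation_mem (F := F) (S := Set.Iic 1)
          fun _ => ⟨1, one_ne_zero, fun c hc => hc.le⟩).preimage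
            (f := fun c : Fin (Module.finrank F D) → F => c i) (continuous_apply i)
      have h2 : Continuous b.equivFun :=
        IsModuleTopology.continuous_of_linearMap (R := F) b.equivFun.toLinearMap
      convert h1.preimage h2 using 1
      ext x
      constructor
      · rintro ⟨c, rfl⟩ i
        have : b.equivFun (θ c) i = c i := by
          change b.equivFun (∑ i, (c i : F) • b i) i = c i
          rw [← b.equivFun_symm_apply, LinearEquiv.apply_symm_apply]
        exact this.symm ▸ (c i).2
      · intro h
        exact ⟨fun i => ⟨b.equivFun x i, h i⟩, b.sum_equivFun x⟩
    have ho : IsOpen ((L.addSubgroupOf (intRing F D).toAddSubgroup :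
        AddSubgroup (intRing F D)) : Set (intRing F D)) := hLo.preimage continuous_subtype_val
    have := AddSubgroup.quotient_finite_of_isOpen _ ho
    exact (AddSubgroup.finiteIndex_of_finite_quotient (H := (L.addSubgroupOf
      (intRing F D).toAddSubgroup : AddSubgroup (intRing F D)))).index_ne_zero
  have huA : A.map (AddMonoidHom.mulLeft (u : D)) =
      (val F D).leAddSubgroup (val F D (algebraMap F D π)) := by
    rw [hA, map_mulLeft_leAddSubgroup, mul_one]; rfl
  have huAA : A.map (AddMonoidHom.mulLeft (u : D)) ≤ A := by
    rw [huA]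
    refine (val F D).leAddSubgroup_monotone ?_
    rw [val_algebraMap]
    exact pow_le_one' π.2 _
  have e1 := AddSubgroup.relIndex_mul_relIndex _ _ _ hPLL hLA
  have e2 := AddSubgroup.relIndex_mul_relIndex (P.map θ) _ _
    (hPL ▸ AddSubgroup.map_mono hLA) huAA
  rw [← e1, hidx, hPL, AddSubgroup.relIndex_map_map_of_injective _ _ (mulLeft_injective u),
    mul_comm] at e2
  rw [← huA]
  exact mul_right_cancel₀ hfin e2

variable {F D} in
/-- The residue ring of a division algebra of degree `d` with a uniformizer whose `d`-th power is
a uniformizer of the centre has `q ^ d` elements. -/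
theorem card_resRing {d : ℕ} (hd : d ≠ 0) (hD : Module.finrank F D = d ^ 2)
    {π : 𝒪[F]} (hπ : Irreducible π) {ϖ : Dˣ} (hϖ : IsDivUniformizer (F := F) ϖ)
    (hϖπ : (ϖ : D) ^ d = algebraMap F D (π : F)) :
    Nat.card (resRing F D) = Nat.card 𝓀[F] ^ d := by
  have h1 := relIndex_algebraMap (D := D) π hπ rfl
  -- The same index counted through ϖ^d is |k_D|^d, so |k_D|^d = (q^d)^d.
  rw [← hϖπ, map_pow, hϖ.relIndex_pow, hD, sq, pow_mul] at h1
  exact Nat.pow_left_injective hd h1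

end card
end DivAlg

namespace DivAlg
open ValuativeRel
attribute [local instance] fieldResRing

/-! ### The automorphism σ, the map from 𝒪_F to the residue field, and Teichmüller lifts. -/

theorem sum_range_shift {M : Type*} [AddCommGroup M] {n : ℕ} (g : ℕ → M) (h : g n = g 0) :
    ∑ i ∈ Finset.range n, g (i + 1) = ∑ i ∈ Finset.range n, g i := by
  have h1 := Finset.sum_range_succ g n
  rw [Finset.sum_range_succ', h] at h1
  exact add_right_cancel h1

section residueMaps
variable {F D : Type*} [Field F] [ValuativeRel F] [TopologicalSpace F]
  [IsNonarchimedeanLocalField F] [DivisionRing D] [Algebra F D] [FiniteDimensional F D]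

theorem resConj_mk (ϖ : Dˣ) (a : intRing F D) :
    resConj ϖ (Ideal.Quotient.mk (maxIdeal F D) a) =
      Ideal.Quotient.mk (maxIdeal F D) (intConj ϖ a) := rfl

theorem iterate_resConj_mk (ϖ : Dˣ) (a : intRing F D) (l : ℕ) :
    (resConj ϖ)^[l] (Ideal.Quotient.mk (maxIdeal F D) a) =
      Ideal.Quotient.mk (maxIdeal F D) ((intConj ϖ)^[l] a) := by
  induction l generalizing a with
  | zero => rfl
  | succ l ih => rw [Function.iterate_succ_apply, resConj_mk, ih, Function.iterate_succ_apply]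

theorem coe_iterate_intConj (ϖ : Dˣ) (a : intRing F D) (l : ℕ) :
    ((((intConj ϖ)^[l] a : intRing F D)) : D) * (ϖ : D) ^ l = (ϖ : D) ^ l * a := by
  induction l with
  | zero => simp
  | succ l ih =>
    rw [Function.iterate_succ_apply']
    change (ϖ : D) * ((intConj ϖ)^[l] a : intRing F D) * ((ϖ⁻¹ : Dˣ) : D) * (ϖ : D) ^ (l + 1) = _
    rw [pow_succ', mul_assoc _ ((ϖ⁻¹ : Dˣ) : D), Units.inv_mul_cancel_left, mul_assoc, ih,
      ← mul_assoc]

theorem iterate_resConj_eq {ϖ : Dˣ} {d : ℕ} {z : F} (hϖ : (ϖ : D) ^ d = algebraMap F D z)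
    (x : resRing F D) : (resConj ϖ)^[d] x = x := by
  obtain ⟨a, rfl⟩ := Ideal.Quotient.mk_surjective x
  rw [iterate_resConj_mk]
  congr 1
  refine Subtype.ext ?_
  have h := coe_iterate_intConj ϖ a d
  rw [hϖ, Algebra.commutes, ← hϖ] at h
  exact (ϖ ^ d).isUnit.mul_right_injective (by simpa using h)

theorem algebraMap_mem_intRing {z : F} (hz : valuation F z ≤ 1) :
    algebraMap F D z ∈ intRing F D := by
  rw [Valuation.mem_integer_iff, val_algebraMap]
  exact pow_le_one' hz _

variable (F D) in
/-- The inclusion `𝒪_F → 𝒪_D`. -/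
noncomputable def intMap : 𝒪[F] →+* intRing F D :=
  ((algebraMap F D).comp (𝒪[F]).subtype).codRestrict _ fun z => algebraMap_mem_intRing z.2

theorem coe_intMap (z : 𝒪[F]) : (intMap F D z : D) = algebraMap F D z := rfl

variable (F D) in
/-- The map `𝒪_F → k_D`. -/
noncomputable def baseRes : 𝒪[F] →+* resRing F D :=
  (Ideal.Quotient.mk (maxIdeal F D)).comp (intMap F D)

theorem baseRes_apply (z : 𝒪[F]) :
    baseRes F D z = Ideal.Quotient.mk (maxIdeal F D) (intMap F D z) := rfl

theorem mem_maximalIdeal_iff (z : 𝒪[F]) : z ∈ 𝓂[F] ↔ valuation F z < 1 := by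
  rw [IsLocalRing.mem_maximalIdeal, mem_nonunits_iff, lt_iff_le_and_ne]
  have hz : valuation F (z : F) ≤ 1 := z.2
  refine ⟨fun h => ⟨hz, fun h1 => h ?_⟩, fun h hu => h.2 ?_⟩
  · exact (Valuation.Integers.isUnit_iff_valuation_eq_one
      (Valuation.integer.integers (valuation F))).2 h1
  · exact (Valuation.Integers.isUnit_iff_valuation_eq_one
      (Valuation.integer.integers (valuation F))).1 hu

theorem baseRes_eq_zero {z : 𝒪[F]} : baseRes F D z = 0 ↔ z ∈ 𝓂[F] := by
  rw [baseRes_apply, resRing_mk_eq_zero, coe_intMap, val_algebraMap, mem_maximalIdeal_iff,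
    pow_lt_one_iff_of_nonneg zero_le Module.finrank_pos.ne']

theorem baseRes_pow_card (z : 𝒪[F]) : baseRes F D z ^ Nat.card 𝓀[F] = baseRes F D z := by
  rw [← map_pow, ← sub_eq_zero, ← map_sub, baseRes_eq_zero, ← Ideal.Quotient.eq_zero_iff_mem,
    map_sub, map_pow, sub_eq_zero]
  have := Fintype.ofFinite 𝓀[F]
  rw [Nat.card_eq_fintype_card]
  exact FiniteField.pow_card (K := 𝓀[F]) (IsLocalRing.residue 𝒪[F] z)

variable {p : ℕ} [Fact p.Prime] {f : ℕ}

theorem natCast_mem_maximalIdeal (hf : Nat.card 𝓀[F] = p ^ f) : (p : 𝒪[F]) ∈ 𝓂[F] := by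
  have := Fintype.ofFinite 𝓀[F]
  have h := Nat.cast_card_eq_zero 𝓀[F]
  rw [← Nat.card_eq_fintype_card, hf, Nat.cast_pow] at h
  have h2 : (p : 𝓀[F]) = 0 := eq_zero_of_pow_eq_zero h
  rw [← map_natCast (IsLocalRing.residue 𝒪[F])] at h2
  exact (IsLocalRing.residue_eq_zero_iff _).1 h2

theorem charP_resRing (hf : Nat.card 𝓀[F] = p ^ f) : CharP (resRing F D) p := by
  refine (CharP.charP_iff_prime_eq_zero Fact.out).2 ?_
  have h := baseRes_eq_zero (D := D).2 (natCast_mem_maximalIdeal hf)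
  rwa [map_natCast] at h

end residueMaps

section teichmuller
variable {F D : Type*} [Field F] [ValuativeRel F] [TopologicalSpace F]
  [IsNonarchimedeanLocalField F] [DivisionRing D] [Algebra F D] [FiniteDimensional F D]
  [TopologicalSpace D] [IsTopologicalRing D] [IsModuleTopology F D]
  {ϖ : Dˣ}

theorem IsDivUniformizer.eq_zero_of_forall_le (hϖ : IsDivUniformizer (F := F) ϖ) {x : D}
    (h : ∀ n : ℕ, val F D x ≤ val F D ϖ ^ n) : x = 0 := by
  by_contra h0
  obtain ⟨n, hn⟩ := hϖ.exists_val_eq_pow h0 (by simpa using h 0)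
  have h1 := h (n + 1)
  rw [hn, pow_succ] at h1
  exact absurd h1 (not_le.2 (mul_lt_of_lt_one_right (pow_pos (val_units_pos ϖ) n) hϖ.1))

theorem val_pow_sub_pow_le {x y : D} (hx : val F D x ≤ 1) (hy : val F D y ≤ 1) (n : ℕ) :
    val F D (x ^ n - y ^ n) ≤ val F D (x - y) := by
  induction n with
  | zero => simp
  | succ n ih =>
    have h : x ^ (n + 1) - y ^ (n + 1) = (x ^ n - y ^ n) * x + y ^ n * (x - y) := by
      rw [pow_succ, pow_succ]; noncomm_ring
    rw [h]
    refine (val F D).map_add_le ?_ ?_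
    · rw [map_mul]
      exact (mul_le_of_le_one_right' hx).trans ih
    · rw [map_mul, map_pow]
      exact mul_le_of_le_one_left' (pow_le_one' hy n)

/-- For congruent commuting elements the cofactor of x - y in x^Q - y^Q reduces to Q y^(Q-1) = 0 in
k_D, which gains one power of ϖ. -/
theorem val_pow_card_sub_lt (hϖ : IsDivUniformizer (F := F) ϖ) {x y : intRing F D}
    (hxy : Commute x y) {m : ℕ} (hm : m ≠ 0) (h : val F D (x - y) ≤ val F D ϖ ^ m) :
    val F D ((x ^ Nat.card (resRing F D) - y ^ Nat.card (resRing F D) : intRing F D) : D) ≤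
      val F D ϖ ^ (m + 1) := by
  set Q := Nat.card (resRing F D)
  have h1 := hxy.mul_geom_sum₂ Q
  rw [← h1]
  have h2 : val F D ((∑ i ∈ Finset.range Q, x ^ i * y ^ (Q - 1 - i) : intRing F D) : D) < 1 := by
    rw [← resRing_mk_eq_zero, map_sum]
    have h3 : Ideal.Quotient.mk (maxIdeal F D) x = Ideal.Quotient.mk (maxIdeal F D) y := by
      rw [← sub_eq_zero, ← map_sub, resRing_mk_eq_zero]
      exact h.trans_lt (pow_lt_one₀ zero_le hϖ.1 hm)
    have h4 : ∀ i ∈ Finset.range Q, Ideal.Quotient.mk (maxIdeal F D) (x ^ i * y ^ (Q - 1 - i)) =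
        Ideal.Quotient.mk (maxIdeal F D) y ^ (Q - 1) := fun i hi => by
      rw [map_mul, map_pow, map_pow, h3, ← pow_add]
      congr 1
      have := Finset.mem_range.1 hi
      omega
    rw [Finset.sum_congr rfl h4, Finset.sum_const, Finset.card_range, nsmul_eq_mul]
    have := Fintype.ofFinite (resRing F D)
    have h5 : (Q : resRing F D) = 0 := by
      rw [show Q = Fintype.card (resRing F D) from Nat.card_eq_fintype_card]
      exact Nat.cast_card_eq_zero _
    rw [h5, zero_mul]
  rw [Subring.coe_mul, map_mul, pow_succ]
  exact mul_le_mul' h (hϖ.2 _ h2)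

/-- Teichmüller representatives. -/
theorem exists_pow_card_eq (hϖ : IsDivUniformizer (F := F) ϖ) (y : resRing F D) :
    ∃ t : intRing F D, Ideal.Quotient.mk (maxIdeal F D) t = y ∧
      t ^ Nat.card (resRing F D) = t := by
  obtain ⟨a, rfl⟩ := Ideal.Quotient.mk_surjective y
  set Q := Nat.card (resRing F D) with hQ
  have hstep (n : ℕ) : val F D ((a ^ Q ^ (n + 1) - a ^ Q ^ n : intRing F D) : D) ≤
      val F D ϖ ^ (n + 1) := by
    induction n with
    | zero =>
      rw [zero_add, pow_one (val F D ϖ)]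
      refine hϖ.2 _ ?_
      rw [← resRing_mk_eq_zero, map_sub, map_pow, map_pow, sub_eq_zero, pow_zero, pow_one, pow_one]
      have := Fintype.ofFinite (resRing F D)
      rw [hQ, Nat.card_eq_fintype_card]
      exact FiniteField.pow_card _
    | succ n ih =>
      have := val_pow_card_sub_lt hϖ ((Commute.refl a).pow_pow _ _) (Nat.succ_ne_zero n) ih
      rwa [← pow_mul, ← pow_mul, ← pow_succ, ← pow_succ] at this
  -- The limit of a^(Q^n) is found as a point common to nested nonempty closed balls in the compact
  -- 𝒪_D.
  let S : ℕ → Set D := fun n => {x | val F D (x - (a ^ Q ^ n : intRing F D)) ≤ val F D ϖ ^ (n + 1)}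
  have hclosed (n : ℕ) : IsClosed (S n) :=
    (isClosed_val_le (F := F) (D := D) (val F D ϖ ^ (n + 1))).preimage
      (f := fun x => x - ((a ^ Q ^ n : intRing F D) : D)) (continuous_id.sub continuous_const)
  have hsub (n : ℕ) : S (n + 1) ⊆ S n := by
    intro x hx
    have hx : val F D (x - (a ^ Q ^ (n + 1) : intRing F D)) ≤ val F D ϖ ^ (n + 1 + 1) := hx
    have h2 : x - (a ^ Q ^ n : intRing F D) = (x - (a ^ Q ^ (n + 1) : intRing F D)) +
        ((a ^ Q ^ (n + 1) - a ^ Q ^ n : intRing F D) : D) := by push_cast; abel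
    change val F D (x - (a ^ Q ^ n : intRing F D)) ≤ val F D ϖ ^ (n + 1)
    rw [h2]
    exact (val F D).map_add_le
      (hx.trans (pow_le_pow_of_le_one zero_le hϖ.1.le (Nat.le_succ _))) (hstep n)
  have hS0 : S 0 ⊆ {x | val F D x ≤ 1} := by
    intro x hx
    have hx : val F D (x - (a ^ Q ^ 0 : intRing F D)) ≤ val F D ϖ ^ (0 + 1) := hx
    have := (val F D).map_add_le (hx.trans (pow_le_one₀ zero_le hϖ.1.le)) (a ^ Q ^ 0).2
    simpa using this
  obtain ⟨t, ht⟩ := IsCompact.nonempty_iInter_of_sequence_nonempty_isCompact_isClosed S hsub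
    (fun n => ⟨(a ^ Q ^ n : intRing F D), by simp [S]⟩)
    ((isCompact_val_le_one F D).of_isClosed_subset (hclosed 0) hS0) hclosed
  have ht (n : ℕ) : val F D (t - (a ^ Q ^ n : intRing F D)) ≤ val F D ϖ ^ (n + 1) :=
    Set.mem_iInter.1 ht n
  have ht1 : val F D t ≤ 1 := hS0 (ht 0)
  refine ⟨⟨t, ht1⟩, ?_, Subtype.ext ?_⟩
  · rw [← sub_eq_zero, ← map_sub, resRing_mk_eq_zero]
    have := ht 0
    rw [pow_zero, pow_one, zero_add, pow_one] at this
    exact this.trans_lt hϖ.1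
  · rw [← sub_eq_zero]
    refine hϖ.eq_zero_of_forall_le fun n => ?_
    have h1 := (val_pow_sub_pow_le ht1 (a ^ Q ^ n).2 Q).trans (ht n)
    have h2 := (ht (n + 1))
    have h3 : (((⟨t, ht1⟩ : intRing F D) ^ Q : intRing F D) : D) - t =
        (t ^ Q - ((a ^ Q ^ n : intRing F D) : D) ^ Q) -
          (t - (a ^ Q ^ (n + 1) : intRing F D)) := by
      push_cast
      rw [← pow_mul, ← pow_succ]
      abel
    change val F D ((((⟨t, ht1⟩ : intRing F D) ^ Q : intRing F D) : D) - t) ≤ _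
    rw [h3]
    exact (val F D).map_sub_le
      (h1.trans (pow_le_pow_of_le_one zero_le hϖ.1.le (Nat.le_succ _)))
      (h2.trans (pow_le_pow_of_le_one zero_le hϖ.1.le (by omega)))

/-- The Teichmüller lift is multiplicative. -/
theorem exists_teichmuller (hϖ : IsDivUniformizer (F := F) ϖ) :
    ∃ T : (resRing F D)ˣ →* (intRing F D)ˣ,
      ∀ y, Ideal.Quotient.mk (maxIdeal F D) (T y) = y := by
  obtain ⟨ζ, hζ⟩ := IsCyclic.exists_generator (α := (resRing F D)ˣ)
  obtain ⟨t, ht1, ht2⟩ := exists_pow_card_eq hϖ (ζ : resRing F D)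
  have htu : IsUnit t := by
    refine isUnit_of_val_eq_one (le_antisymm t.2 (not_lt.1 fun h => ?_))
    rw [← resRing_mk_eq_zero, ht1] at h
    exact ζ.ne_zero h
  obtain ⟨t, rfl⟩ := htu
  -- Since t^(Q-1) = 1, sending the generator ζ of the cyclic group k_Dˣ to `t` defines a
  -- homomorphism.
  have hord : orderOf t ∣ orderOf ζ := by
    rw [orderOf_eq_card_of_forall_mem_zpowers hζ, Nat.card_units, orderOf_dvd_iff_pow_eq_one]
    have h2 : t ^ (Nat.card (resRing F D) - 1) * t = 1 * t := by
      rw [← pow_succ, Nat.sub_add_cancel Nat.card_pos, one_mul]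
      exact Units.ext (by simpa using ht2)
    exact mul_right_cancel h2
  refine ⟨monoidHomOfForallMemZpowers hζ hord, fun y => ?_⟩
  obtain ⟨n, rfl⟩ := hζ y
  have h3 : Units.map (Ideal.Quotient.mk (maxIdeal F D) : _ →* resRing F D) t = ζ :=
    Units.ext ht1
  have h4 : Units.map (Ideal.Quotient.mk (maxIdeal F D) : _ →* resRing F D)
      (monoidHomOfForallMemZpowers hζ hord (ζ ^ n)) = ζ ^ n := by
    rw [map_zpow, monoidHomOfForallMemZpowers_apply_gen, map_zpow, h3]
  exact congrArg Units.val h4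

end teichmuller
end DivAlg

namespace DivAlg
open ValuativeRel
attribute [local instance] fieldResRing

/-! ### The fixed field and the order of σ. -/

section eigen
variable {D : Type*} [DivisionRing D]

/-- An element of a division ring commutes with everything as soon as it commutes with the
eigenvectors of the conjugation by an element of finite order. -/
theorem commute_of_commute_eigenvectors {n : ℕ} (hn0 : (n : D) ≠ 0) {t : D} (ht : t ^ n = 1)
    (hord : ∀ i, 0 < i → i < n → t ^ i ≠ 1) {e : D}
    (he : ∀ (z : D) (m : ℕ), z * t = t ^ m * z → e * z = z * e) (z : D) : e * z = z * e := by
  have hnpos : n ≠ 0 := by rintro rfl; simp at hn0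
  have ht0 : t ≠ 0 := by rintro rfl; simp [hnpos] at ht
  set s := t⁻¹ with hs
  have hsn : s ^ n = 1 := by rw [hs, inv_pow, ht, inv_one]
  -- The sum of `g m i` over i is the component of `z` on which right multiplication by `t` is left
  -- multiplication by t^m; the components add up to n z.
  let g : ℕ → ℕ → D := fun m i => (s ^ m) ^ i * z * t ^ i
  have hz (m : ℕ) : e * (∑ i ∈ Finset.range n, g m i) = (∑ i ∈ Finset.range n, g m i) * e := by
    refine he _ m ?_
    have h1 : g m n = g m 0 := by
      simp only [g]
      rw [← pow_mul, mul_comm m n, pow_mul, hsn, ht]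
      simp
    nth_rewrite 2 [← sum_range_shift (g m) h1]
    rw [Finset.sum_mul, Finset.mul_sum]
    refine Finset.sum_congr rfl fun i _ => ?_
    have h2 : t ^ m * s ^ m = 1 := by
      rw [hs, inv_pow, mul_inv_cancel₀ (pow_ne_zero _ ht0)]
    simp only [g]
    rw [pow_succ' (s ^ m), pow_succ t]
    calc _ = 1 * ((s ^ m) ^ i * z * t ^ i * t) := by rw [one_mul]
      _ = _ := by rw [← h2]; noncomm_ring
  have hsum : ∑ m ∈ Finset.range n, ∑ i ∈ Finset.range n, g m i = n * z := by
    rw [Finset.sum_comm, Finset.sum_eq_single 0]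
    · simp [g]
    · intro i hi hi0
      simp only [g]
      rw [← Finset.sum_mul, ← Finset.sum_mul]
      have h3 : ∑ m ∈ Finset.range n, (s ^ m) ^ i = 0 := by
        have h4 := mul_neg_geom_sum (s ^ i) n
        rw [← pow_mul, mul_comm i n, pow_mul, hsn, one_pow, sub_self] at h4
        have h5 : 1 - s ^ i ≠ 0 := by
          rw [sub_ne_zero, hs, inv_pow]
          intro h
          exact hord i (Nat.pos_of_ne_zero hi0) (Finset.mem_range.1 hi) (inv_eq_one.1 h.symm)
        rw [← (mul_eq_zero.1 h4).resolve_left h5]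
        exact Finset.sum_congr rfl fun m _ => pow_right_comm _ _ _
      rw [h3, zero_mul, zero_mul]
    · intro h; exact absurd (Finset.mem_range.2 (Nat.pos_of_ne_zero hnpos)) h
  have h6 : e * (n * z) = (n * z) * e := by
    rw [← hsum, Finset.mul_sum, Finset.sum_mul]
    exact Finset.sum_congr rfl fun m _ => hz m
  rw [← mul_assoc, ← (Nat.cast_commute n e).eq, mul_assoc, mul_assoc] at h6
  exact mul_left_cancel₀ hn0 h6

end eigen

section fixed
variable {F D : Type*} [Field F] [ValuativeRel F] [TopologicalSpace F]
  [IsNonarchimedeanLocalField F] [DivisionRing D] [Algebra F D] [FiniteDimensional F D]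
  [TopologicalSpace D] [IsTopologicalRing D] [IsModuleTopology F D]
  {ϖ : Dˣ} {d : ℕ} {π : 𝒪[F]}

/-- Every nonzero element is `w ϖ ^ l π ^ j` with `w` a unit and `l < d`. -/
theorem IsDivUniformizer.exists_eq_mul (hϖ : IsDivUniformizer (F := F) ϖ) (hd : d ≠ 0)
    (hϖπ : (ϖ : D) ^ d = algebraMap F D (π : F)) {z : D} (hz : z ≠ 0) :
    ∃ (w : (intRing F D)ˣ) (l : ℕ) (c : Fˣ), l < d ∧
      z = (w : intRing F D) * (ϖ : D) ^ l * algebraMap F D c := by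
  obtain ⟨n, hn⟩ := hϖ.exists_val_eq_zpow hz
  have hπ0 : (π : F) ≠ 0 := by
    intro h
    rw [h, map_zero] at hϖπ
    exact pow_ne_zero d ϖ.ne_zero hϖπ
  -- Euclidean division of the exponent by d: the quotient gives a central power of π, the remainder
  -- a power ϖ^l.
  let c : Fˣ := Units.mk0 (π : F) hπ0 ^ (n / d)
  have hc : algebraMap F D c = (ϖ : D) ^ (d * (n / d)) := by
    simp only [c, Units.val_zpow_eq_zpow_val, Units.val_mk0, map_zpow₀, ← hϖπ]
    rw [zpow_mul, zpow_natCast]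
  have hdz : (d : ℤ) ≠ 0 := by exact_mod_cast hd
  have hl : 0 ≤ n % d := Int.emod_nonneg _ hdz
  obtain ⟨l, hl'⟩ := Int.eq_ofNat_of_zero_le hl
  have hϖn : (ϖ : D) ^ l * algebraMap F D c = (ϖ : D) ^ n := by
    rw [hc, ← zpow_natCast, ← zpow_add₀ ϖ.ne_zero, ← hl', Int.emod_add_mul_ediv]
  have hval : val F D (z * ((ϖ : D) ^ n)⁻¹) = 1 := by
    rw [map_mul, map_inv₀, map_zpow₀, ← hn, mul_inv_cancel₀ (by simpa using hz)]
  obtain ⟨w, hw⟩ := isUnit_of_val_eq_one (x := ⟨z * ((ϖ : D) ^ n)⁻¹, hval.le⟩) hval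
  refine ⟨w, l, c, ?_, ?_⟩
  · have := Int.emod_lt_of_pos n (Int.natCast_pos.2 (Nat.pos_of_ne_zero hd))
    omega
  · rw [mul_assoc, hϖn, hw, mul_assoc, inv_mul_cancel₀ (zpow_ne_zero _ ϖ.ne_zero), mul_one]

/-- Traces of Teichmüller representatives under conjugation by a uniformizer are central. -/
theorem exists_baseRes_eq_sum [Algebra.IsCentral F D] (hϖ : IsDivUniformizer (F := F) ϖ)
    (hd : d ≠ 0) (hϖπ : (ϖ : D) ^ d = algebraMap F D (π : F)) (y : (resRing F D)ˣ) :
    ∃ c : 𝒪[F], baseRes F D c = ∑ j ∈ Finset.range d, (resConj ϖ)^[j] (y : resRing F D) := by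
  obtain ⟨T, hT⟩ := exists_teichmuller (F := F) (D := D) hϖ
  let mk := Ideal.Quotient.mk (maxIdeal F D)
  let σ : (resRing F D)ˣ →* (resRing F D)ˣ := Units.map (resConj (F := F) ϖ : resRing F D →* resRing F D)
  have hσ (j : ℕ) (x : (resRing F D)ˣ) : ((σ^[j] x : (resRing F D)ˣ) : resRing F D) =
      (resConj ϖ)^[j] (x : resRing F D) := by
    induction j generalizing x with
    | zero => rfl
    | succ j ih => rw [Function.iterate_succ_apply, ih]; rfl
  let T' : (resRing F D)ˣ →* D := ((intRing F D).subtype : intRing F D →* D).comp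
    ((Units.coeHom _).comp T)
  have hTinj : Function.Injective T' := fun a b h => by
    have h1 : (T a : intRing F D) = T b := Subtype.ext h
    exact Units.ext (by rw [← hT, ← hT, h1])
  obtain ⟨ζ, hζ⟩ := IsCyclic.exists_generator (α := (resRing F D)ˣ)
  set t := T' ζ with ht
  set n := Nat.card (resRing F D)ˣ with hn
  have hordζ : orderOf ζ = n := orderOf_eq_card_of_forall_mem_zpowers hζ
  -- The trace of Teichmüller lifts over the σ-orbit of `y`; it will be shown to be central.
  let e : D := ∑ j ∈ Finset.range d, T' (σ^[j] y)
  have hcard : (n : resRing F D) = -1 := by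
    have := Fintype.ofFinite (resRing F D)
    rw [hn, Nat.card_units, Nat.cast_sub Nat.card_pos, Nat.card_eq_fintype_card,
      Nat.cast_card_eq_zero]
    simp
  have hn0 : (n : D) ≠ 0 := by
    intro h
    have h1 : (n : intRing F D) = 0 := Subtype.ext (by simpa using h)
    have h2 := congrArg mk h1
    rw [map_natCast, map_zero, hcard] at h2
    exact neg_ne_zero.2 one_ne_zero h2
  -- Write an eigenvector as z = w ϖ^l c. Reducing the eigenvector relation modulo 𝔪_D gives σ^l(ζ)
  -- = ζ^m, the unit `w` cancelling as k_D is commutative. Hence conjugation by z moves each lift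
  -- T(x) to T(σ^l(x)) and only permutes the terms of `e`.
  have key : ∀ (z : D) (m : ℕ), z * t = t ^ m * z → e * z = z * e := by
    intro z m hz
    rcases eq_or_ne z 0 with rfl | hz0
    · simp
    obtain ⟨w, l, c, -, hwz⟩ := hϖ.exists_eq_mul hd hϖπ hz0
    have hcc (x : D) : algebraMap F D c * x = x * algebraMap F D c := Algebra.commutes _ _
    have hc0 : algebraMap F D c ≠ 0 := by simp
    have h1 : (T ζ : intRing F D) ^ m * (w : intRing F D) =
        (w : intRing F D) * (intConj ϖ)^[l] (T ζ : intRing F D) := by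
      refine Subtype.ext ?_
      have h2 := coe_iterate_intConj ϖ (T ζ : intRing F D) l
      rw [hwz] at hz
      have h3 : (w : intRing F D) * (ϖ : D) ^ l * (t * algebraMap F D c) =
          t ^ m * ((w : intRing F D) * (ϖ : D) ^ l * algebraMap F D c) := by
        rw [← hz, ← hcc]; noncomm_ring
      rw [← mul_assoc, ← mul_assoc] at h3
      have h4 := mul_right_cancel₀ hc0 h3
      rw [mul_assoc, show t = ((T ζ : intRing F D) : D) from rfl, ← h2] at h4
      push_cast
      refine mul_right_cancel₀ (pow_ne_zero l ϖ.ne_zero) ?_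
      rw [mul_assoc, mul_assoc, h4]
    have h2 : ζ ^ m = σ^[l] ζ := by
      have h3 := congrArg mk h1
      rw [map_mul, map_mul, map_pow, ← iterate_resConj_mk, hT, mul_comm] at h3
      refine Units.ext ?_
      rw [hσ, Units.val_pow_eq_pow_val]
      exact ((w.isUnit.map mk).mul_right_injective h3)
    have h3 (x : (resRing F D)ˣ) : z * T' x = T' (σ^[l] x) * z := by
      obtain ⟨i, rfl⟩ := mem_powers_iff_mem_zpowers.2 (hζ x)
      have h4 : σ^[l] (ζ ^ i) = (ζ ^ m) ^ i := by
        rw [h2, iterate_map_pow]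
      change z * T' (ζ ^ i) = T' (σ^[l] (ζ ^ i)) * z
      rw [h4, map_pow, map_pow, map_pow, ← ht]
      exact SemiconjBy.pow_right (show SemiconjBy z t (t ^ m) from hz) i
    have h5 (a : ℕ) : ∑ j ∈ Finset.range d, T' (σ^[a + j] y) = e := by
      induction a with
      | zero => simp [e]
      | succ a ih =>
        rw [← ih]
        have := sum_range_shift (n := d) (fun j => T' (σ^[a + j] y)) ?_
        · rw [← this]
          refine Finset.sum_congr rfl fun j _ => ?_
          rw [show a + 1 + j = a + (j + 1) by ring]
        · congr 1
          rw [Function.iterate_add_apply, Function.iterate_add_apply, Function.iterate_zero, id]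
          congr 1
          exact Units.ext (by rw [hσ, iterate_resConj_eq hϖπ])
    have h6 : z * e = e * z := by
      nth_rewrite 2 [← h5 l]
      rw [Finset.mul_sum, Finset.sum_mul]
      refine Finset.sum_congr rfl fun j _ => ?_
      rw [h3, ← Function.iterate_add_apply]
    exact h6.symm
  have hpow : t ^ n = 1 := by rw [ht, ← map_pow, ← hordζ, pow_orderOf_eq_one, map_one]
  have hne : ∀ i, 0 < i → i < n → t ^ i ≠ 1 := by
    intro i hi hin h
    rw [ht, ← map_pow, ← map_one T'] at h
    have := orderOf_dvd_of_pow_eq_one (hTinj h)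
    rw [hordζ] at this
    exact absurd (Nat.le_of_dvd hi this) (not_le.2 hin)
  have hcentral : e ∈ Subalgebra.center F D :=
    Subalgebra.mem_center_iff.2 fun z =>
      (commute_of_commute_eigenvectors hn0 hpow hne key z).symm
  rw [Algebra.IsCentral.center_eq_bot, Algebra.mem_bot] at hcentral
  obtain ⟨c, hc⟩ := hcentral
  have he : e = ((∑ j ∈ Finset.range d, (T (σ^[j] y) : intRing F D) : intRing F D) : D) := by
    push_cast; rfl
  have hc1 : valuation F c ≤ 1 := by
    have h1 : val F D e ≤ 1 := he ▸ Subtype.prop (p := (· ∈ intRing F D)) _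
    rw [← hc, val_algebraMap] at h1
    exact (pow_le_one_iff_of_nonneg zero_le Module.finrank_pos.ne').1 h1
  refine ⟨⟨c, hc1⟩, ?_⟩
  have h2 : intMap F D ⟨c, hc1⟩ = ∑ j ∈ Finset.range d, (T (σ^[j] y) : intRing F D) :=
    Subtype.ext (hc.trans he)
  rw [baseRes_apply, h2, map_sum]
  exact Finset.sum_congr rfl fun j _ => by rw [hT, hσ]

variable {p : ℕ} [Fact p.Prime] {f : ℕ}

/-- The fixed field of the automorphism `σ` of `k_D` is `k_F`. -/
theorem exists_baseRes_eq [Algebra.IsCentral F D] (hf : Nat.card 𝓀[F] = p ^ f)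
    (hpd : Nat.Coprime p d) (hϖ : IsDivUniformizer (F := F) ϖ)
    (hd : d ≠ 0) (hϖπ : (ϖ : D) ^ d = algebraMap F D (π : F)) {x : resRing F D}
    (hx : resConj ϖ x = x) : ∃ c : 𝒪[F], baseRes F D c = x := by
  rcases eq_or_ne x 0 with rfl | h0
  · exact ⟨0, map_zero _⟩
  obtain ⟨c, hc⟩ := exists_baseRes_eq_sum hϖ hd hϖπ (Units.mk0 x h0)
  have h1 : ∑ j ∈ Finset.range d, (resConj ϖ)^[j] (Units.mk0 x h0 : resRing F D) = d * x := by
    have h2 (j : ℕ) : (resConj ϖ)^[j] x = x := Function.iterate_fixed hx j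
    simp [h2]
  rw [h1] at hc
  -- The trace of a fixed element is d x; Bézout inverts d modulo p by an integer, so x itself comes
  -- from 𝒪_F.
  have h2 : ((d : ℤ) * Nat.gcdA d p + (p : ℤ) * Nat.gcdB d p) = 1 := by
    rw [← Nat.gcd_eq_gcd_ab, Nat.Coprime.gcd_eq_one hpd.symm]; rfl
  have := charP_resRing (F := F) (D := D) hf
  have h3 : (d : resRing F D) * (Nat.gcdA d p : ℤ) = 1 := by
    have := congrArg (Int.cast : ℤ → resRing F D) h2
    push_cast at this
    rwa [CharP.cast_eq_zero (resRing F D) p, zero_mul, add_zero] at this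
  refine ⟨(Nat.gcdA d p : ℤ) * c, ?_⟩
  rw [map_mul, map_intCast, hc, ← mul_assoc, mul_comm _ (d : resRing F D), h3, one_mul]

end fixed

section finiteField

/-- By the Galois correspondence: an automorphism fixing the fixed field of σ lies in the group
generated by σ, and finiteness makes the exponent a natural number. -/
theorem exists_iterate_eq_pow {κ : Type*} [Field κ] [Finite κ] (p : ℕ) [Fact p.Prime] [CharP κ p]
    (σ : κ →+* κ) (f : ℕ) (h : ∀ x, σ x = x → x ^ p ^ f = x) :
    ∃ s : ℕ, ∀ x, x ^ p ^ f = σ^[s] x := by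
  let : Algebra (ZMod p) κ := ZMod.algebra κ p
  have : Module.Finite (ZMod p) κ := Module.Finite.of_finite
  have hbij : Function.Bijective σ := Finite.injective_iff_bijective.1 σ.injective
  let τ : κ ≃ₐ[ZMod p] κ := AlgEquiv.ofRingEquiv (f := RingEquiv.ofBijective σ hbij)
    fun x => DFunLike.congr_fun (Subsingleton.elim ((σ : κ →+* κ).comp (algebraMap (ZMod p) κ))
      (algebraMap (ZMod p) κ)) x
  let φ : κ ≃ₐ[ZMod p] κ := FiniteField.frobeniusAlgEquivOfAlgebraic (ZMod p) κ ^ f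
  have hφ (x : κ) : φ x = x ^ p ^ f := by
    simp only [φ]
    rw [AlgEquiv.coe_pow, FiniteField.coe_frobeniusAlgEquivOfAlgebraic_iterate]
    simp
  have hmem : φ ∈ IntermediateField.fixingSubgroup
      (IntermediateField.fixedField (Subgroup.zpowers τ)) := by
    rw [IntermediateField.mem_fixingSubgroup_iff]
    intro x hx
    rw [hφ]
    exact h x (hx ⟨τ, Subgroup.mem_zpowers τ⟩)
  rw [IntermediateField.fixingSubgroup_fixedField] at hmem
  obtain ⟨s, hs⟩ := mem_powers_iff_mem_zpowers.2 hmem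
  refine ⟨s, fun x => ?_⟩
  rw [← hφ, ← hs]
  simp only [AlgEquiv.coe_pow]
  rfl

end finiteField

section order
variable {F D : Type*} [Field F] [ValuativeRel F] [TopologicalSpace F]
  [IsNonarchimedeanLocalField F] [DivisionRing D] [Algebra F D] [FiniteDimensional F D]
  [TopologicalSpace D] [IsTopologicalRing D] [IsModuleTopology F D] [Algebra.IsCentral F D]
  {ϖ : Dˣ} {d : ℕ} {π : 𝒪[F]} {p : ℕ} [Fact p.Prime] {f : ℕ}

/-- The `q`-th power map of `k_D` is a power of `σ`. -/
theorem exists_pow_eq_iterate_resConj (hf : Nat.card 𝓀[F] = p ^ f)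
    (hpd : Nat.Coprime p d) (hϖ : IsDivUniformizer (F := F) ϖ)
    (hd : d ≠ 0) (hϖπ : (ϖ : D) ^ d = algebraMap F D (π : F)) :
    ∃ s : ℕ, ∀ x : resRing F D, x ^ p ^ f = (resConj ϖ)^[s] x := by
  have := charP_resRing (F := F) (D := D) hf
  refine exists_iterate_eq_pow p (resConj (F := F) (D := D) ϖ) f fun x hx => ?_
  obtain ⟨c, rfl⟩ := exists_baseRes_eq hf hpd hϖ hd hϖπ hx
  rw [← hf, baseRes_pow_card]

/-- With x^q = σ^s(x), the relation σ^a = 1 gives x^(q^a) = x on all of k_D. A polynomial of degree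
q^a then has q^d roots, so d ≤ a. -/
theorem le_of_iterate_resConj_eq (hf : Nat.card 𝓀[F] = p ^ f)
    (hpd : Nat.Coprime p d) (hϖ : IsDivUniformizer (F := F) ϖ)
    (hd : d ≠ 0) (hϖπ : (ϖ : D) ^ d = algebraMap F D (π : F))
    (hD : Module.finrank F D = d ^ 2) (hπ : Irreducible π) {a : ℕ} (ha : 0 < a)
    (h : ∀ x : resRing F D, (resConj ϖ)^[a] x = x) : d ≤ a := by
  obtain ⟨s, hs⟩ := exists_pow_eq_iterate_resConj hf hpd hϖ hd hϖπ
  have hQ := card_resRing hd hD hπ hϖ hϖπ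
  have hq : 1 < p ^ f := hf ▸ Finite.one_lt_card
  have h1 (m : ℕ) (x : resRing F D) : x ^ (p ^ f) ^ m = (resConj ϖ)^[s * m] x := by
    induction m with
    | zero => simp
    | succ m ih => rw [pow_succ, pow_mul, ih, hs, ← Function.iterate_add_apply, Nat.mul_succ,
        add_comm]
  have h2 (x : resRing F D) : x ^ (p ^ f) ^ a = x := by
    rw [h1, mul_comm, Function.iterate_mul]
    exact Function.iterate_fixed (h x) s
  have h3 : Nat.card (resRing F D) ≤ (p ^ f) ^ a := by
    classical
    have := Fintype.ofFinite (resRing F D)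
    have hlt : 1 < (p ^ f) ^ a := Nat.one_lt_pow ha.ne' hq
    have h4 := Polynomial.card_roots' (Polynomial.X ^ (p ^ f) ^ a - Polynomial.X : Polynomial (resRing F D))
    rw [FiniteField.X_pow_card_sub_X_natDegree_eq _ hlt] at h4
    rw [Nat.card_eq_fintype_card, ← Finset.card_univ]
    refine (Finset.card_le_card ?_).trans ((Multiset.toFinset_card_le _).trans h4)
    intro x _
    rw [Multiset.mem_toFinset, Polynomial.mem_roots (FiniteField.X_pow_card_sub_X_ne_zero _ hlt)]
    simp [h2]
  rw [hQ, hf] at h3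
  exact (Nat.pow_le_pow_iff_right hq).1 h3

end order
end DivAlg

namespace DivAlg
open ValuativeRel
attribute [local instance] fieldResRing

/-! ### Characters of `I₁` along the congruence filtration. -/

section principalUnits
variable {F D : Type*} [Field F] [ValuativeRel F] [TopologicalSpace F]
  [IsNonarchimedeanLocalField F] [DivisionRing D] [Algebra F D] [FiniteDimensional F D]
  {ϖ : Dˣ}

theorem val_coe_I₁ (u : I₁ F D) : val F D ((u : Dˣ) : D) = 1 := by
  have := (val F D).map_one_add_of_lt ((mem_I₁ _).1 u.2)
  simpa using this

theorem one_add_ne_zero {y : D} (h : val F D y < 1) : 1 + y ≠ 0 := by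
  intro h0
  have := (val F D).map_one_add_of_lt h
  rw [h0] at this
  simp at this

instance : CoeOut (I₁ F D) D := ⟨fun u => ((u : Dˣ) : D)⟩

/-- The element `1 + y` of `I₁`. -/
noncomputable def oneAdd (y : D) (h : val F D y < 1) : I₁ F D :=
  ⟨Units.mk0 (1 + y) (one_add_ne_zero h), by rw [mem_I₁]; simpa using h⟩

@[simp] theorem coe_oneAdd (y : D) (h : val F D y < 1) :
    ((oneAdd y h : I₁ F D) : D) = 1 + y := rfl

theorem I₁_ext {u v : I₁ F D} (h : ((u : Dˣ) : D) = ((v : Dˣ) : D)) : u = v :=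
  Subtype.ext (Units.ext h)

theorem IsDivUniformizer.val_mul_pow_lt (hϖ : IsDivUniformizer (F := F) ϖ) (a : intRing F D)
    {j : ℕ} (hj : j ≠ 0) : val F D ((a : D) * (ϖ : D) ^ j) < 1 := by
  rw [map_mul, map_pow]
  exact mul_lt_one_of_nonneg_of_lt_one_right a.2 zero_le (pow_lt_one₀ zero_le hϖ.1 hj)

theorem IsDivUniformizer.exists_eq_mul_pow {y : D} {j : ℕ}
    (h : val F D y ≤ val F D ϖ ^ j) : ∃ a : intRing F D, y = a * (ϖ : D) ^ j := by
  refine ⟨⟨y * ((ϖ : D) ^ j)⁻¹, ?_⟩, ?_⟩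
  · rw [Valuation.mem_integer_iff, map_mul, map_inv₀, map_pow]
    exact mul_inv_le_one_of_le₀ h zero_le
  · rw [mul_assoc, inv_mul_cancel₀ (pow_ne_zero _ ϖ.ne_zero), mul_one]

end principalUnits

section characters
variable {F D : Type*} [Field F] [ValuativeRel F] [TopologicalSpace F]
  [IsNonarchimedeanLocalField F] [DivisionRing D] [Algebra F D] [FiniteDimensional F D]
  {ϖ : Dˣ} {k : Type*} [Field k]

variable (ϖ) in
/-- The function `φ` vanishes on `1 + ϖ ^ n 𝒪_D`. -/
def VanishesOn (φ : I₁ F D → k) (n : ℕ) : Prop :=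
  ∀ u : I₁ F D, val F D ((u : D) - 1) ≤ val F D ϖ ^ n → φ u = 0

theorem VanishesOn.eq_of_sub_le {φ : I₁ F D → k} (hφ : ∀ x y, φ (x * y) = φ x + φ y) {n : ℕ}
    (hV : VanishesOn ϖ φ n) {u v : I₁ F D} (h : val F D ((u : D) - (v : D)) ≤ val F D ϖ ^ n) :
    φ u = φ v := by
  have h1 : φ (v⁻¹ * u) = 0 := by
    refine hV _ ?_
    have h2 : ((v⁻¹ * u : I₁ F D) : D) - 1 = ((v⁻¹ : I₁ F D) : D) * ((u : D) - v) := by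
      have h3 : ((v⁻¹ : I₁ F D) : D) * (v : D) = 1 := by
        rw [← Units.val_mul, ← Subgroup.coe_mul, inv_mul_cancel]; rfl
      rw [mul_sub, h3]; rfl
    rw [h2, map_mul, val_coe_I₁, one_mul]
    exact h
  have h2 := hφ v (v⁻¹ * u)
  rwa [mul_inv_cancel_left, h1, add_zero] at h2

/-- The product of 1 + aϖ^j and 1 + bϖ^j is 1 + (a+b)ϖ^j up to valuation 2j ≥ j + 1, so φ is
additive in a. -/
theorem VanishesOn.exists_graded {φ : I₁ F D → k} (hφ : ∀ x y, φ (x * y) = φ x + φ y)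
    (hϖ : IsDivUniformizer (F := F) ϖ) {j : ℕ} (hj : j ≠ 0) (hV : VanishesOn ϖ φ (j + 1)) :
    ∃ ψ : resRing F D →+ k, ∀ (a : intRing F D) (u : I₁ F D),
      (u : D) = 1 + (a : D) * (ϖ : D) ^ j → φ u = ψ (Ideal.Quotient.mk (maxIdeal F D) a) := by
  have hg : val F D ϖ ^ (j + j) ≤ val F D ϖ ^ (j + 1) :=
    pow_le_pow_of_le_one zero_le hϖ.1.le (by omega)
  let θ : intRing F D →+ k := AddMonoidHom.mk'
    (fun a => φ (oneAdd _ (hϖ.val_mul_pow_lt a hj))) fun a b => by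
      rw [← hφ]
      refine hV.eq_of_sub_le hφ ?_
      have h : ((oneAdd _ (hϖ.val_mul_pow_lt (a + b) hj) : I₁ F D) : D) -
          ((oneAdd _ (hϖ.val_mul_pow_lt a hj) * oneAdd _ (hϖ.val_mul_pow_lt b hj) : I₁ F D) : D) =
          -(((a : D) * (ϖ : D) ^ j) * ((b : D) * (ϖ : D) ^ j)) := by
        simp only [Subgroup.coe_mul, Units.val_mul, coe_oneAdd, Subring.coe_add]
        noncomm_ring
      rw [h, Valuation.map_neg, map_mul, map_mul, map_mul, map_pow]
      refine le_trans ?_ hg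
      rw [pow_add]
      exact mul_le_mul' (mul_le_of_le_one_left' a.2) (mul_le_of_le_one_left' b.2)
  refine ⟨QuotientAddGroup.lift (maxIdeal F D).toAddSubgroup θ fun a ha => ?_, fun a u hu => ?_⟩
  · refine hV _ ?_
    have ha : val F D a < 1 := ha
    rw [coe_oneAdd, add_sub_cancel_left, map_mul, map_pow, pow_succ' (val F D ϖ)]
    exact mul_le_mul_left (hϖ.2 _ ha) _
  · have h1 : u = oneAdd _ (hϖ.val_mul_pow_lt a hj) := I₁_ext hu
    rw [h1]
    rfl

/-- For x = 1 + aϖ and y = 1 + bϖ^m one has xy ≡ yx(1 + cϖ^(m+1)) modulo ϖ^(m+2), where c reduces to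
aσ(b) - bσ^m(a); and φ(xy) = φ(yx). -/
theorem VanishesOn.graded_commutator {φ : I₁ F D → k} (hφ : ∀ x y, φ (x * y) = φ x + φ y)
    (hϖ : IsDivUniformizer (F := F) ϖ) {m : ℕ} (hm : m ≠ 0) (hV : VanishesOn ϖ φ (m + 1 + 1))
    {ψ : resRing F D →+ k} (hψ : ∀ (a : intRing F D) (u : I₁ F D),
      (u : D) = 1 + (a : D) * (ϖ : D) ^ (m + 1) → φ u = ψ (Ideal.Quotient.mk (maxIdeal F D) a))
    (a b : resRing F D) : ψ (a * resConj ϖ b) = ψ (b * (resConj ϖ)^[m] a) := by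
  obtain ⟨a, rfl⟩ := Ideal.Quotient.mk_surjective a
  obtain ⟨b, rfl⟩ := Ideal.Quotient.mk_surjective b
  rw [resConj_mk, iterate_resConj_mk, ← map_mul, ← map_mul, ← sub_eq_zero, ← map_sub, ← map_sub]
  set c := a * intConj ϖ b - b * (intConj ϖ)^[m] a with hc
  have ha := hϖ.val_mul_pow_lt a one_ne_zero
  have hb := hϖ.val_mul_pow_lt b hm
  have hcv := hϖ.val_mul_pow_lt c (Nat.succ_ne_zero m)
  set x : I₁ F D := oneAdd _ ha with hx
  set y : I₁ F D := oneAdd _ hb with hy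
  set z : I₁ F D := oneAdd _ hcv with hz
  rw [← hψ c z rfl]
  have h1 : φ (x * y) = φ (y * x * z) := by
    refine hV.eq_of_sub_le hφ ?_
    have e1 : ((intConj ϖ b : intRing F D) : D) * (ϖ : D) = (ϖ : D) * b := by
      simpa using coe_iterate_intConj ϖ b 1
    have e2 := coe_iterate_intConj ϖ a m
    have e3 : (c : D) * (ϖ : D) ^ (m + 1) = (a : D) * (ϖ : D) ^ 1 * ((b : D) * (ϖ : D) ^ m) -
        (b : D) * (ϖ : D) ^ m * ((a : D) * (ϖ : D) ^ 1) := by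
      rw [hc]
      push_cast
      rw [sub_mul]
      congr 1
      · rw [pow_succ', mul_assoc, ← mul_assoc _ (ϖ : D), e1, pow_one]; noncomm_ring
      · rw [pow_succ, mul_assoc, ← mul_assoc _ ((ϖ : D) ^ m), e2, pow_one]; noncomm_ring
    have e4 : ((x * y : I₁ F D) : D) - ((y * x * z : I₁ F D) : D) =
        -(((y * x : I₁ F D) : D) - 1) * ((c : D) * (ϖ : D) ^ (m + 1)) := by
      have e5 : ((x * y : I₁ F D) : D) =
          ((y * x : I₁ F D) : D) + (c : D) * (ϖ : D) ^ (m + 1) := by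
        rw [e3]
        simp only [Subgroup.coe_mul, Units.val_mul, hx, hy, coe_oneAdd]
        noncomm_ring
      have e6 : ((y * x * z : I₁ F D) : D) =
          ((y * x : I₁ F D) : D) * (1 + (c : D) * (ϖ : D) ^ (m + 1)) := rfl
      rw [e6, e5]
      noncomm_ring
    rw [e4, map_mul, Valuation.map_neg, pow_succ' _ (m + 1)]
    refine mul_le_mul' (hϖ.2 _ ((mem_I₁ _).1 (y * x).2)) ?_
    rw [map_mul, map_pow]
    exact mul_le_of_le_one_left' c.2
  rw [hφ, hφ, hφ] at h1
  linear_combination -h1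

variable [TopologicalSpace D] [IsTopologicalRing D] [IsModuleTopology F D] [Algebra.IsCentral F D]
  {d : ℕ} {π : 𝒪[F]} {p : ℕ} [Fact p.Prime] {f : ℕ}

/-- A character which is trivial on `1 + ϖ ^ (j + 1) 𝒪_D` and on `1 + π 𝒪_F` is trivial on
`1 + ϖ ^ j 𝒪_D`, for `j ≥ 2`. -/
theorem VanishesOn.pred (hf : Nat.card 𝓀[F] = p ^ f)
    (hpd : Nat.Coprime p d) (hϖ : IsDivUniformizer (F := F) ϖ)
    (hd : d ≠ 0) (hϖπ : (ϖ : D) ^ d = algebraMap F D (π : F))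
    (hD : Module.finrank F D = d ^ 2) (hπ : Irreducible π) (hdk : (d : k) ≠ 0)
    {φ : I₁ F D → k} (hφ : ∀ x y, φ (x * y) = φ x + φ y)
    (hφF : ∀ (u : I₁ F D) (z : F), (u : D) = algebraMap F D z → φ u = 0)
    {m : ℕ} (hm : m ≠ 0) (hV : VanishesOn ϖ φ (m + 1 + 1)) : VanishesOn ϖ φ (m + 1) := by
  obtain ⟨ψ, hψ⟩ := hV.exists_graded hφ hϖ (Nat.succ_ne_zero m)
  have hcomm := hV.graded_commutator hφ hϖ hm hψ
  have hσψ (b : resRing F D) : ψ (resConj ϖ b) = ψ b := by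
    have := hcomm 1 b
    rwa [one_mul, Function.iterate_fixed (map_one _), mul_one] at this
  have hσsurj : Function.Surjective (resConj (F := F) (D := D) ϖ) :=
    Finite.injective_iff_surjective.1 (RingHom.injective _)
  -- Put c = σ(b) in the commutator relation, then apply the σ-invariance of ψ.
  have hmul (a c : resRing F D) : ψ (c * (a - (resConj ϖ)^[m + 1] a)) = 0 := by
    obtain ⟨b, rfl⟩ := hσsurj c
    rw [mul_sub, map_sub, mul_comm _ a, hcomm, ← hσψ (b * _), map_mul,
      ← Function.iterate_succ_apply' (f := resConj ϖ), sub_self]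
  have hψ0 : ∀ x, ψ x = 0 := by
    by_cases hfix : ∀ x : resRing F D, (resConj ϖ)^[m + 1] x = x
    · have hdvd : d ∣ m + 1 := by
        by_contra hnd
        have hr : 0 < (m + 1) % d := Nat.pos_of_ne_zero fun h => hnd (Nat.dvd_of_mod_eq_zero h)
        refine absurd (Nat.mod_lt (m + 1) (Nat.pos_of_ne_zero hd)) (not_lt.2 ?_)
        refine le_of_iterate_resConj_eq hf hpd hϖ hd hϖπ hD hπ hr fun x => ?_
        have h1 := hfix x
        rw [← Nat.mod_add_div (m + 1) d, Function.iterate_add_apply, Function.iterate_mul] at h1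
        rwa [Function.iterate_fixed (iterate_resConj_eq hϖπ x)] at h1
      obtain ⟨e, he⟩ := hdvd
      -- With m + 1 = d e, the element 1 + cϖ^(m+1) = 1 + cπ^e lies in F, where φ vanishes. Thus ψ
      -- kills k_F, and σ-invariance turns ψ(Tr x) = 0 into d ψ(x) = 0.
      have hbase (c : 𝒪[F]) : ψ (baseRes F D c) = 0 := by
        rw [baseRes_apply, ← hψ (intMap F D c) (oneAdd _ (hϖ.val_mul_pow_lt _ (Nat.succ_ne_zero m)))
          rfl]
        refine hφF _ (1 + c * π ^ e) ?_
        rw [coe_oneAdd, Nat.succ_eq_add_one, he, pow_mul, hϖπ, coe_intMap]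
        simp
      intro x
      rcases eq_or_ne x 0 with rfl | hx
      · exact map_zero ψ
      obtain ⟨c, hc⟩ := exists_baseRes_eq_sum hϖ hd hϖπ (Units.mk0 x hx)
      have h1 := hbase c
      have h2 (j : ℕ) : ψ ((resConj ϖ)^[j] x) = ψ x := by
        induction j with
        | zero => rfl
        | succ j ih => rw [Function.iterate_succ_apply', hσψ, ih]
      rw [hc, map_sum] at h1
      simp only [Units.val_mk0, h2, Finset.sum_const, Finset.card_range, nsmul_eq_mul] at h1
      exact (mul_eq_zero.1 h1).resolve_left hdk
    · push Not at hfix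
      obtain ⟨a, ha⟩ := hfix
      intro x
      have h1 := hmul a (x / (a - (resConj ϖ)^[m + 1] a))
      rwa [div_mul_cancel₀ _ (sub_ne_zero.2 ha.symm)] at h1
  intro u hu
  obtain ⟨a, ha⟩ := IsDivUniformizer.exists_eq_mul_pow hu
  rw [hψ a u (by rw [← ha]; abel), hψ0]

/-- A continuous character vanishes on a congruence subgroup. -/
theorem exists_vanishesOn [TopologicalSpace k] [DiscreteTopology k]
    (hϖ : IsDivUniformizer (F := F) ϖ) {φ : I₁ F D → k} (hφ : ∀ x y, φ (x * y) = φ x + φ y) (hc : Continuous φ) :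
    ∃ n, VanishesOn ϖ φ n := by
  have h1 : φ 1 = 0 := by simpa using hφ 1 1
  have h2 : φ ⁻¹' {0} ∈ nhds (1 : I₁ F D) :=
    hc.continuousAt.preimage_mem_nhds ((isOpen_discrete _).mem_nhds h1)
  rw [nhds_subtype, Filter.mem_comap] at h2
  obtain ⟨U, hU, hUφ⟩ := h2
  -- The topology on units is induced from D × Dᵒᵖ, so both u and u⁻¹ have to be close to 1.
  rw [OneMemClass.coe_one, Units.isInducing_embedProduct.nhds_eq_comap, Filter.mem_comap] at hU
  obtain ⟨W, hW, hWU⟩ := hU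
  obtain ⟨A, hA, B, hB, hAB⟩ := mem_nhds_prod_iff.1 hW
  have hA' : (fun y : D => 1 + y) ⁻¹' A ∈ nhds (0 : D) :=
    (continuous_const.add continuous_id).continuousAt.preimage_mem_nhds (by simpa using hA)
  have hB' : (fun y : D => MulOpposite.op (1 + y)) ⁻¹' B ∈ nhds (0 : D) :=
    (MulOpposite.continuous_op.comp
      (continuous_const.add continuous_id)).continuousAt.preimage_mem_nhds (by simpa using hB)
  obtain ⟨z, hz0, hz⟩ := exists_val_le_subset (F := F) (Filter.inter_mem hA' hB')
  have hz1 : val F D (algebraMap F D z) ≠ 0 := by simpa using hz0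
  obtain ⟨n, hn⟩ := exists_pow_lt₀ hϖ.1 (Units.mk0 _ hz1)
  refine ⟨n, fun u hu => hUφ (hWU (hAB ⟨?_, ?_⟩))⟩
  · have h3 := (hz (hu.trans hn.le)).1
    simpa using h3
  · have h4 : val F D (((u⁻¹ : I₁ F D) : D) - 1) ≤ val F D ϖ ^ n := by
      have h5 : ((u⁻¹ : I₁ F D) : D) * (u : D) = 1 := by
        rw [← Units.val_mul, ← Subgroup.coe_mul, inv_mul_cancel]; rfl
      have h6 : ((u⁻¹ : I₁ F D) : D) - 1 = -(((u⁻¹ : I₁ F D) : D) * ((u : D) - 1)) := by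
        rw [mul_sub, h5, mul_one, neg_sub]
      rwa [h6, Valuation.map_neg, map_mul, val_coe_I₁, one_mul]
    have h3 := (hz (h4.trans hn.le)).2
    simpa using h3

theorem vanishesOn_two [TopologicalSpace k] [DiscreteTopology k] (hf : Nat.card 𝓀[F] = p ^ f)
    (hpd : Nat.Coprime p d) (hϖ : IsDivUniformizer (F := F) ϖ)
    (hd : d ≠ 0) (hϖπ : (ϖ : D) ^ d = algebraMap F D (π : F))
    (hD : Module.finrank F D = d ^ 2) (hπ : Irreducible π) (hdk : (d : k) ≠ 0)
    {φ : I₁ F D → k} (hφ : ∀ x y, φ (x * y) = φ x + φ y) (hc : Continuous φ)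
    (hφF : ∀ (u : I₁ F D) (z : F), (u : D) = algebraMap F D z → φ u = 0) :
    VanishesOn ϖ φ 2 := by
  obtain ⟨n, hn⟩ := exists_vanishesOn hϖ hφ hc
  have h1 : VanishesOn ϖ φ (n + 2) := fun u hu =>
    hn u (hu.trans (pow_le_pow_of_le_one zero_le hϖ.1.le (by omega)))
  clear hn
  induction n with
  | zero => exact h1
  | succ n ih =>
    exact ih (VanishesOn.pred hf hpd hϖ hd hϖπ hD hπ hdk hφ hφF (Nat.succ_ne_zero n) h1)

end characters
end DivAlg

namespace DivAlg
open ValuativeRel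
attribute [local instance] fieldResRing

/-! ### Embeddings of a finite field as a basis of its additive characters. -/

section embeddings
variable {κ k : Type*} [Field κ] [Finite κ] [Field k] {p : ℕ} [Fact p.Prime] [CharP κ p]

/-- Any two embeddings of a finite field differ by a power of Frobenius. -/
theorem exists_eq_pow_embedding [Algebra (ZMod p) k] (ι e : κ →+* k) :
    ∃ l : ℕ, ∀ y, e y = ι y ^ p ^ l := by
  let : Algebra (ZMod p) κ := ZMod.algebra κ p
  have : Module.Finite (ZMod p) κ := Module.Finite.of_finite
  let : Algebra κ k := ι.toAlgebra
  have : IsScalarTower (ZMod p) κ k := IsScalarTower.of_algebraMap_eq' (Subsingleton.elim _ _)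
  let e' : κ →ₐ[ZMod p] k :=
    { e with commutes' := fun x => DFunLike.congr_fun (Subsingleton.elim
        (e.comp (algebraMap (ZMod p) κ)) (algebraMap (ZMod p) k)) x }
  -- A finite field is normal over 𝔽_p, so `e` is ι after an automorphism, and every automorphism is
  -- a Frobenius power.
  obtain ⟨l, hl⟩ := (FiniteField.bijective_frobeniusAlgEquivOfAlgebraic_pow (ZMod p) κ).2
    (Normal.algHomEquivAut (ZMod p) k κ e')
  refine ⟨l, fun y => ?_⟩
  have h1 := DFunLike.congr_fun ((Normal.algHomEquivAut (ZMod p) k κ).symm_apply_apply e') y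
  rw [← hl] at h1
  have h2 : ι ((FiniteField.frobeniusAlgEquivOfAlgebraic (ZMod p) κ ^ (l : ℕ)) y) = e y := h1
  rw [← h2, AlgEquiv.coe_pow, FiniteField.coe_frobeniusAlgEquivOfAlgebraic_iterate]
  simp

/-- An additive map from a finite field to an algebraically closed field is zero if it is
orthogonal to all embeddings. -/
theorem eq_zero_of_sum_div_eq_zero [Fintype κˣ] [IsAlgClosed k] [Algebra (ZMod p) k]
    (ψ : κ →+ k) (h : ∀ e : κ →+* k, ∑ y : κˣ, ψ y * (e y)⁻¹ = 0) : ψ = 0 := by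
  classical
  let : Algebra (ZMod p) κ := ZMod.algebra κ p
  have : Module.Finite (ZMod p) κ := Module.Finite.of_finite
  let ψ' : κ →ₗ[ZMod p] k := AddMonoidHom.toZModLinearMap p ψ
  -- By Dedekind the embeddings are independent, and over an algebraically closed field there are as
  -- many as the dimension.
  have hspan := (linearIndependent_toLinearMap (ZMod p) κ k).span_eq_top_of_card_eq_finrank'
    (by rw [AlgHom.card, Module.finrank_linearMap_self])
  have hψ' : ψ' ∈ Submodule.span k (Set.range (AlgHom.toLinearMap : (κ →ₐ[ZMod p] k) → _)) := by
    rw [hspan]; trivial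
  obtain ⟨c, hc⟩ := (Submodule.mem_span_range_iff_exists_fun k).1 hψ'
  have hψc (x : κ) : ψ x = ∑ e, c e * e x := by
    have := DFunLike.congr_fun hc x
    rw [LinearMap.sum_apply] at this
    exact this.symm
  -- Orthogonality of characters of κˣ: only e = e' contributes, with factor |κˣ| = -1.
  have hc0 (e' : κ →ₐ[ZMod p] k) : c e' = 0 := by
    have h1 := h e'
    simp only [hψc, Finset.sum_mul] at h1
    rw [Finset.sum_comm, Finset.sum_eq_single e'] at h1
    · have h2 (y : κˣ) : c e' * e' (y : κ) * ((e' : κ →+* k) (y : κ))⁻¹ = c e' := by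
        have : e' (y : κ) ≠ 0 := (map_ne_zero e').2 y.ne_zero
        exact mul_inv_cancel_right₀ this _
      simp only [h2, Finset.sum_const, Finset.card_univ, nsmul_eq_mul] at h1
      refine (mul_eq_zero.1 h1).resolve_left ?_
      have hcard : ((Fintype.card κˣ : ℕ) : κ) = -1 := by
        have := Fintype.ofFinite κ
        rw [← Nat.card_eq_fintype_card, Nat.card_units, Nat.cast_sub Nat.card_pos,
          Nat.card_eq_fintype_card, Nat.cast_card_eq_zero]
        simp
      have h3 := congrArg e' hcard
      rw [map_natCast, map_neg, map_one] at h3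
      rw [h3]
      exact neg_ne_zero.2 one_ne_zero
    · intro e _ hne
      simp only [mul_assoc]
      rw [← Finset.mul_sum]
      let χ : κˣ →* k :=
        { toFun := fun y => e (y : κ) * ((e' : κ →+* k) (y : κ))⁻¹
          map_one' := by simp
          map_mul' := fun a b => by simp only [Units.val_mul, map_mul, mul_inv]; ring }
      have hχ : χ ≠ 1 := by
        intro hχ
        refine hne (AlgHom.ext fun y => ?_)
        rcases eq_or_ne y 0 with rfl | hy
        · simp
        · have h4 : e y * (e' y)⁻¹ = 1 := DFunLike.congr_fun hχ (Units.mk0 y hy)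
          exact (mul_inv_eq_one₀ ((map_ne_zero e').2 hy)).1 h4
      rw [show ∑ y : κˣ, e (y : κ) * ((e' : κ →+* k) (y : κ))⁻¹ = ∑ y, χ y from rfl,
        sum_hom_units_eq_zero χ hχ, mul_zero]
    · intro h; exact absurd (Finset.mem_univ _) h
  ext x
  simp [hψc, hc0]

end embeddings

/-! ### The order of the characters with respect to σ. -/

section characterOrder
variable {F D : Type*} [Field F] [ValuativeRel F] [TopologicalSpace F]
  [IsNonarchimedeanLocalField F] [DivisionRing D] [Algebra F D] [FiniteDimensional F D]
  [TopologicalSpace D] [IsTopologicalRing D] [IsModuleTopology F D] [Algebra.IsCentral F D]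
  {ϖ : Dˣ} {d : ℕ} {π : 𝒪[F]} {p : ℕ} [Fact p.Prime] {f : ℕ}
  {k : Type*} [Field k] [CharP k p]

/-- The hypothesis says that σ^a(x)/x is fixed by σ. For x not fixed by σ, compare σ^a(x) = c x with
σ^a(1+x) = c'(1+x): unless c = c' = 1, the relation (c - c')x = c' - 1 would make x fixed or be
absurd. -/
theorem iterate_resConj_eq_of_resChar {ι : resRing F D →+* k} {i a : ℕ}
    (h : ∀ x : (resRing F D)ˣ,
      resChar p ϖ ι i (Units.map (resConj ϖ ^ a : resRing F D →+* resRing F D) x) =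
        resChar p ϖ ι i x) (x : resRing F D) : (resConj ϖ)^[a] x = x := by
  have key (x : resRing F D) (hx : x ≠ 0) :
      ∃ c : resRing F D, resConj ϖ c = c ∧ (resConj ϖ)^[a] x = c * x := by
    have h1 := congrArg Units.val (h (Units.mk0 x hx))
    rw [resChar_apply, resChar_apply] at h1
    have h2 := (iterateFrobenius_inj k p i) h1
    set y := (resConj ϖ)^[a] x with hy
    have h3 : ((Units.map (resConj ϖ ^ a : resRing F D →+* resRing F D) (Units.mk0 x hx) :
        (resRing F D)ˣ) : resRing F D) = y := by
      rw [hy, ← RingHom.coe_pow]; rfl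
    have hy0 : y ≠ 0 := by rw [← h3]; exact Units.ne_zero _
    rw [h3, Units.val_mk0, ← map_div₀, ← map_div₀] at h2
    have h4 := ι.injective h2
    have hσx : resConj ϖ x ≠ 0 := by simpa using hx
    refine ⟨y / x, ?_, (div_mul_cancel₀ _ hx).symm⟩
    rw [map_div₀]
    rw [div_eq_div_iff hy0 hx] at h4
    rw [div_eq_div_iff hσx hx, h4, mul_comm]
  by_cases hfix : resConj ϖ x = x
  · exact Function.iterate_fixed hfix a
  · have hx0 : x ≠ 0 := by rintro rfl; exact hfix (map_zero _)
    have hx1 : 1 + x ≠ 0 := by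
      intro h0
      rw [eq_neg_of_add_eq_zero_right h0, map_neg, map_one] at hfix
      exact hfix rfl
    obtain ⟨c, hc, h1⟩ := key x hx0
    obtain ⟨c', hc', h2⟩ := key (1 + x) hx1
    rw [iterate_map_add, Function.iterate_fixed (map_one _), h1] at h2
    have h3 : (c - c') * x = c' - 1 := by linear_combination h2
    have hcc : c = c' := by
      by_contra hne
      have hne' := sub_ne_zero.2 hne
      refine hfix ?_
      rw [eq_div_of_mul_eq hne' ((mul_comm _ _).trans h3), map_div₀, map_sub, map_sub, hc, hc',
        map_one]
    rw [hcc, sub_self, zero_mul] at h3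
    rw [h1, hcc, sub_eq_zero.1 h3.symm, one_mul]

theorem isLeast_resChar (hf : Nat.card 𝓀[F] = p ^ f)
    (hpd : Nat.Coprime p d) (hϖ : IsDivUniformizer (F := F) ϖ)
    (hd : d ≠ 0) (hϖπ : (ϖ : D) ^ d = algebraMap F D (π : F))
    (hD : Module.finrank F D = d ^ 2) (hπ : Irreducible π) (ι : resRing F D →+* k) (i : ℕ) :
    IsLeast {a : ℕ | 0 < a ∧ ∀ x : (resRing F D)ˣ,
      resChar p ϖ ι i (Units.map (resConj ϖ ^ a : resRing F D →+* resRing F D) x) =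
        resChar p ϖ ι i x} d := by
  refine ⟨⟨Nat.pos_of_ne_zero hd, fun x => ?_⟩, fun a ha => ?_⟩
  · congr 1
    refine Units.ext ?_
    change (resConj ϖ ^ d) (x : resRing F D) = x
    rw [RingHom.coe_pow, iterate_resConj_eq hϖπ]
  · exact le_of_iterate_resConj_eq hf hpd hϖ hd hϖπ hD hπ ha.1
      (iterate_resConj_eq_of_resChar ha.2)

end characterOrder

/-! ### The induced representations and their dependence on i modulo f. -/

section induced
variable {F D : Type*} [Field F] [ValuativeRel F] [TopologicalSpace F]
  [IsNonarchimedeanLocalField F] [DivisionRing D] [Algebra F D] [FiniteDimensional F D]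
  {k : Type*} [Field k]

theorem chi_baseToDd (p : ℕ) (ϖ : Dˣ) (ι : resRing F D →+* k) (i : ℕ) (z : Fˣ) :
    chi p ϖ ι i (baseToDd F D z) = 1 :=
  (existsUnique_chi p ϖ ι i).choose_spec.1.1 z

theorem chi_intToDd (p : ℕ) (ϖ : Dˣ) (ι : resRing F D →+* k) (i : ℕ) (u : (intRing F D)ˣ) :
    chi p ϖ ι i (intToDd F D u) =
      resChar p ϖ ι i (Units.map (Ideal.Quotient.mk (maxIdeal F D) : _ →* resRing F D) u) :=
  (existsUnique_chi p ϖ ι i).choose_spec.1.2 u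

theorem coe_intToDd (u : (intRing F D)ˣ) : (intToDd F D u : Dˣ ⧸ I₁ F D) =
    QuotientGroup.mk (Units.map ((intRing F D).subtype : intRing F D →* D) u) := rfl

theorem coe_baseToDd (z : Fˣ) : (baseToDd F D z : Dˣ ⧸ I₁ F D) =
    QuotientGroup.mk (Units.map (algebraMap F D : F →* D) z) := rfl

/-- Two characters of a subgroup which are conjugate in the ambient group have isomorphic
coinduced representations. -/
noncomputable def coindEquivOfConj {G : Type*} [Group G] {H : Subgroup G} (χ χ' : H →* kˣ) (g : G)
    (h₁ : ∀ h : H, ∃ h' : H, g * h = h' * g ∧ χ h' = χ' h)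
    (h₂ : ∀ h : H, ∃ h' : H, g * h' = h * g ∧ χ h = χ' h') :
    (Representation.coind H.subtype (charRep χ)).Equiv
      (Representation.coind H.subtype (charRep χ')) :=
  Representation.Equiv.mk
    { toFun := fun φ => ⟨fun x => φ.1 (g * x), fun h x => by
        obtain ⟨h', e, hχ⟩ := h₁ h
        change φ.1 (g * (h * x)) = χ' h * φ.1 (g * x)
        rw [← mul_assoc, e, mul_assoc, ← hχ]
        exact φ.2 h' (g * x)⟩
      invFun := fun φ => ⟨fun x => φ.1 (g⁻¹ * x), fun h x => by
        obtain ⟨h', e, hχ⟩ := h₂ h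
        change φ.1 (g⁻¹ * (h * x)) = χ h * φ.1 (g⁻¹ * x)
        have e' : g⁻¹ * (h * x) = h' * (g⁻¹ * x) := by
          rw [inv_mul_eq_iff_eq_mul, ← mul_assoc, ← mul_assoc, e, mul_inv_cancel_right]
        rw [e', hχ]
        exact φ.2 h' (g⁻¹ * x)⟩
      left_inv := fun φ => Subtype.ext (funext fun x => by simp)
      right_inv := fun φ => Subtype.ext (funext fun x => by simp)
      map_add' := fun _ _ => rfl
      map_smul' := fun _ _ => rfl }
    fun y => LinearMap.ext fun φ => Subtype.ext (funext fun x => by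
      change φ.1 (g * x * y) = φ.1 (g * (x * y))
      rw [mul_assoc])

theorem resConj_pow (ϖ : Dˣ) (t : ℕ) (x : resRing F D) :
    resConj (ϖ ^ t) x = (resConj ϖ)^[t] x := by
  obtain ⟨a, rfl⟩ := Ideal.Quotient.mk_surjective x
  rw [iterate_resConj_mk, resConj_mk]
  congr 1
  refine Subtype.ext ?_
  have h := coe_iterate_intConj ϖ a t
  change ((ϖ ^ t : Dˣ) : D) * a * (((ϖ ^ t)⁻¹ : Dˣ) : D) = _
  rw [Units.val_pow_eq_pow_val, ← h, ← Units.val_pow_eq_pow_val, Units.mul_inv_cancel_right]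

/-- Conjugation on `𝒪_Dˣ`. -/
noncomputable def intConjUnits (g : Dˣ) : (intRing F D)ˣ →* (intRing F D)ˣ :=
  Units.map (intConj (F := F) g : intRing F D →* intRing F D)

theorem mk_mul_intToDd (g : Dˣ) (u : (intRing F D)ˣ) :
    (QuotientGroup.mk g : Dˣ ⧸ I₁ F D) * (intToDd F D u : Dˣ ⧸ I₁ F D) =
      (intToDd F D (intConjUnits g u) : Dˣ ⧸ I₁ F D) * QuotientGroup.mk g := by
  rw [coe_intToDd, coe_intToDd, ← QuotientGroup.mk_mul, ← QuotientGroup.mk_mul]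
  congr 1
  refine Units.ext ?_
  change (g : D) * ((u : intRing F D) : D) = (g : D) * (u : intRing F D) * ((g⁻¹ : Dˣ) : D) * g
  rw [Units.inv_mul_cancel_right]

theorem mk_mul_baseToDd (g : Dˣ) (z : Fˣ) :
    (QuotientGroup.mk g : Dˣ ⧸ I₁ F D) * (baseToDd F D z : Dˣ ⧸ I₁ F D) =
      (baseToDd F D z : Dˣ ⧸ I₁ F D) * QuotientGroup.mk g := by
  rw [coe_baseToDd, ← QuotientGroup.mk_mul, ← QuotientGroup.mk_mul]
  congr 1
  exact Units.ext (Algebra.commutes _ _).symm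

variable [TopologicalSpace D] [IsTopologicalRing D] [IsModuleTopology F D] [Algebra.IsCentral F D]
  {ϖ : Dˣ} {d : ℕ} {π : 𝒪[F]} {p : ℕ} [Fact p.Prime] {f : ℕ}

theorem pow_pow_eq_iterate {s : ℕ} (hs : ∀ x : resRing F D, x ^ p ^ f = (resConj ϖ)^[s] x)
    (m : ℕ) (x : resRing F D) : x ^ p ^ (f * m) = (resConj ϖ)^[s * m] x := by
  induction m with
  | zero => simp
  | succ m ih =>
    rw [Nat.mul_succ, pow_add, pow_mul, ih, hs, ← Function.iterate_add_apply, Nat.mul_succ,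
      add_comm]

/-- Since σ^(sm) is the q^m-power map, precomposing with it multiplies the exponent p^i by p^(fm).
-/
theorem resChar_add_mul {s : ℕ} (hs : ∀ x : resRing F D, x ^ p ^ f = (resConj ϖ)^[s] x)
    (ι : resRing F D →+* k) (i m : ℕ) (x y : (resRing F D)ˣ)
    (h : (y : resRing F D) = resConj (ϖ ^ (s * m)) x) :
    resChar p ϖ ι i y = resChar p ϖ ι (i + f * m) x := by
  refine Units.ext ?_
  rw [resChar_apply, resChar_apply, h, resConj_pow, ← Function.iterate_succ_apply' (f := resConj ϖ),
    Function.iterate_succ_apply, ← pow_pow_eq_iterate hs, ← pow_pow_eq_iterate hs, map_pow,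
    map_pow, ← div_pow, ← pow_mul, ← pow_add, add_comm]

/-- Conjugation by ϖ^(sm) carries one character to the other, and characters conjugate in the big
group induce isomorphic representations. -/
theorem nonempty_indChi_equiv (hf : Nat.card 𝓀[F] = p ^ f)
    (hpd : Nat.Coprime p d) (hϖ : IsDivUniformizer (F := F) ϖ)
    (hd : d ≠ 0) (hϖπ : (ϖ : D) ^ d = algebraMap F D (π : F)) (ι : resRing F D →+* k)
    {i j : ℕ} (hij : i ≡ j [MOD f]) : Nonempty ((indChi p ϖ ι i).Equiv (indChi p ϖ ι j)) := by
  wlog hle : i ≤ j generalizing i j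
  · exact (this hij.symm (le_of_not_ge hle)).map Representation.Equiv.symm
  obtain ⟨m, hm⟩ := (Nat.modEq_iff_dvd' hle).1 hij
  obtain rfl : j = i + f * m := by omega
  obtain ⟨s, hs⟩ := exists_pow_eq_iterate_resConj hf hpd hϖ hd hϖπ
  set g : Dˣ := ϖ ^ (s * m) with hg
  refine ⟨coindEquivOfConj _ _ (QuotientGroup.mk g) (fun h => ?_) fun h => ?_⟩
  · obtain ⟨⟨z, u⟩, rfl⟩ := prodToDd_surjective h
    refine ⟨prodToDd (z, intConjUnits g u), ?_, ?_⟩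
    · rw [prodToDd_apply, prodToDd_apply, Subgroup.coe_mul, Subgroup.coe_mul, ← mul_assoc,
        mk_mul_baseToDd, mul_assoc, mk_mul_intToDd, mul_assoc]
    · rw [prodToDd_apply, prodToDd_apply, map_mul, map_mul, chi_baseToDd, chi_baseToDd,
        chi_intToDd, chi_intToDd]
      exact congrArg _ (resChar_add_mul hs ι i m _ _ rfl)
  · obtain ⟨⟨z, u⟩, rfl⟩ := prodToDd_surjective h
    have hu : intConjUnits g (intConjUnits g⁻¹ u) = u := by
      refine Units.ext (Subtype.ext ?_)
      change (g : D) * (((g⁻¹ : Dˣ) : D) * (u : intRing F D) * ((g⁻¹⁻¹ : Dˣ) : D)) *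
        ((g⁻¹ : Dˣ) : D) = (u : intRing F D)
      rw [inv_inv, mul_assoc, mul_assoc, mul_assoc, Units.mul_inv, mul_one, Units.mul_inv_cancel_left]
    refine ⟨prodToDd (z, intConjUnits g⁻¹ u), ?_, ?_⟩
    · rw [prodToDd_apply, prodToDd_apply, Subgroup.coe_mul, Subgroup.coe_mul, ← mul_assoc,
        mk_mul_baseToDd, mul_assoc, mk_mul_intToDd, hu, mul_assoc]
    · rw [prodToDd_apply, prodToDd_apply, map_mul, map_mul, chi_baseToDd, chi_baseToDd,
        chi_intToDd, chi_intToDd]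
      nth_rewrite 1 [← hu]
      exact congrArg _ (resChar_add_mul hs ι i m _ _ rfl)

end induced
end DivAlg

namespace DivAlg
open ValuativeRel
attribute [local instance] fieldResRing

/-! ### Restriction to 1 + 𝔪_F, its splitting, and the coefficient functionals. -/

section frobeniusReciprocity
variable {k : Type*} [Field k] {G : Type*} [Group G] {V : Type*} [AddCommGroup V] [Module k V]

/-- Frobenius reciprocity: an equivariant functional gives a map to the coinduced
representation. -/
def coindLift {H : Subgroup G} {χ : H →* kˣ} (ρ : Representation k G V) (l : V →ₗ[k] k)
    (hl : ∀ (h : H) (v : V), l (ρ h v) = χ h * l v) :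
    V →ₗ[k] Representation.coindV H.subtype (charRep χ) where
  toFun v := ⟨fun g => l (ρ g v), fun h g => by
    change l (ρ (h * g) v) = χ h * l (ρ g v)
    rw [map_mul, Module.End.mul_apply, hl]⟩
  map_add' v w := Subtype.ext (funext fun g => by simp)
  map_smul' c v := Subtype.ext (funext fun g => by simp)

end frobeniusReciprocity

section maps
variable (F D : Type u) [Field F] [ValuativeRel F] [TopologicalSpace F]
  [IsNonarchimedeanLocalField F] [DivisionRing D] [Algebra F D] [FiniteDimensional F D]
  [TopologicalSpace D] [IsTopologicalRing D] [IsModuleTopology F D]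

/-- The subgroup `1 + 𝔪_F` of `Fˣ`. -/
noncomputable abbrev principalUnits : Subgroup Fˣ := (valuation F).valuationSubring.principalUnitGroup

variable {F} in
theorem mem_principalUnits {z : Fˣ} :
    z ∈ principalUnits F ↔ valuation F ((z : F) - 1) < 1 := by
  rw [ValuationSubring.mem_principalUnitGroup_iff]
  exact (Valuation.isEquiv_valuation_valuationSubring (valuation F)).lt_one_iff_lt_one.symm

/-- The inclusion `1 + 𝔪_F → I₁`. -/
noncomputable def inclHom : principalUnits F →ₜ* I₁ F D where
  toMonoidHom := ((Units.map (algebraMap F D : F →* D)).comp (principalUnits F).subtype).codRestrict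
    (I₁ F D) fun z => by
      have hz := mem_principalUnits.1 z.2
      rw [mem_I₁]
      change val F D (algebraMap F D ((z : Fˣ) : F) - 1) < 1
      rw [← map_one (algebraMap F D), ← map_sub, val_algebraMap]
      exact pow_lt_one₀ zero_le hz Module.finrank_pos.ne'
  continuous_toFun := by
    refine Continuous.subtype_mk ?_ _
    have h : Continuous (algebraMap F D) := continuous_algebraMap F D
    exact (Continuous.units_map (algebraMap F D : F →* D) h).comp continuous_subtype_val

theorem coe_inclHom (z : principalUnits F) : ((inclHom F D z : I₁ F D) : D) =
    algebraMap F D ((z : Fˣ) : F) := rfl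

/-- The homomorphism `x ↦ N(x) ^ (q - 1)` from `I₁` to `1 + 𝔪_F`. -/
noncomputable def normHom : I₁ F D →ₜ* principalUnits F where
  toMonoidHom := (((powMonoidHom (Nat.card 𝓀[F] - 1)).comp
    (Units.map (Algebra.norm F : D →* F))).comp (I₁ F D).subtype).codRestrict
    (principalUnits F) fun x => by
      have hx : valuation F (Algebra.norm F (x : D)) = 1 := val_coe_I₁ x
      rw [mem_principalUnits]
      change valuation F (Algebra.norm F (x : D) ^ (Nat.card 𝓀[F] - 1) - 1) < 1
      -- The norm is used here only as a unit of 𝒪_F; its (q-1)-th power reduces to 1.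
      let y : 𝒪[F] := ⟨Algebra.norm F (x : D), hx.le⟩
      have h : y ^ (Nat.card 𝓀[F] - 1) - 1 ∈ 𝓂[F] := by
        rw [← IsLocalRing.residue_eq_zero_iff, map_sub, map_pow, map_one, sub_eq_zero]
        have := Fintype.ofFinite 𝓀[F]
        rw [Nat.card_eq_fintype_card]
        refine FiniteField.pow_card_sub_one_eq_one _ fun h => ?_
        rw [IsLocalRing.residue_eq_zero_iff, mem_maximalIdeal_iff] at h
        exact absurd hx h.ne
      exact (mem_maximalIdeal_iff _).1 h
  continuous_toFun := by
    refine Continuous.subtype_mk ?_ _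
    exact ((Continuous.units_map (Algebra.norm F : D →* F) continuous_algebraNorm).comp
      continuous_subtype_val).pow _

theorem coe_normHom (x : I₁ F D) : (((normHom F D x : principalUnits F) : Fˣ) : F) =
    Algebra.norm F (x : D) ^ (Nat.card 𝓀[F] - 1) := rfl

variable (k : Type u) [Field k] [TopologicalSpace k] [DiscreteTopology k]

/-- Restriction to `1 + 𝔪_F`. -/
noncomputable def resMap : H1 k (I₁ F D) →ₗ[k] H1 k (principalUnits F) := H1map k (inclHom F D)

/-- The splitting of the restriction map. -/
noncomputable def splitMap : H1 k (principalUnits F) →ₗ[k] H1 k (I₁ F D) :=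
  ((Module.finrank F D * (Nat.card 𝓀[F] - 1) : ℕ) : k)⁻¹ • H1map k (normHom F D)

variable {k F D} in
theorem contHom_pow {G : Type u} [Group G] [TopologicalSpace G] [IsTopologicalGroup G] {φ : G → k}
    (hφ : φ ∈ contHom k G) (x : G) (n : ℕ) : φ (x ^ n) = n * φ x := by
  induction n with
  | zero => simpa using hφ.2 1 1
  | succ n ih => rw [pow_succ, hφ.2, ih]; push_cast; ring

/-- On central elements N(z) = z^[D:F], so pulling back multiplies a character by [D:F](q-1), which
the definition divides out. -/
theorem resMap_splitMap (h : ((Module.finrank F D * (Nat.card 𝓀[F] - 1) : ℕ) : k) ≠ 0)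
    (c : H1 k (principalUnits F)) : resMap F D k (splitMap F D k c) = c := by
  refine (H1equiv k _).injective (Subtype.ext (funext fun z => ?_))
  rw [splitMap, LinearMap.smul_apply, map_smul, map_smul]
  change _⁻¹ * (H1equiv k _ (H1map k (inclHom F D) (H1map k (normHom F D) c)) :
    principalUnits F → k) z = _
  rw [H1equiv_H1map, H1equiv_H1map]
  have h1 : normHom F D (inclHom F D z) = z ^ (Module.finrank F D * (Nat.card 𝓀[F] - 1)) := by
    refine Subtype.ext (Units.ext ?_)
    rw [coe_normHom, coe_inclHom, Algebra.norm_algebraMap, ← pow_mul]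
    simp
  rw [h1, contHom_pow (H1equiv k _ c).2, inv_mul_cancel_left₀ h]

theorem resMap_conjRep (g : Dˣ) (c : H1 k (I₁ F D)) :
    resMap F D k (conjRep k (I₁ F D) g c) = resMap F D k c := by
  refine (H1equiv k _).injective (Subtype.ext (funext fun z => ?_))
  change (H1equiv k _ (H1map k (inclHom F D) (H1map k (conjHom (I₁ F D) g) c)) :
    principalUnits F → k) z = (H1equiv k _ (H1map k (inclHom F D) c) : principalUnits F → k) z
  rw [H1equiv_H1map, H1equiv_H1map, H1equiv_H1map]
  refine congrArg _ (I₁_ext (F := F) (D := D) ?_)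
  change ((g⁻¹ : Dˣ) : D) * algebraMap F D ((z : Fˣ) : F) * ((g⁻¹⁻¹ : Dˣ) : D) =
    algebraMap F D ((z : Fˣ) : F)
  rw [← Algebra.commutes, mul_assoc, Units.mul_inv, mul_one]

theorem conjRep_splitMap (g : Dˣ) (c : H1 k (principalUnits F)) :
    conjRep k (I₁ F D) g (splitMap F D k c) = splitMap F D k c := by
  rw [splitMap, LinearMap.smul_apply, map_smul]
  congr 1
  refine (H1equiv k _).injective (Subtype.ext (funext fun x => ?_))
  change (H1equiv k _ (H1map k (conjHom (I₁ F D) g) (H1map k (normHom F D) c)) :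
    I₁ F D → k) x = _
  rw [H1equiv_H1map, H1equiv_H1map, H1equiv_H1map]
  have h : normHom F D (conjHom (I₁ F D) g x) = normHom F D x := by
    refine Subtype.ext (Units.ext ?_)
    rw [coe_normHom, coe_normHom]
    refine congrArg (· ^ _) ?_
    change Algebra.norm F (((g⁻¹ : Dˣ) : D) * (x : D) * ((g⁻¹⁻¹ : Dˣ) : D)) = _
    rw [map_mul, map_mul, mul_comm (Algebra.norm F ((g⁻¹ : Dˣ) : D)), mul_assoc, ← map_mul,
      Units.mul_inv, map_one, mul_one]
  rw [h]

/-- The projection to the kernel of the restriction to `1 + 𝔪_F`. -/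
noncomputable def projMap : H1 k (I₁ F D) →ₗ[k] H1 k (I₁ F D) :=
  LinearMap.id - splitMap F D k ∘ₗ resMap F D k

variable {F D k} in
theorem projMap_apply (c : H1 k (I₁ F D)) :
    projMap F D k c = c - splitMap F D k (resMap F D k c) := rfl

theorem projMap_conjRep (g : Dˣ) (c : H1 k (I₁ F D)) :
    projMap F D k (conjRep k (I₁ F D) g c) = conjRep k (I₁ F D) g (projMap F D k c) := by
  rw [projMap_apply, projMap_apply, map_sub, resMap_conjRep, conjRep_splitMap]

variable {F D k} in
theorem projMap_of_resMap_eq_zero {c : H1 k (I₁ F D)} (h : resMap F D k c = 0) :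
    projMap F D k c = c := by
  rw [projMap_apply, h, map_zero, sub_zero]

theorem resMap_projMap (h : ((Module.finrank F D * (Nat.card 𝓀[F] - 1) : ℕ) : k) ≠ 0)
    (c : H1 k (I₁ F D)) : resMap F D k (projMap F D k c) = 0 := by
  rw [projMap_apply, map_sub, resMap_splitMap F D k h, sub_self]

variable {F D k}

/-- The character `φ` of `I₁` factors through `ψ` on `I₁ / I₂ = k_D`. -/
def IsGraded (ϖ : Dˣ) (c : H1 k (I₁ F D)) (ψ : resRing F D →+ k) : Prop :=
  ∀ (a : intRing F D) (u : I₁ F D), (u : D) = 1 + (a : D) * (ϖ : D) →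
    (H1equiv k _ c : I₁ F D → k) u = ψ (Ideal.Quotient.mk (maxIdeal F D) a)

variable {ϖ : Dˣ}

theorem conjRep_apply_I₁ (g : Dˣ) (c : H1 k (I₁ F D)) (u : I₁ F D) :
    (H1equiv k _ (conjRep k (I₁ F D) g c) : I₁ F D → k) u =
      (H1equiv k _ c : I₁ F D → k) (conjHom (I₁ F D) g u) :=
  H1equiv_H1map k (conjHom (I₁ F D) g) c u

theorem coe_conjHom_mul (g : Dˣ) (u : I₁ F D) :
    ((conjHom (I₁ F D) g u : I₁ F D) : D) = ((g⁻¹ : Dˣ) : D) * (u : D) * (g : D) := by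
  change ((g⁻¹ : Dˣ) : D) * (u : D) * ((g⁻¹⁻¹ : Dˣ) : D) = _
  rw [inv_inv]

theorem IsGraded.conj_base {c : H1 k (I₁ F D)} {ψ : resRing F D →+ k} (h : IsGraded ϖ c ψ)
    (z : Fˣ) :
    IsGraded ϖ (conjRep k (I₁ F D) (Units.map (algebraMap F D : F →* D) z) c) ψ := by
  intro a u hu
  rw [conjRep_apply_I₁]
  refine h a _ ?_
  rw [coe_conjHom_mul, ← hu]
  change _ * (u : D) * algebraMap F D z = _
  rw [mul_assoc, ← Algebra.commutes]
  exact Units.inv_mul_cancel_left _ _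

/-- From w⁻¹(1 + aϖ)w = 1 + w⁻¹ a (ϖwϖ⁻¹)ϖ: the residue of a is multiplied by σ(w)/w, the source of
the characters in the theorem. -/
theorem IsGraded.conj_int {c : H1 k (I₁ F D)} {ψ : resRing F D →+ k} (h : IsGraded ϖ c ψ)
    (w : (intRing F D)ˣ) : IsGraded ϖ
      (conjRep k (I₁ F D) (Units.map ((intRing F D).subtype : intRing F D →* D) w) c)
      (ψ.comp (AddMonoidHom.mulLeft
        (resConj ϖ (Ideal.Quotient.mk _ (w : intRing F D)) / (Ideal.Quotient.mk _ (w : intRing F D))))) := by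
  intro a u hu
  have hw : (((w⁻¹ : (intRing F D)ˣ) : intRing F D) : D) * ((w : intRing F D) : D) = 1 :=
    congrArg Subtype.val w.inv_mul
  rw [conjRep_apply_I₁,
    h (((w⁻¹ : (intRing F D)ˣ) : intRing F D) * a * intConj ϖ (w : intRing F D)) _ ?_]
  · have hw' : Ideal.Quotient.mk (maxIdeal F D) ((w⁻¹ : (intRing F D)ˣ) : intRing F D) *
        Ideal.Quotient.mk (maxIdeal F D) (w : intRing F D) = 1 := by
      rw [← map_mul, w.inv_mul, map_one]
    rw [map_mul (Ideal.Quotient.mk _), map_mul (Ideal.Quotient.mk _), resConj_mk,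
      eq_inv_of_mul_eq_one_left hw']
    refine congrArg ψ ?_
    change _ = (_ / _ : resRing F D) * _
    ring
  · rw [coe_conjHom_mul, hu]
    change (((w⁻¹ : (intRing F D)ˣ) : intRing F D) : D) * (1 + (a : D) * (ϖ : D)) *
      ((w : intRing F D) : D) = 1 + (((w⁻¹ : (intRing F D)ˣ) : intRing F D) : D) * (a : D) *
        ((ϖ : D) * ((w : intRing F D) : D) * ((ϖ⁻¹ : Dˣ) : D)) * (ϖ : D)
    rw [mul_add, add_mul, mul_one, hw]
    simp only [mul_assoc, Units.inv_mul, mul_one]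

/-- Any lift b satisfies ϖ^(-j)(1 + (ϖ^j b ϖ^(-j))ϖ)ϖ^j = 1 + bϖ, so ϖ^j acts by precomposition with
σ^(-j). -/
theorem IsGraded.conj_pow (hϖ : IsDivUniformizer (F := F) ϖ) {c : H1 k (I₁ F D)}
    {ψ ψ' : resRing F D →+ k} (h : IsGraded ϖ c ψ) (j : ℕ) (h' : IsGraded ϖ (conjRep k (I₁ F D) (ϖ ^ j) c) ψ')
    (x : resRing F D) : ψ' ((resConj ϖ)^[j] x) = ψ x := by
  obtain ⟨b, rfl⟩ := Ideal.Quotient.mk_surjective x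
  have hb := coe_iterate_intConj ϖ b j
  rw [iterate_resConj_mk, ← h' _ _ (by rw [coe_oneAdd _ (hϖ.val_mul_pow_lt _ one_ne_zero),
    pow_one]), conjRep_apply_I₁]
  refine h b _ ?_
  rw [coe_conjHom_mul, coe_oneAdd, pow_one, mul_add, add_mul, mul_one, Units.inv_mul]
  congr 1
  rw [mul_assoc, mul_assoc, Units.val_pow_eq_pow_val ϖ j, ← pow_succ', pow_succ,
    ← mul_assoc _ _ (ϖ : D), hb, mul_assoc, ← Units.val_pow_eq_pow_val, Units.inv_mul_cancel_left]

variable (ϖ) in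
/-- The functional on `H¹(I₁, k)` that extracts the coefficient of `x ↦ ι(x) ^ (p ^ i)`, up to
sign. -/
noncomputable def coeffMap (p : ℕ) (hϖ : IsDivUniformizer (F := F) ϖ) [Fintype (resRing F D)ˣ]
    (ι : resRing F D →+* k) (i : ℕ) : H1 k (I₁ F D) →ₗ[k] k where
  -- Evaluating at fixed lifts keeps the functional linear in c by construction; the choice of lifts
  -- is immaterial once the projected class is graded.
  toFun c := ∑ y : (resRing F D)ˣ, (H1equiv k _ (projMap F D k c) : I₁ F D → k)
    (oneAdd _ (hϖ.val_mul_pow_lt (Quotient.out (y : resRing F D)) one_ne_zero)) *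
      (ι y ^ p ^ i)⁻¹
  map_add' a b := by
    simp only [map_add, Submodule.coe_add, Pi.add_apply, add_mul, Finset.sum_add_distrib]
  map_smul' a b := by
    simp only [map_smul, Submodule.coe_smul, Pi.smul_apply, smul_eq_mul, RingHom.id_apply,
      Finset.mul_sum, mul_assoc]

theorem coeffMap_eq (p : ℕ) (hϖ : IsDivUniformizer (F := F) ϖ) [Fintype (resRing F D)ˣ]
    (ι : resRing F D →+* k) (i : ℕ) {c : H1 k (I₁ F D)} {ψ : resRing F D →+ k}
    (h : IsGraded ϖ (projMap F D k c) ψ) :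
    coeffMap ϖ p hϖ ι i c = ∑ y : (resRing F D)ˣ, ψ y * (ι y ^ p ^ i)⁻¹ := by
  refine Finset.sum_congr rfl fun y _ => ?_
  rw [h (Quotient.out (y : resRing F D)) _ (by rw [coe_oneAdd, pow_one])]
  congr 2
  exact Quotient.out_eq (y : resRing F D)

section main
variable [Algebra.IsCentral F D] {d : ℕ} {π : 𝒪[F]} {p : ℕ} [Fact p.Prime] {f : ℕ}

theorem exists_isGraded (hf : Nat.card 𝓀[F] = p ^ f)
    (hpd : Nat.Coprime p d) (hϖ : IsDivUniformizer (F := F) ϖ)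
    (hd : d ≠ 0) (hϖπ : (ϖ : D) ^ d = algebraMap F D (π : F))
    (hD : Module.finrank F D = d ^ 2) (hπ : Irreducible π) (hdk : (d : k) ≠ 0)
    {c : H1 k (I₁ F D)} (hc : resMap F D k c = 0) :
    ∃ ψ : resRing F D →+ k, IsGraded ϖ c ψ := by
  have hφ := (H1equiv k _ c).2
  have hφF : ∀ (u : I₁ F D) (z : F), (u : D) = algebraMap F D z →
      (H1equiv k _ c : I₁ F D → k) u = 0 := by
    intro u z hu
    have hz0 : z ≠ 0 := by
      rintro rfl
      rw [map_zero] at hu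
      exact (u : Dˣ).ne_zero hu
    have hz : Units.mk0 z hz0 ∈ principalUnits F := by
      have h1 := (mem_I₁ _).1 u.2
      rw [hu, ← map_one (algebraMap F D), ← map_sub, val_algebraMap] at h1
      exact mem_principalUnits.2 (lt_of_pow_lt_pow_left₀ _ zero_le (by rwa [one_pow]))
    have h2 : u = inclHom F D ⟨_, hz⟩ := I₁_ext (F := F) (D := D) hu
    have h3 := H1equiv_H1map k (inclHom F D) c ⟨_, hz⟩
    rw [h2, ← h3]
    change (H1equiv k _ (resMap F D k c) : principalUnits F → k) _ = 0
    rw [hc, map_zero]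
    rfl
  obtain ⟨ψ, hψ⟩ := (vanishesOn_two hf hpd hϖ hd hϖπ hD hπ hdk hφ.2 hφ.1 hφF).exists_graded
    hφ.2 hϖ one_ne_zero
  exact ⟨ψ, fun a u hu => hψ a u (by rw [hu, pow_one])⟩

/-- Scalars act trivially. A unit `w` replaces ψ(y) by ψ(sy) with s = σ(w)/w, and the substitution y
↦ sy in the sum brings out ι(s)^(p^i). -/
theorem coeffMap_conjRepQuotient (hϖ : IsDivUniformizer (F := F) ϖ) [Fintype (resRing F D)ˣ]
    (ι : resRing F D →+* k) (i : ℕ)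
    (hgr : ∀ c : H1 k (I₁ F D), ∃ ψ : resRing F D →+ k, IsGraded ϖ (projMap F D k c) ψ)
    (h : DdQuotient F D) (c : H1 k (I₁ F D)) :
    coeffMap ϖ p hϖ ι i (conjRepQuotient k (I₁ F D) h c) =
      chi p ϖ ι i h * coeffMap ϖ p hϖ ι i c := by
  obtain ⟨⟨z, w⟩, rfl⟩ := prodToDd_surjective h
  rw [prodToDd_apply, Subgroup.coe_mul, map_mul, map_mul, chi_baseToDd, one_mul, chi_intToDd,
    Module.End.mul_apply, coe_baseToDd, coe_intToDd]
  change coeffMap ϖ p hϖ ι i (conjRep k (I₁ F D) _ (conjRep k (I₁ F D) _ c)) = _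
  obtain ⟨ψ, hψ⟩ := hgr c
  have h1 := (hψ.conj_int w).conj_base z
  rw [← projMap_conjRep, ← projMap_conjRep] at h1
  rw [coeffMap_eq p hϖ ι i h1, coeffMap_eq p hϖ ι i hψ]
  set t := Units.map (Ideal.Quotient.mk (maxIdeal F D) : _ →* resRing F D) w with ht
  set s := Units.map (resConj (F := F) ϖ : resRing F D →* resRing F D) t / t with hs
  rw [Finset.mul_sum]
  conv_rhs => rw [← Equiv.sum_comp (Equiv.mulLeft s)]
  refine Finset.sum_congr rfl fun y _ => ?_
  have e1 : ((s * y : (resRing F D)ˣ) : resRing F D) =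
      resConj ϖ (t : resRing F D) / t * y := by
    rw [Units.val_mul, hs, Units.val_div_eq_div_val]
    rfl
  have e2 : ι (resConj ϖ (t : resRing F D) / t) ≠ 0 := by
    rw [map_ne_zero]
    exact div_ne_zero ((map_ne_zero _).2 t.ne_zero) t.ne_zero
  change ψ (resConj ϖ (t : resRing F D) / t * y) * _ = _
  rw [resChar_apply, Equiv.coe_mulLeft, e1, map_mul ι, ← map_div₀, mul_pow, mul_inv]
  field_simp

end main
end maps
end DivAlg

namespace DivAlg
open ValuativeRel
attribute [local instance] fieldResRing

/-! ### Bijectivity of the coefficient maps and the decomposition. -/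

section main
variable {F D : Type u} [Field F] [ValuativeRel F] [TopologicalSpace F]
  [IsNonarchimedeanLocalField F] [DivisionRing D] [Algebra F D] [FiniteDimensional F D]
  [TopologicalSpace D] [IsTopologicalRing D] [IsModuleTopology F D]
  {k : Type u} [Field k] [TopologicalSpace k] [DiscreteTopology k]
  {ϖ : Dˣ} {d : ℕ} {π : 𝒪[F]} {p : ℕ} [Fact p.Prime] {f : ℕ}

/-- Translating by ϖ^j converts the coefficient at ι^(p^i) into the one at (ι ∘ σ^j)^(p^i), by the
substitution y ↦ σ^j(y). -/
theorem coeffMap_conjRep_pow (hϖ : IsDivUniformizer (F := F) ϖ) [Fintype (resRing F D)ˣ]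
    (ι : resRing F D →+* k) (i j : ℕ)
    (hgr : ∀ c : H1 k (I₁ F D), ∃ ψ : resRing F D →+ k, IsGraded ϖ (projMap F D k c) ψ)
    {c : H1 k (I₁ F D)} {ψ : resRing F D →+ k} (hψ : IsGraded ϖ (projMap F D k c) ψ) :
    coeffMap ϖ p hϖ ι i (conjRep k (I₁ F D) (ϖ ^ j) c) =
      ∑ y : (resRing F D)ˣ, ψ y * (ι ((resConj ϖ)^[j] y) ^ p ^ i)⁻¹ := by
  obtain ⟨ψ', hψ'⟩ := hgr (conjRep k (I₁ F D) (ϖ ^ j) c)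
  have h1 := hψ'
  rw [projMap_conjRep] at h1
  have h2 := hψ.conj_pow hϖ j h1
  rw [coeffMap_eq p hϖ ι i hψ']
  let τ := Units.map ((resConj (F := F) ϖ ^ j : resRing F D →+* resRing F D) :
    resRing F D →* resRing F D)
  have hτ : Function.Injective τ := Units.map_injective (RingHom.injective _)
  have hb : Function.Bijective τ := Finite.injective_iff_bijective.1 hτ
  have hv (y : (resRing F D)ˣ) : ((τ y : (resRing F D)ˣ) : resRing F D) =
      (resConj ϖ)^[j] y := by
    rw [← RingHom.coe_pow]; rfl
  rw [← hb.sum_comp]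
  refine Finset.sum_congr rfl fun y _ => ?_
  rw [hv, h2]

/-- Every embedding of `k_D` is the composition of a power of `σ` with one of the given
embeddings. -/
theorem exists_eq_iterate_resConj_pow [Algebra.IsCentral F D] [Algebra (ZMod p) k]
    (hf : Nat.card 𝓀[F] = p ^ f)
    (hpd : Nat.Coprime p d) (hϖ : IsDivUniformizer (F := F) ϖ)
    (hd : d ≠ 0) (hϖπ : (ϖ : D) ^ d = algebraMap F D (π : F)) (hf0 : f ≠ 0)
    {r : ZMod f → ℕ} (hr : ∀ i, (r i : ZMod f) = i) (ι e : resRing F D →+* k) :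
    ∃ (i : ZMod f) (j : Fin d), ∀ y, e y = ι ((resConj ϖ)^[j] y) ^ p ^ r i := by
  have := charP_resRing (D := D) hf
  obtain ⟨s, hs⟩ := exists_pow_eq_iterate_resConj hf hpd hϖ hd hϖπ
  obtain ⟨l, hl⟩ := exists_eq_pow_embedding (p := p) ι e
  have hper (y : resRing F D) : Function.IsPeriodicPt (resConj (F := F) ϖ) d y :=
    iterate_resConj_eq hϖπ y
  set i : ZMod f := (l : ZMod f) with hi
  -- The representative `r i` may exceed l. Adding a multiple of fd to l is harmless, since
  -- x^(p^(fd)) = x, and makes the difference a nonnegative multiple fm; the remaining q^m-power is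
  -- σ^(sm).
  have hle : r i ≤ l + f * (d * r i) :=
    le_add_left ((Nat.le_mul_of_pos_left _ (Nat.pos_of_ne_zero (mul_ne_zero hf0 hd))).trans
      (mul_assoc _ _ _).le)
  have hmod : r i ≡ l + f * (d * r i) [MOD f] := by
    rw [← ZMod.natCast_eq_natCast_iff, hr]
    simp [hi]
  obtain ⟨m, hm⟩ := (Nat.modEq_iff_dvd' hle).1 hmod
  refine ⟨i, ⟨s * m % d, Nat.mod_lt _ (Nat.pos_of_ne_zero hd)⟩, fun y => ?_⟩
  have h1 : y ^ p ^ (f * (d * r i)) = y := by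
    rw [pow_pow_eq_iterate hs, mul_left_comm]
    exact (hper y).mul_const _
  change _ = ι ((resConj ϖ)^[s * m % d] y) ^ p ^ r i
  rw [(hper y).iterate_mod_apply, ← pow_pow_eq_iterate hs, hl, map_pow, ← pow_mul, ← pow_add]
  conv_lhs => rw [← h1, map_pow, ← pow_mul, ← pow_add]
  congr 2
  omega

/-- The character is u ↦ ψ of the class of (u-1)ϖ⁻¹. It is additive because (u-1)(v-1) is divisible
by ϖ², and it kills 1 + 𝔪_F because π = ϖ^d with d ≥ 2. -/
theorem exists_isGraded_of_addMonoidHom (hϖ : IsDivUniformizer (F := F) ϖ)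
    (hd : 1 < d) (hϖπ : (ϖ : D) ^ d = algebraMap F D (π : F)) (hπ : Irreducible π)
    (ψ : resRing F D →+ k) :
    ∃ c : H1 k (I₁ F D), resMap F D k c = 0 ∧ IsGraded ϖ c ψ := by
  have hv := val_units_pos (F := F) ϖ
  have hex (u : I₁ F D) : ∃ a : intRing F D, (u : D) - 1 = a * (ϖ : D) := by
    have h := hϖ.2 _ ((mem_I₁ _).1 u.2)
    rw [← pow_one (val F D ϖ)] at h
    obtain ⟨a, ha⟩ := IsDivUniformizer.exists_eq_mul_pow h
    exact ⟨a, by rw [ha, pow_one]⟩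
  choose A hA using hex
  have hmk {a b : intRing F D} (h : val F D ((a : D) * ϖ - b * ϖ) < val F D ϖ) :
      Ideal.Quotient.mk (maxIdeal F D) a = Ideal.Quotient.mk (maxIdeal F D) b := by
    rw [← sub_eq_zero, ← map_sub, resRing_mk_eq_zero]
    rw [← sub_mul, map_mul] at h
    exact (mul_lt_iff_lt_one_left hv).1 h
  let φ : I₁ F D → k := fun u => ψ (Ideal.Quotient.mk (maxIdeal F D) (A u))
  have hφ : φ ∈ contHom k (I₁ F D) := by
    refine ⟨?_, fun u v => ?_⟩
    · refine IsLocallyConstant.continuous ((IsLocallyConstant.iff_eventually_eq _).2 fun u => ?_)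
      have ho : IsOpen {v : I₁ F D | val F D ((v : D) - u) < val F D ϖ} :=
        (isOpen_val_lt (F := F) (D := D) (val F D ϖ)).preimage
          ((Units.continuous_val.comp continuous_subtype_val).sub continuous_const)
      filter_upwards [ho.mem_nhds (by simpa using hv)] with v hv'
      refine congrArg ψ (hmk ?_)
      rw [← hA, ← hA, sub_sub_sub_cancel_right]
      exact hv'
    · change ψ _ = ψ _ + ψ _
      rw [← map_add, ← map_add]
      refine congrArg ψ (hmk ?_)
      have h1 : ((A (u * v) : intRing F D) : D) * ϖ - ((A u + A v : intRing F D) : D) * ϖ =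
          ((u : D) - 1) * ((v : D) - 1) := by
        rw [Subring.coe_add, add_mul, ← hA, ← hA, ← hA, Subgroup.coe_mul, Units.val_mul]
        noncomm_ring
      rw [h1, map_mul]
      exact (mul_le_mul_right (hϖ.2 _ ((mem_I₁ _).1 v.2)) _).trans_lt
        ((mul_lt_iff_lt_one_left hv).2 ((mem_I₁ _).1 u.2))
  have hgr : IsGraded ϖ ((H1equiv k _).symm ⟨φ, hφ⟩) ψ := by
    intro a u hu
    rw [LinearEquiv.apply_symm_apply]
    refine congrArg ψ (hmk ?_)
    rw [← hA, hu, add_sub_cancel_left, sub_self, map_zero]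
    exact hv
  refine ⟨_, (H1equiv k _).injective (Subtype.ext (funext fun z => ?_)), hgr⟩
  refine (H1equiv_H1map k (inclHom F D) _ z).trans ?_
  obtain ⟨y, hy⟩ : π ∣ (⟨((z : Fˣ) : F) - 1, (mem_principalUnits.1 z.2).le⟩ : 𝒪[F]) := by
    rw [← Ideal.mem_span_singleton, ← hπ.maximalIdeal_eq, mem_maximalIdeal_iff]
    exact mem_principalUnits.1 z.2
  have hy' : ((z : Fˣ) : F) - 1 = π * y := congrArg Subtype.val hy
  rw [LinearEquiv.apply_symm_apply]
  change ψ _ = (H1equiv k (principalUnits F) 0 : principalUnits F → k) z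
  rw [map_zero]
  refine (congrArg ψ (hmk (b := 0) ?_)).trans ((congrArg ψ (map_zero _)).trans (map_zero ψ))
  rw [← hA, coe_inclHom, ← map_one (algebraMap F D), ← map_sub, hy', map_mul, ← hϖπ]
  have h2 : val F D (algebraMap F D y) ≤ 1 := algebraMap_mem_intRing y.2
  rw [Subring.coe_zero, zero_mul, sub_zero, map_mul, map_pow]
  refine (mul_le_of_le_one_right' h2).trans_lt ?_
  exact pow_lt_self_of_lt_one₀ hv hϖ.1 hd

/-- The coefficients of the conjugates by powers of `ϖ` of a graded character. -/
noncomputable def gradedCoeff (ϖ : Dˣ) (d p : ℕ) [Fintype (resRing F D)ˣ]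
    [Module (ZMod p) (resRing F D)] [Module (ZMod p) k] (ι : resRing F D →+* k) (r : ZMod f → ℕ) :
    (resRing F D →ₗ[ZMod p] k) →ₗ[k] (ZMod f × Fin d → k) where
  toFun ψ ij := ∑ y : (resRing F D)ˣ, ψ y * (ι ((resConj ϖ)^[ij.2] y) ^ p ^ r ij.1)⁻¹
  map_add' a b := funext fun ij => by
    simp only [LinearMap.add_apply, Pi.add_apply, add_mul, Finset.sum_add_distrib]
  map_smul' a b := funext fun ij => by
    simp only [LinearMap.smul_apply, Pi.smul_apply, smul_eq_mul, RingHom.id_apply,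
      Finset.mul_sum, mul_assoc]

variable [Algebra.IsCentral F D]

/-- The indexed embeddings exhaust all embeddings, which gives injectivity; both sides have
dimension fd. -/
theorem bijective_gradedCoeff [Algebra (ZMod p) k] [IsAlgClosed k] [Fintype (resRing F D)ˣ]
    [Algebra (ZMod p) (resRing F D)]
    (hf : Nat.card 𝓀[F] = p ^ f)
    (hpd : Nat.Coprime p d) (hϖ : IsDivUniformizer (F := F) ϖ)
    (hd : d ≠ 0) (hϖπ : (ϖ : D) ^ d = algebraMap F D (π : F))
    (hD : Module.finrank F D = d ^ 2) (hπ : Irreducible π) (hf0 : f ≠ 0)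
    {r : ZMod f → ℕ} (hr : ∀ i, (r i : ZMod f) = i) (ι : resRing F D →+* k) :
    Function.Bijective (gradedCoeff (f := f) ϖ d p ι r) := by
  have := charP_resRing (D := D) hf
  have : NeZero f := ⟨hf0⟩
  have : Module.Finite (ZMod p) (resRing F D) := Module.Finite.of_finite
  have hinj : Function.Injective (gradedCoeff (f := f) ϖ d p ι r) := by
    rw [injective_iff_map_eq_zero]
    intro ψ hψ
    have h0 : (ψ : resRing F D →+ k) = 0 := by
      refine eq_zero_of_sum_div_eq_zero (p := p) _ fun e => ?_
      obtain ⟨i, j, h⟩ := exists_eq_iterate_resConj_pow hf hpd hϖ hd hϖπ hf0 hr ι e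
      simp only [h]
      exact congrFun hψ (i, j)
    exact LinearMap.ext fun y => DFunLike.congr_fun h0 y
  have hcard : Module.finrank (ZMod p) (resRing F D) = f * d := by
    have h1 := Module.natCard_eq_pow_finrank (K := ZMod p) (V := resRing F D)
    rw [card_resRing hd hD hπ hϖ hϖπ, hf, ← pow_mul, Nat.card_zmod] at h1
    exact (Nat.pow_right_injective (Fact.out : p.Prime).two_le h1).symm
  refine ⟨hinj, (LinearMap.injective_iff_surjective_of_finrank_eq_finrank ?_).1 hinj⟩
  rw [Module.finrank_linearMap_self, hcard, Module.finrank_fintype_fun_eq_card, Fintype.card_prod,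
    ZMod.card, Fintype.card_fin]

/-- The powers ϖ^j with j < d represent all cosets of D_d^×. -/
theorem coindV_ext (hϖ : IsDivUniformizer (F := F) ϖ)
    (hd : d ≠ 0) (hϖπ : (ϖ : D) ^ d = algebraMap F D (π : F)) {χ : DdQuotient F D →* kˣ}
    {a b : Representation.coindV (DdQuotient F D).subtype (charRep χ)}
    (h : ∀ j : Fin d, a.1 (QuotientGroup.mk (ϖ ^ (j : ℕ))) = b.1 (QuotientGroup.mk (ϖ ^ (j : ℕ)))) :
    a = b := by
  refine Subtype.ext (funext fun g => ?_)
  obtain ⟨z, rfl⟩ := QuotientGroup.mk_surjective g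
  obtain ⟨w, l, c, hl, hz⟩ := hϖ.exists_eq_mul hd hϖπ z.ne_zero
  have hz' : (QuotientGroup.mk z : Dˣ ⧸ I₁ F D) =
      ((baseToDd F D c * intToDd F D w : DdQuotient F D) : Dˣ ⧸ I₁ F D) *
        QuotientGroup.mk (ϖ ^ l) := by
    rw [Subgroup.coe_mul, coe_baseToDd, coe_intToDd, ← QuotientGroup.mk_mul, ← QuotientGroup.mk_mul]
    refine congrArg _ (Units.ext ?_)
    rw [hz, ← Algebra.commutes, ← mul_assoc]
    simp
  rw [hz']
  have ha := a.2 (baseToDd F D c * intToDd F D w) (QuotientGroup.mk (ϖ ^ l))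
  have hb := b.2 (baseToDd F D c * intToDd F D w) (QuotientGroup.mk (ϖ ^ l))
  refine ha.trans (Eq.trans ?_ hb.symm)
  rw [h ⟨l, hl⟩]

end main
end DivAlg

namespace DivAlg
open ValuativeRel
attribute [local instance] fieldResRing

section main
variable {F D : Type u} [Field F] [ValuativeRel F] [TopologicalSpace F]
  [IsNonarchimedeanLocalField F] [DivisionRing D] [Algebra F D] [FiniteDimensional F D]
  [TopologicalSpace D] [IsTopologicalRing D] [IsModuleTopology F D]
  {k : Type u} [Field k] [TopologicalSpace k] [DiscreteTopology k]
  [Algebra.IsCentral F D]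
  {ϖ : Dˣ} {d : ℕ} {π : 𝒪[F]} {p : ℕ} [Fact p.Prime] {f : ℕ}

/-- The map from `H¹(I₁, k)` to the direct sum of the induced representations. -/
noncomputable def toInduced (hϖ : IsDivUniformizer (F := F) ϖ) [Fintype (resRing F D)ˣ]
    (ι : resRing F D →+* k) (p : ℕ) [Fact p.Prime] (r : ZMod f → ℕ)
    (hgr : ∀ c : H1 k (I₁ F D), ∃ ψ : resRing F D →+ k, IsGraded ϖ (projMap F D k c) ψ) :
    H1 k (I₁ F D) →ₗ[k] ∀ i : ZMod f, Representation.coindV (DdQuotient F D).subtype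
      (charRep (chi p ϖ ι (r i))) :=
  LinearMap.pi fun i => coindLift (conjRepQuotient k (I₁ F D)) (coeffMap ϖ p hϖ ι (r i))
    (coeffMap_conjRepQuotient hϖ ι (r i) hgr)

theorem toInduced_apply (hϖ : IsDivUniformizer (F := F) ϖ) [Fintype (resRing F D)ˣ]
    (ι : resRing F D →+* k) (r : ZMod f → ℕ)
    (hgr : ∀ c : H1 k (I₁ F D), ∃ ψ : resRing F D →+ k, IsGraded ϖ (projMap F D k c) ψ)
    (c : H1 k (I₁ F D)) (i : ZMod f) (g : Dˣ ⧸ I₁ F D) :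
    (toInduced hϖ ι p r hgr c i).1 g =
      coeffMap ϖ p hϖ ι (r i) (conjRepQuotient k (I₁ F D) g c) := rfl

theorem toInduced_splitMap (hϖ : IsDivUniformizer (F := F) ϖ) [Fintype (resRing F D)ˣ]
    (ι : resRing F D →+* k) (r : ZMod f → ℕ)
    (hN : ((Module.finrank F D * (Nat.card 𝓀[F] - 1) : ℕ) : k) ≠ 0)
    (hgr : ∀ c : H1 k (I₁ F D), ∃ ψ : resRing F D →+ k, IsGraded ϖ (projMap F D k c) ψ)
    (c : H1 k (principalUnits F)) : toInduced hϖ ι p r hgr (splitMap F D k c) = 0 := by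
  refine funext fun i => Subtype.ext (funext fun g => ?_)
  obtain ⟨g, rfl⟩ := QuotientGroup.mk_surjective g
  rw [toInduced_apply]
  change coeffMap ϖ p hϖ ι (r i) (conjRep k (I₁ F D) g (splitMap F D k c)) = 0
  have h0 : IsGraded ϖ (projMap F D k (splitMap F D k c)) 0 := by
    intro a u _
    rw [projMap_apply, resMap_splitMap F D k hN, sub_self, map_zero]
    rfl
  rw [conjRep_splitMap, coeffMap_eq p hϖ ι (r i) h0]
  simp

theorem toInduced_pow (hϖ : IsDivUniformizer (F := F) ϖ) [Fintype (resRing F D)ˣ]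
    [Algebra (ZMod p) (resRing F D)] [Algebra (ZMod p) k]
    (ι : resRing F D →+* k) (r : ZMod f → ℕ)
    (hgr : ∀ c : H1 k (I₁ F D), ∃ ψ : resRing F D →+ k, IsGraded ϖ (projMap F D k c) ψ)
    {c : H1 k (I₁ F D)} {ψ : resRing F D →ₗ[ZMod p] k}
    (hψ : IsGraded ϖ (projMap F D k c) (ψ : resRing F D →+ k)) (i : ZMod f) (j : Fin d) :
    (toInduced hϖ ι p r hgr c i).1 (QuotientGroup.mk (ϖ ^ (j : ℕ))) =
      gradedCoeff ϖ d p ι r ψ (i, j) :=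
  coeffMap_conjRep_pow hϖ ι (r i) j hgr hψ

/-- On the kernel of restriction the values at the ϖ^j are the graded coefficients, so
`bijective_gradedCoeff` applies; the image of `splitMap` supplies the other summand and is killed by
`toInduced`. -/
theorem bijective_resMap_prod_toInduced [Algebra (ZMod p) k] [IsAlgClosed k]
    [Fintype (resRing F D)ˣ]
    (hf : Nat.card 𝓀[F] = p ^ f) (hpd : Nat.Coprime p d) (hϖ : IsDivUniformizer (F := F) ϖ)
    (hd : 1 < d) (hϖπ : (ϖ : D) ^ d = algebraMap F D (π : F))
    (hD : Module.finrank F D = d ^ 2) (hπ : Irreducible π) (hf0 : f ≠ 0)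
    {r : ZMod f → ℕ} (hr : ∀ i, (r i : ZMod f) = i) (ι : resRing F D →+* k)
    (hN : ((Module.finrank F D * (Nat.card 𝓀[F] - 1) : ℕ) : k) ≠ 0)
    (hgr : ∀ c : H1 k (I₁ F D), ∃ ψ : resRing F D →+ k, IsGraded ϖ (projMap F D k c) ψ) :
    Function.Bijective ((resMap F D k).prod (toInduced hϖ ι p r hgr)) := by
  have := charP_resRing (D := D) hf
  let : Algebra (ZMod p) (resRing F D) := ZMod.algebra (resRing F D) p
  have hd0 : d ≠ 0 := by omega
  have hb := bijective_gradedCoeff hf hpd hϖ hd0 hϖπ hD hπ hf0 hr ι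
  constructor
  · rw [injective_iff_map_eq_zero]
    intro c hc
    obtain ⟨h1, h2⟩ := Prod.ext_iff.1 hc
    obtain ⟨ψ, hψ⟩ := hgr c
    let ψ' : resRing F D →ₗ[ZMod p] k := AddMonoidHom.toZModLinearMap p ψ
    have hψ0 : ψ' = 0 := by
      refine hb.1 (funext fun ij => ?_)
      rw [← toInduced_pow hϖ ι r hgr (ψ := ψ') hψ]
      have h3 : toInduced hϖ ι p r hgr c = 0 := h2
      rw [h3, map_zero]
      rfl
    rw [projMap_of_resMap_eq_zero h1] at hψ
    refine (H1equiv k _).injective (Subtype.ext (funext fun u => ?_))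
    obtain ⟨a, ha⟩ := IsDivUniformizer.exists_eq_mul_pow (ϖ := ϖ) (j := 1)
      ((hϖ.2 _ ((mem_I₁ _).1 u.2)).trans_eq (pow_one _).symm)
    rw [hψ a u (by rw [← pow_one (ϖ : D), ← ha, add_sub_cancel]), map_zero]
    exact DFunLike.congr_fun hψ0 _
  · rintro ⟨x, b⟩
    obtain ⟨ψ, hψ⟩ := hb.2 fun ij => (b ij.1).1 (QuotientGroup.mk (ϖ ^ (ij.2 : ℕ)))
    obtain ⟨c, hc, hcψ⟩ := exists_isGraded_of_addMonoidHom (k := k) hϖ hd hϖπ hπ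
      (ψ : resRing F D →+ k)
    refine ⟨splitMap F D k x + c, Prod.ext ?_ ?_⟩
    · change resMap F D k (splitMap F D k x + c) = x
      rw [map_add, hc, add_zero, resMap_splitMap F D k hN]
    · change toInduced hϖ ι p r hgr (splitMap F D k x + c) = b
      rw [map_add, toInduced_splitMap hϖ ι r hN, zero_add]
      refine funext fun i => coindV_ext hϖ hd0 hϖπ fun j => ?_
      rw [toInduced_pow hϖ ι r hgr (ψ := ψ) (by rwa [projMap_of_resMap_eq_zero hc]), hψ]

theorem nonempty_conjRepQuotient_equiv [Algebra (ZMod p) k] [CharP k p] [IsAlgClosed k]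
    (hf : Nat.card 𝓀[F] = p ^ f) (hpd : Nat.Coprime p d) (hϖ : IsDivUniformizer (F := F) ϖ)
    (hd : 1 < d) (hϖπ : (ϖ : D) ^ d = algebraMap F D (π : F))
    (hD : Module.finrank F D = d ^ 2) (hπ : Irreducible π)
    {r : ZMod f → ℕ} (hr : ∀ i, (r i : ZMod f) = i) (ι : resRing F D →+* k) :
    Nonempty ((conjRepQuotient k (I₁ F D)).Equiv
        ((Representation.trivial k (Dˣ ⧸ I₁ F D) (H1 k (principalUnits F))).prod
          (Representation.directSum fun i : ZMod f => indChi p ϖ ι (r i)))) := by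
  have hf0 : f ≠ 0 := by
    rintro rfl
    rw [pow_zero] at hf
    exact (Finite.one_lt_card (α := 𝓀[F])).ne' hf
  have : NeZero f := ⟨hf0⟩
  have : Fintype (resRing F D)ˣ := Fintype.ofFinite _
  have hdk : (d : k) ≠ 0 := by
    rw [Ne, CharP.cast_eq_zero_iff k p]
    intro h
    exact (Fact.out : p.Prime).one_lt.ne' (Nat.eq_one_of_dvd_coprimes hpd dvd_rfl h)
  -- Modulo p the integer d²(q-1) is -d².
  have hN : ((Module.finrank F D * (Nat.card 𝓀[F] - 1) : ℕ) : k) ≠ 0 := by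
    rw [hD, hf, Nat.cast_mul, Nat.cast_pow, Nat.cast_sub (Nat.one_le_pow _ _ (NeZero.pos p)),
      Nat.cast_pow, CharP.cast_eq_zero k p, zero_pow hf0, Nat.cast_one, zero_sub]
    simpa using hdk
  have hgr (c : H1 k (I₁ F D)) := exists_isGraded hf hpd hϖ (by omega) hϖπ hD hπ hdk
    (resMap_projMap F D k hN c)
  let e := (LinearEquiv.ofBijective _ (bijective_resMap_prod_toInduced hf hpd hϖ hd hϖπ hD hπ hf0
    hr ι hN hgr)).trans (LinearEquiv.prodCongr (LinearEquiv.refl k _)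
      (DirectSum.linearEquivFunOnFintype k (ZMod f) fun i => Representation.coindV
        (DdQuotient F D).subtype (charRep (chi p ϖ ι (r i)))).symm)
  refine ⟨Representation.Equiv.mk e fun g => LinearMap.ext fun c => Prod.ext ?_ ?_⟩
  · obtain ⟨g, rfl⟩ := QuotientGroup.mk_surjective g
    exact resMap_conjRep F D k g c
  · refine DFinsupp.ext fun i => Subtype.ext (funext fun x => ?_)
    change coeffMap ϖ p hϖ ι (r i) (conjRepQuotient k (I₁ F D) x (conjRepQuotient k (I₁ F D) g c)) =
      coeffMap ϖ p hϖ ι (r i) (conjRepQuotient k (I₁ F D) (x * g) c)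
    rw [map_mul]
    rfl

end main
end DivAlg

theorem mainTheorem5
    (p : ℕ) [Fact p.Prime]
    -- a non-archimedean local field `F` with residue field of cardinality `p ^ f`
    (F : Type u) [Field F] [ValuativeRel F] [TopologicalSpace F] [IsNonarchimedeanLocalField F]
    (f : ℕ) (hf : Nat.card 𝓀[F] = p ^ f)
    -- a central division algebra `D` of degree `d > 1` over `F`, with its natural topology
    (D : Type u) [DivisionRing D] [Algebra F D] [FiniteDimensional F D] [Algebra.IsCentral F D]
    [TopologicalSpace D] [IsTopologicalRing D] [IsModuleTopology F D]
    (d : ℕ) (hd : 1 < d) (hD : Module.finrank F D = d ^ 2)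
    -- `p > d e + 1` in the `p`-adic case, `gcd(p, d) = 1` in the function field case
    (hp : (CharZero F ∧ ∃ e : ℕ, Ideal.span {(p : 𝒪[F])} = 𝓂[F] ^ e ∧ d * e + 1 < p) ∨
      (CharP F p ∧ Nat.Coprime p d))
    -- uniformizers `π` of `F` and `ϖ` of `D` with `ϖ ^ d = π`
    (π : 𝒪[F]) (hπ : Irreducible π)
    (ϖ : Dˣ) (hϖ : IsDivUniformizer (F := F) ϖ) (hϖπ : (ϖ : D) ^ d = algebraMap F D (π : F))
    -- a discrete algebraic closure `k` of `𝔽_p` and an embedding of `k_D` into it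
    (k : Type u) [Field k] [Algebra (ZMod p) k] [IsAlgClosure (ZMod p) k]
    [TopologicalSpace k] [DiscreteTopology k]
    (ι : resRing F D →+* k) :
    -- the decomposition, for every choice `r` of representatives of `ℤ / f ℤ`
    (∀ r : ZMod f → ℕ, (∀ i : ZMod f, (r i : ZMod f) = i) →
      Nonempty ((conjRepQuotient k (I₁ F D)).Equiv
        ((Representation.trivial k (Dˣ ⧸ I₁ F D)
            (H1 k (valuation F).valuationSubring.principalUnitGroup)).prod
          (Representation.directSum fun i : ZMod f => indChi p ϖ ι (r i))))) ∧
    -- up to isomorphism the induced representations depend only on `i` modulo `f`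
    (∀ i j : ℕ, i ≡ j [MOD f] → Nonempty ((indChi p ϖ ι i).Equiv (indChi p ϖ ι j))) ∧
    -- the character `x ↦ (σ(x) / x) ^ (p ^ i)` has order `d` with respect to `σ`
    (∀ i : ℕ, IsLeast {a : ℕ | 0 < a ∧ ∀ x : (resRing F D)ˣ,
      resChar p ϖ ι i (Units.map (resConj ϖ ^ a : resRing F D →+* resRing F D) x) =
        resChar p ϖ ι i x} d) := by
  have hpd : Nat.Coprime p d := by
    rcases hp with ⟨-, e, he, hlt⟩ | ⟨-, h⟩
    -- As p lies in 𝔪_F, the exponent e is at least 1, so p > de + 1 gives p > d.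
    · have he0 : e ≠ 0 := by
        rintro rfl
        have h1 : Ideal.span {(p : 𝒪[F])} ≤ 𝓂[F] :=
          (Ideal.span_singleton_le_iff_mem _).2 (natCast_mem_maximalIdeal hf)
        rw [he, pow_zero, Ideal.one_eq_top, top_le_iff] at h1
        exact Ideal.IsPrime.ne_top' h1
      have hle := Nat.le_mul_of_pos_right d (Nat.pos_of_ne_zero he0)
      exact Nat.coprime_of_lt_prime (by omega) (by omega) Fact.out
    · exact h
  have : IsAlgClosed k := IsAlgClosure.isAlgClosed (ZMod p)
  have : CharP k p := charP_of_injective_algebraMap (algebraMap (ZMod p) k).injective p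
  have hd0 : d ≠ 0 := by omega
  exact ⟨fun r hr => nonempty_conjRepQuotient_equiv hf hpd hϖ hd hϖπ hD hπ hr ι,
    fun i j hij => nonempty_indChi_equiv hf hpd hϖ hd0 hϖπ ι hij,
    fun i => isLeast_resChar hf hpd hϖ hd0 hϖπ hD hπ ι i⟩
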